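/- Let $n\ge 0$ be an integer and let $\alpha>0$ be an element of an ordered field $K$ (for instance a positive real number, or the indeterminate of $\mathbb{Q}(\alpha)$, ordered so that $\alpha>0$). For a partition $\lambda=(\lambda_1\ge\lambda_2\ge\dots)\vdash n$ let $\ell(\lambda)$ be its number of parts, $m_i(\lambda)$ the number of its parts equal to $i$, $z_\lambda=\prod_i i^{m_i(\lambda)}m_i(\lambda)!$ and $h_\lambda(\alpha)=\prod_{s\in\lambda}(\alpha a(s)+l(s)+1)$, where $a(s)$ and $l(s)$ are the arm length and the leg length of the box $s$ of the Young diagram of $\lambda$ (the numbers of boxes of the diagram to the east and to the south of $s$). Let $m_\lambda$ and $p_\lambda$ be the monomial and power sum symmetric functions in infinitely many variables, with coefficients in $K$, and let $\langle\cdot,\cdot\rangle_\alpha$ be the bilinear form with $\langle p_\lambda,p_\mu\rangle_\alpha=\alpha^{\ell(\lambda)}z_\lambda\delta_{\lambda\mu}$. Write $\mu<\lambda$ if $\mu\ne\lambda$ and $\mu_1+\dots+\mu_i\le\lambda_1+\dots+\lambda_i$ for all $i\ge1$. Let $(J^\alpha_\beta)_{\beta\vdash n}$ be the Jack symmetric functions,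 characterized by the two properties: they are pairwise orthogonal for $\langle\cdot,\cdot\rangle_\alpha$, and $J^\alpha_\lambda=h_\lambda(\alpha)m_\lambda+\sum_{\mu<\lambda}u^\alpha_{\lambda\mu}m_\mu$ for some scalars $u^\alpha_{\lambda\mu}\in K$. For $\lambda^1,\dots,\lambda^s\vdash n$ the Jack connection coefficient $a_{\lambda^1,\dots,\lambda^s}(\alpha)$ is the coefficient of $\prod_{i}p_{\lambda^i}(x^i)$ in the power sum expansion of $$\sum_{\beta\vdash n}\frac{1}{\langle J^\alpha_\beta,J^\alpha_\beta\rangle_\alpha}\prod_{i=1}^s J^\alpha_\beta(x^i),$$ where $x^1,\dots,x^s$ are independent sets of variables. For $r\ge 0$ let $a^r_\lambda(\alpha)=a_{\lambda,\rho,\dots,\rho}(\alpha)$ with $\rho=[1^{n-2}2^1]$ appearing $r$ times. Theorem. For every partition $\lambda\vdash n$ and every integer $r\ge 0$ with $r<r_\lambda:=n-\ell(\lambda)$, we have $a^r_\lambda(\alpha)=0$. -/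

import Mathlib

namespace JackConnection

open Classical in
/-- The power sum `p_k = ∑_i x_i ^ k` (for `k ≥ 1`) in the variables `x_0, x_1, x_2, …`, as a formal
power series: the coefficient of a monomial is `1` if it is `x_i ^ k` for some `i`, and `0`
otherwise. -/
noncomputable def powerSum (K : Type*) [Field K] (k : ℕ) : MvPowerSeries ℕ K :=
  fun d => if ∃ i : ℕ, d = Finsupp.single i k then 1 else 0

/-- The power sum symmetric function `p_lam = ∏_i p_{lam_i}`. -/
noncomputable def powerSumPart (K : Type*) [Field K] {n : ℕ} (lam : n.Partition) :
    MvPowerSeries ℕ K :=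
  (lam.parts.map (powerSum K)).prod

/-- The monomial symmetric function `m_mu`: the sum of all distinct monomials whose multiset of
nonzero exponents is the multiset of parts of `mu`. -/
noncomputable def monomialSymm (K : Type*) [Field K] {n : ℕ} (mu : n.Partition) :
    MvPowerSeries ℕ K :=
  fun d => if d.support.val.map d = mu.parts then 1 else 0

/-- The number `ℓ(lam)` of parts. -/
def length {n : ℕ} (lam : n.Partition) : ℕ := lam.parts.card

/-- `z_lam = ∏_i i ^ m_i(lam) * m_i(lam)!`. -/
def zee {n : ℕ} (lam : n.Partition) : ℕ :=
  ∏ i ∈ lam.parts.toFinset, i ^ lam.parts.count i * (lam.parts.count i).factorial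

/-- The parts `lam_1 ≥ lam_2 ≥ …` in decreasing order. -/
def rows {n : ℕ} (lam : n.Partition) : List ℕ := lam.parts.sort (· ≥ ·)

/-- The dominance order, strict version: `mu < lam` if `mu ≠ lam` and
`mu_1 + ⋯ + mu_i ≤ lam_1 + ⋯ + lam_i` for all `i`. -/
def DominatedBy {n : ℕ} (mu lam : n.Partition) : Prop :=
  mu ≠ lam ∧ ∀ i : ℕ, ((rows mu).take i).sum ≤ ((rows lam).take i).sum

/-- The Young diagram whose `i`-th row has `lam_i` boxes. -/
def diagram {n : ℕ} (lam : n.Partition) : YoungDiagram :=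
  YoungDiagram.ofRowLens (rows lam) (lam.parts.pairwise_sort (· ≥ ·)).sortedGE

/-- The number of boxes to the east of `s` (rows and columns are numbered from `0`). -/
def arm (Y : YoungDiagram) (s : ℕ × ℕ) : ℕ := Y.rowLen s.1 - (s.2 + 1)

/-- The number of boxes to the south of `s` (rows and columns are numbered from `0`). -/
def leg (Y : YoungDiagram) (s : ℕ × ℕ) : ℕ := Y.colLen s.2 - (s.1 + 1)

/-- `h_lam(α) = ∏_{s ∈ lam} (α a(s) + l(s) + 1)`. -/
def hook {K : Type*} [Field K] (α : K) {n : ℕ} (lam : n.Partition) : K :=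
  ∏ s ∈ (diagram lam).cells, (α * (arm (diagram lam) s : K) + (leg (diagram lam) s : K) + 1)

open Classical in
/-- `[p_lam] f`: the coefficient of `p_lam` in the power sum expansion of the degree `n` homogeneous
symmetric function `f`. The expansion exists and is unique, since the `p_lam` with `lam ⊢ n` are a
basis of the space of these functions; the value for other `f` is the dummy value `0`. -/
noncomputable def powerSumCoeff {K : Type*} [Field K] {n : ℕ} (f : MvPowerSeries ℕ K)
    (lam : n.Partition) : K :=
  if h : ∃ c : n.Partition → K, f = ∑ mu, c mu • powerSumPart K mu then h.choose lam else 0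

/-- The scalar product with `⟨p_lam, p_mu⟩_α = α ^ ℓ(lam) * z_lam * δ_{lam, mu}` on homogeneous
symmetric functions of degree `n`. -/
noncomputable def jackInner {K : Type*} [Field K] (α : K) (n : ℕ) (f g : MvPowerSeries ℕ K) : K :=
  ∑ lam : n.Partition,
    α ^ length lam * (zee lam : K) * powerSumCoeff f lam * powerSumCoeff g lam

/-- `J` is the family of the Jack symmetric functions `J_lam^α` with `lam ⊢ n`: they are pairwise
orthogonal for `⟨·,·⟩_α`, and `J_lam^α = h_lam(α) m_lam + ∑_{mu < lam} u_{lam, mu} m_mu` with some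
scalars `u_{lam, mu}`, where `<` is the dominance order. -/
def IsJackFamily {K : Type*} [Field K] (α : K) {n : ℕ}
    (J : n.Partition → MvPowerSeries ℕ K) : Prop :=
  (∀ lam mu : n.Partition, lam ≠ mu → jackInner α n (J lam) (J mu) = 0) ∧
  ∃ u : n.Partition → n.Partition → K,
    (∀ lam mu : n.Partition, ¬ DominatedBy mu lam → u lam mu = 0) ∧
    ∀ lam : n.Partition,
      J lam = hook α lam • monomialSymm K lam + ∑ mu, u lam mu • monomialSymm K mu

/-- The Jack connection coefficient `a_{L 1, …, L s}(α)`, i.e. the coefficient of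
`∏_i p_{L i}(x^i)` in `∑_{β ⊢ n} (1 / ⟨J_β, J_β⟩_α) ∏_i J_β(x^i)`, for `s` independent alphabets
`x^1, …, x^s`. As the alphabets are independent, the coefficient of `∏_i p_{L i}(x^i)` in
`∏_i J_β(x^i)` is the product of the coefficients of the `p_{L i}` in `J_β`. -/
noncomputable def connectionCoeff {K : Type*} [Field K] (α : K) {n : ℕ}
    (J : n.Partition → MvPowerSeries ℕ K) {s : ℕ} (L : Fin s → n.Partition) : K :=
  ∑ β : n.Partition, 1 / jackInner α n (J β) (J β) * ∏ i, powerSumCoeff (J β) (L i)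

/-- The partition `[1^(n-2) 2]` of `n`, for `n ≥ 2`. There is no such partition for `n < 2`, and the
value is then a dummy. -/
def rho (n : ℕ) : n.Partition :=
  if hn : 2 ≤ n then
    { parts := 2 ::ₘ Multiset.replicate (n - 2) 1
      parts_pos := by
        intro i hi
        rcases Multiset.mem_cons.1 hi with h | h
        · omega
        · have := Multiset.eq_of_mem_replicate h
          omega
      parts_sum := by
        simp only [Multiset.sum_cons, Multiset.sum_replicate, smul_eq_mul]
        omega }
  else Nat.Partition.indiscrete n

/-- `a^r_lam(α) = a_{lam, ρ, …, ρ}(α)` with `ρ = [1^(n-2) 2]` appearing `r` times. -/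
noncomputable def connectionCoeffRho {K : Type*} [Field K] (α : K) {n : ℕ}
    (J : n.Partition → MvPowerSeries ℕ K) (r : ℕ) (lam : n.Partition) : K :=
  connectionCoeff α J (Fin.cons lam (fun _ : Fin r => rho n) : Fin (r + 1) → n.Partition)

end JackConnection

/-! Write `c β μ` for the coefficient of `p_μ` in `J_β`. The connection coefficient is then the
spectral sum `∑_β c β λ * c β ρ ^ r / ⟨J_β, J_β⟩`. The numbers `c β ρ` are, up to an affine change,
the eigenvalues of the Laplace–Beltrami operator `D`, a second order differential operator in the
power sums: `D J_β = (2 c β ρ + α n) J_β` (`laplaceBeltrami_powerComb`, `energy_eq`). Since the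
coefficient of `p_1^n` in every `J_β` is `1` (`apply_ones`), `p_1^n = α^n n! ∑_β J_β / ⟨J_β, J_β⟩`.
Hence the coefficient of `p_λ` in `(D - α n)^r p_1^n` is a nonzero multiple of the spectral sum. In
power sums `D` either merges two factors, splits one, or keeps the product, so each application
loses at most one factor (`laplaceBeltrami_mem_lengthSpan`). Starting from the `n` factors of
`p_1^n`, no `p_λ` with fewer than `n - r` parts can appear (`sum_pow_eq_zero`).

That `J_β` is an eigenvector follows from orthogonality, self-adjointness of `D` and triangularity
of `D` in the monomial basis. Dominance is replaced throughout by a coarser comparison, the size of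
the eigenvalue (`energy`).

The hard input is `apply_ones`, which depends on the normalization by hooks. It is the leading
coefficient, as a polynomial in `N`, of the principal specialization `J_λ(1^N)` (`sum_mul_pow`).
This is computed with nonsymmetric Jack polynomials, the joint eigenvectors of the Cherednik
operators `Y_i`. They are built from `1` by two intertwiners, adjacent swaps (`isNonsymJack_swap`)
and an affine rotation (`isNonsymJack_raise`), whose effect on the value at `(1, …, 1)` is explicit
(`JackValue.of_stages`). The operator `∑_i Y_i ^ 2` commutes with permutations and acts on symmetric
polynomials as `α D` plus a constant (`sum_cherednik_cherednik_powerSumEval`), which identifies the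
symmetrization of a nonsymmetric Jack polynomial with a multiple of `J_λ` (`hook_smul_symmetrize`).
-/

open MvPolynomial in
theorem JackConnection.X_sub_X_dvd {K σ : Type*} [Field K] [DecidableEq σ] (i j : σ)
    (f : MvPolynomial σ K) : (X i - X j) ∣ f - rename (Equiv.swap i j) f := by
  induction f using MvPolynomial.induction_on with
  | C a => simp
  | add p q hp hq =>
    rw [map_add, add_sub_add_comm]
    exact dvd_add hp hq
  | mul_X p k hp =>
    have h : (X i - X j : MvPolynomial σ K) ∣ X k - X (Equiv.swap i j k) := by
      rcases eq_or_ne k i with rfl | hi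
      · simp
      rcases eq_or_ne k j with rfl | hj
      · rw [Equiv.swap_apply_right]
        exact (dvd_sub_comm).1 dvd_rfl
      · rw [Equiv.swap_apply_of_ne_of_ne hi hj]
        simp
    have : p * X k - rename (Equiv.swap i j) (p * X k)
        = (p - rename (Equiv.swap i j) p) * X k
          + rename (Equiv.swap i j) p * (X k - X (Equiv.swap i j k)) := by
      rw [map_mul, rename_X]
      ring
    rw [this]
    exact dvd_add (hp.mul_right _) (h.mul_left _)

namespace JackConnection

/-! ### Divided differences. -/

section DividedDifference

open MvPolynomial

theorem X_sub_X_ne_zero {K σ : Type*} [Field K] {i j : σ} (h : i ≠ j) : (X i - X j : MvPolynomial σ K) ≠ 0 :=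
  sub_ne_zero.2 fun e => h (X_injective e)

variable {K σ : Type*} [Field K] [DecidableEq σ]

/-- The divided difference operator `f ↦ (f - s_{ij} f) / (x_i - x_j)`. -/
noncomputable def divDiff (i j : σ) : MvPolynomial σ K →ₗ[K] MvPolynomial σ K :=
  -- For `i = j` the divisor is zero and the quotient is not unique, so linearity could not be
  -- proved by cancellation; `0` is a convention.
  if h : i = j then 0 else
    { toFun := fun f => (X_sub_X_dvd i j f).choose
      map_add' := fun f g => by
        apply mul_left_cancel₀ (X_sub_X_ne_zero (K := K) h)
        rw [mul_add, ← (X_sub_X_dvd i j (f + g)).choose_spec, ← (X_sub_X_dvd i j f).choose_spec,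
          ← (X_sub_X_dvd i j g).choose_spec, map_add]
        ring
      map_smul' := fun c f => by
        apply mul_left_cancel₀ (X_sub_X_ne_zero (K := K) h)
        rw [RingHom.id_apply, mul_smul_comm, ← (X_sub_X_dvd i j (c • f)).choose_spec,
          ← (X_sub_X_dvd i j f).choose_spec, map_smul, smul_sub] }

theorem X_sub_X_mul_divDiff (i j : σ) (f : MvPolynomial σ K) :
    (X i - X j) * divDiff i j f = f - rename (Equiv.swap i j) f := by
  unfold divDiff
  split_ifs with h
  · subst h
    simp
  · exact (X_sub_X_dvd i j f).choose_spec.symm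

theorem divDiff_eq_of {i j : σ} (h : i ≠ j) {f g : MvPolynomial σ K}
    (hg : (X i - X j) * g = f - rename (Equiv.swap i j) f) : divDiff i j f = g :=
  mul_left_cancel₀ (X_sub_X_ne_zero (K := K) h) ((X_sub_X_mul_divDiff i j f).trans hg.symm)

theorem divDiff_mul (i j : σ) (f g : MvPolynomial σ K) :
    divDiff i j (f * g) = divDiff i j f * g + rename (Equiv.swap i j) f * divDiff i j g := by
  rcases eq_or_ne i j with rfl | h
  · simp [divDiff]
  apply divDiff_eq_of h
  have hf := X_sub_X_mul_divDiff i j f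
  have hg := X_sub_X_mul_divDiff i j g
  rw [map_mul]
  linear_combination g * hf + rename (Equiv.swap i j) f * hg

theorem divDiff_mul_of_rename_eq (i j : σ) (f : MvPolynomial σ K) {g : MvPolynomial σ K}
    (hg : rename (Equiv.swap i j) g = g) : divDiff i j (f * g) = divDiff i j f * g := by
  have h0 : divDiff i j g = 0 := by
    rcases eq_or_ne i j with rfl | h
    · simp [divDiff]
    · exact divDiff_eq_of h (by rw [hg]; simp)
  rw [divDiff_mul, h0, mul_zero, add_zero]

theorem rename_divDiff (e : Equiv.Perm σ) (i j : σ) (f : MvPolynomial σ K) :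
    rename e (divDiff i j f) = divDiff (e i) (e j) (rename e f) := by
  rcases eq_or_ne i j with rfl | h
  · simp [divDiff]
  symm
  apply divDiff_eq_of (e.injective.ne h)
  have := congrArg (rename e) (X_sub_X_mul_divDiff i j f)
  rw [map_mul, map_sub, rename_X, rename_X, map_sub] at this
  rw [this, rename_rename, rename_rename]
  congr 2
  ext x
  simp [Equiv.swap_apply_def]
  grind

theorem divDiff_X_left {i j : σ} (h : i ≠ j) : divDiff i j (X i : MvPolynomial σ K) = 1 :=
  divDiff_eq_of h (by simp)

theorem divDiff_X_right {i j : σ} (h : i ≠ j) : divDiff i j (X j : MvPolynomial σ K) = -1 :=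
  divDiff_eq_of h (by simp)

theorem divDiff_X_pow {i j : σ} (h : i ≠ j) (k : ℕ) :
    divDiff i j (X i ^ k : MvPolynomial σ K)
      = ∑ t ∈ Finset.range k, X i ^ t * X j ^ (k - 1 - t) :=
  divDiff_eq_of h (by rw [mul_comm, geom_sum₂_mul]; simp)

end DividedDifference

/-! ### Cherednik operators and the degenerate Hecke relations. -/

section Cherednik

open MvPolynomial

variable {K : Type*} [Field K] {N : ℕ}

/-- The contribution of the index `j` to the Cherednik operator of index `i`. -/
noncomputable def dunklTerm (i j : Fin N) : MvPolynomial (Fin N) K →ₗ[K] MvPolynomial (Fin N) K :=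
  if i < j then LinearMap.mulLeft K (X j) ∘ₗ divDiff i j
  else if j < i then LinearMap.mulLeft K (X i) ∘ₗ divDiff i j
  else 0

theorem dunklTerm_of_lt {i j : Fin N} (h : i < j) (f : MvPolynomial (Fin N) K) :
    dunklTerm i j f = X j * divDiff i j f := by
  simp [dunklTerm, h]

theorem dunklTerm_of_gt {i j : Fin N} (h : j < i) (f : MvPolynomial (Fin N) K) :
    dunklTerm i j f = X i * divDiff i j f := by
  simp [dunklTerm, h, h.not_gt]

@[simp] theorem dunklTerm_self (i : Fin N) (f : MvPolynomial (Fin N) K) :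
    dunklTerm i i f = 0 := by
  simp [dunklTerm]

/-- The Cherednik operator
`α x_i ∂_i + ∑_{j > i} x_j N_{ij} + ∑_{j < i} x_i N_{ij} - i`. -/
noncomputable def cherednik (α : K) (i : Fin N) :
    MvPolynomial (Fin N) K →ₗ[K] MvPolynomial (Fin N) K :=
  α • (LinearMap.mulLeft K (X i) ∘ₗ (pderiv i).toLinearMap) + ∑ j, dunklTerm i j
    - (i.val : K) • LinearMap.id

theorem cherednik_apply (α : K) (i : Fin N) (f : MvPolynomial (Fin N) K) :
    cherednik α i f = α • (X i * pderiv i f) + ∑ j, dunklTerm i j f - (i.val : K) • f := by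
  simp [cherednik]

/-- The term is `x_{max i j}` times a divided difference, so the order of the two indices is its
only asymmetry, and a permutation preserving that order intertwines the terms. -/
theorem rename_dunklTerm_of_lt_iff (e : Equiv.Perm (Fin N)) {i j : Fin N}
    (h : i < j ↔ e i < e j) (f : MvPolynomial (Fin N) K) :
    rename e (dunklTerm i j f) = dunklTerm (e i) (e j) (rename e f) := by
  rcases lt_trichotomy i j with hij | rfl | hij
  · rw [dunklTerm_of_lt hij, dunklTerm_of_lt (h.1 hij), map_mul, rename_X, rename_divDiff]
  · simp
  · have : e j < e i :=
      lt_of_le_of_ne (not_lt.1 fun h' => hij.not_gt (h.2 h')) (e.injective.ne hij.ne)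
    rw [dunklTerm_of_gt hij, dunklTerm_of_gt this, map_mul, rename_X, rename_divDiff]

theorem rename_X_mul_pderiv (e : Equiv.Perm (Fin N)) (i : Fin N) (f : MvPolynomial (Fin N) K) :
    rename e (X i * pderiv i f) = X (e i) * pderiv (e i) (rename e f) := by
  rw [map_mul, rename_X, pderiv_rename e.injective]

/-- The degenerate Hecke relation `s_i Y_i = Y_{i+1} s_i + 1`. -/
theorem rename_swap_cherednik (α : K) {i k : Fin N} (hk : k.val = i.val + 1)
    (f : MvPolynomial (Fin N) K) :
    rename (Equiv.swap i k) (cherednik α i f)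
      = cherednik α k (rename (Equiv.swap i k) f) + f := by
  have hik : i < k := Fin.lt_def.2 (by omega)
  have hne : k ≠ i := hik.ne'
  rw [cherednik_apply, cherednik_apply, map_sub, map_add, map_smul, map_smul, map_sum,
    rename_X_mul_pderiv, Equiv.swap_apply_left]
  -- Only the term `j = k` has its order reversed by the swap; its defect is `f - s f`. The part `-
  -- s f` is absorbed by the passage from the constant `-i` to `-(i + 1)`, which leaves the summand
  -- `f`.
  have hT : ∑ j, rename (Equiv.swap i k) (dunklTerm i j f)
      = ∑ j, dunklTerm k j (rename (Equiv.swap i k) f)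
        + (f - rename (Equiv.swap i k) f) := by
    rw [← Equiv.sum_comp (Equiv.swap i k) fun j => dunklTerm k j (rename (Equiv.swap i k) f),
      ← sub_eq_iff_eq_add', ← Finset.sum_sub_distrib, Finset.sum_eq_single k]
    · rw [dunklTerm_of_lt hik, Equiv.swap_apply_right, dunklTerm_of_gt hik, map_mul, rename_X,
        rename_divDiff, Equiv.swap_apply_right, Equiv.swap_apply_left, ← sub_mul]
      have := X_sub_X_mul_divDiff k i (rename (Equiv.swap i k) f)
      rw [rename_rename, Equiv.swap_comm k i] at this
      have h2 : rename (Equiv.swap i k ∘ Equiv.swap i k) f = f := by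
        have : (Equiv.swap i k ∘ Equiv.swap i k : Fin N → Fin N) = id := by ext; simp
        rw [this, rename_id_apply]
      rw [h2] at this
      linear_combination -this
    · intro j _ hj
      rcases eq_or_ne j i with rfl | hji
      · simp
      · rw [sub_eq_zero]
        have h1 : Equiv.swap i k j = j := Equiv.swap_apply_of_ne_of_ne hji hj
        have := rename_dunklTerm_of_lt_iff (Equiv.swap i k) (i := i) (j := j) (by
          rw [Equiv.swap_apply_left, h1, Fin.lt_def, Fin.lt_def]
          have : j.val ≠ k.val := fun h => hj (Fin.ext h)
          omega) f
        rw [this, Equiv.swap_apply_left, h1]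
    · simp
  rw [hT, hk]
  push_cast
  rw [add_smul, one_smul]
  ring

/-- `s_i` commutes with `Y_j` for `j ≠ i, i + 1`. -/
theorem rename_swap_cherednik_of_ne (α : K) {i k j : Fin N} (hk : k.val = i.val + 1)
    (hji : j ≠ i) (hjk : j ≠ k) (f : MvPolynomial (Fin N) K) :
    rename (Equiv.swap i k) (cherednik α j f) = cherednik α j (rename (Equiv.swap i k) f) := by
  have h1 : Equiv.swap i k j = j := Equiv.swap_apply_of_ne_of_ne hji hjk
  rw [cherednik_apply, cherednik_apply, map_sub, map_add, map_smul, map_smul, map_sum,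
    rename_X_mul_pderiv, h1,
    ← Equiv.sum_comp (Equiv.swap i k) fun l => dunklTerm j l (rename (Equiv.swap i k) f)]
  congr 2
  refine Finset.sum_congr rfl fun l _ => ?_
  rw [rename_dunklTerm_of_lt_iff, h1]
  rw [h1]
  have hji' : j.val ≠ i.val := fun h => hji (Fin.ext h)
  have hjk' : j.val ≠ k.val := fun h => hjk (Fin.ext h)
  rw [Equiv.swap_apply_def]
  split_ifs with h2 h3
  · subst h2
    simp only [Fin.lt_def]
    omega
  · subst h3
    simp only [Fin.lt_def]
    omega
  · rfl

end Cherednik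

end JackConnection
namespace JackConnection

/-! ### The affine intertwiner. -/

section AffineIntertwiner

open MvPolynomial

variable {K : Type*} [Field K] {M : ℕ}

/-- The affine operator `f ↦ x_M f(x_M, x_0, …, x_{M-1})`. -/
noncomputable def affineRaise :
    MvPolynomial (Fin (M + 1)) K →ₗ[K] MvPolynomial (Fin (M + 1)) K :=
  LinearMap.mulLeft K (X (Fin.last M)) ∘ₗ (rename (finRotate (M + 1)).symm).toLinearMap

theorem affineRaise_apply (f : MvPolynomial (Fin (M + 1)) K) :
    affineRaise f = X (Fin.last M) * rename (finRotate (M + 1)).symm f := rfl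

theorem finRotate_lt_iff {i j : Fin (M + 1)} (hi : i ≠ Fin.last M) (hj : j ≠ Fin.last M) :
    finRotate (M + 1) i < finRotate (M + 1) j ↔ i < j := by
  have hi' : i.val < M := Fin.val_lt_last hi
  have hj' : j.val < M := Fin.val_lt_last hj
  rw [Fin.lt_def, Fin.lt_def, coe_finRotate_of_ne_last hi, coe_finRotate_of_ne_last hj]
  omega

theorem rename_finRotate_symm_divDiff (i j : Fin (M + 1)) (f : MvPolynomial (Fin (M + 1)) K) :
    rename (finRotate (M + 1)).symm (divDiff (finRotate (M + 1) i) (finRotate (M + 1) j) f)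
      = divDiff i j (rename (finRotate (M + 1)).symm f) := by
  rw [rename_divDiff, Equiv.symm_apply_apply, Equiv.symm_apply_apply]

theorem divDiff_X_mul_of_ne {N : ℕ} {i j l : Fin N} (hi : l ≠ i) (hj : l ≠ j)
    (g : MvPolynomial (Fin N) K) : divDiff i j (X l * g) = X l * divDiff i j g := by
  rw [mul_comm, divDiff_mul_of_rename_eq, mul_comm]
  rw [rename_X, Equiv.swap_apply_of_ne_of_ne hi hj]

/-- The rotation preserves the order of all pairs not involving the last index, which it sends to
`0`. For `j` the last index, the twisted Leibniz rule applied to the factor `x_M` produces the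
correction; it matches the difference of the constants `-i` and `-(i + 1)` in the Cherednik
operators. -/
theorem dunklTerm_affineRaise_of_ne {i : Fin (M + 1)} (hi : i ≠ Fin.last M) (j : Fin (M + 1))
    (f : MvPolynomial (Fin (M + 1)) K) :
    dunklTerm i j (affineRaise f)
      = affineRaise (dunklTerm (finRotate (M + 1) i) (finRotate (M + 1) j) f)
        - if j = Fin.last M then affineRaise f else 0 := by
  rw [affineRaise_apply, affineRaise_apply]
  have hlt : i < Fin.last M := Fin.lt_last_iff_ne_last.2 hi
  have h0 : (0 : Fin (M + 1)) < finRotate (M + 1) i := by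
    rw [Fin.lt_def, coe_finRotate_of_ne_last hi]
    exact Nat.succ_pos _
  rcases eq_or_ne j (Fin.last M) with rfl | hj
  · rw [dunklTerm_of_lt hlt, finRotate_last, dunklTerm_of_gt h0, map_mul (rename _), rename_X,
      Equiv.symm_apply_apply, if_pos rfl, divDiff_mul, divDiff_X_right hi, rename_X,
      Equiv.swap_apply_right]
    rw [← finRotate_last, rename_finRotate_symm_divDiff]
    ring
  · rw [if_neg hj, sub_zero]
    rcases lt_trichotomy i j with h | rfl | h
    · rw [dunklTerm_of_lt h, dunklTerm_of_lt ((finRotate_lt_iff hi hj).2 h), map_mul (rename _), rename_X,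
        Equiv.symm_apply_apply, rename_finRotate_symm_divDiff, divDiff_X_mul_of_ne hi.symm hj.symm]
      ring
    · simp
    · rw [dunklTerm_of_gt h, dunklTerm_of_gt ((finRotate_lt_iff hj hi).2 h), map_mul (rename _), rename_X,
        Equiv.symm_apply_apply, rename_finRotate_symm_divDiff, divDiff_X_mul_of_ne hi.symm hj.symm]
      ring

theorem dunklTerm_last_affineRaise (j : Fin (M + 1)) (f : MvPolynomial (Fin (M + 1)) K) :
    dunklTerm (Fin.last M) j (affineRaise f)
      = affineRaise (dunklTerm 0 (finRotate (M + 1) j) f)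
        + if j = Fin.last M then 0 else affineRaise f := by
  rw [affineRaise_apply, affineRaise_apply]
  rcases eq_or_ne j (Fin.last M) with rfl | hj
  · simp
  · have h0 : (0 : Fin (M + 1)) < finRotate (M + 1) j := by
      rw [Fin.lt_def, coe_finRotate_of_ne_last hj]
      exact Nat.succ_pos _
    rw [if_neg hj, dunklTerm_of_gt (Fin.lt_last_iff_ne_last.2 hj), dunklTerm_of_lt h0, map_mul (rename _),
      rename_X, Equiv.symm_apply_apply, divDiff_mul, divDiff_X_left hj.symm, rename_X,
      Equiv.swap_apply_left, ← finRotate_last, rename_finRotate_symm_divDiff]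
    ring

theorem cherednik_affineRaise_of_ne (α : K) {i : Fin (M + 1)} (hi : i ≠ Fin.last M)
    (f : MvPolynomial (Fin (M + 1)) K) :
    cherednik α i (affineRaise f) = affineRaise (cherednik α (finRotate (M + 1) i) f) := by
  rw [cherednik_apply, cherednik_apply, map_sub, map_add, map_smul, map_smul, map_sum,
    coe_finRotate_of_ne_last hi]
  simp_rw [dunklTerm_affineRaise_of_ne hi]
  rw [Finset.sum_sub_distrib, Finset.sum_ite_eq' , if_pos (Finset.mem_univ _),
    Equiv.sum_comp (finRotate (M + 1))
      fun j => affineRaise (dunklTerm (finRotate (M + 1) i) j f)]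
  have : X i * pderiv i (affineRaise f)
      = affineRaise (X (finRotate (M + 1) i) * pderiv (finRotate (M + 1) i) f) := by
    rw [affineRaise_apply, affineRaise_apply, rename_X_mul_pderiv, Equiv.symm_apply_apply,
      pderiv_mul, pderiv_X_of_ne hi.symm]
    ring
  rw [this]
  push_cast
  rw [add_smul, one_smul]
  ring

/-- Each of the `M` other indices contributes one extra copy of `affineRaise f`, which together
cancel the constant `-M`; the derivative of the factor `x_M` gives the shift by `α`. -/
theorem cherednik_last_affineRaise (α : K) (f : MvPolynomial (Fin (M + 1)) K) :
    cherednik α (Fin.last M) (affineRaise f) = affineRaise (cherednik α 0 f + α • f) := by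
  rw [cherednik_apply, cherednik_apply, map_add, map_sub, map_add, map_smul, map_smul, map_sum]
  simp_rw [dunklTerm_last_affineRaise]
  rw [Finset.sum_add_distrib, Equiv.sum_comp (finRotate (M + 1))
      fun j => affineRaise (dunklTerm 0 j f)]
  have h1 : X (Fin.last M) * pderiv (Fin.last M) (affineRaise f)
      = affineRaise (X 0 * pderiv 0 f) + affineRaise f := by
    rw [affineRaise_apply, affineRaise_apply, rename_X_mul_pderiv, ← finRotate_last,
      Equiv.symm_apply_apply, pderiv_mul, pderiv_X_self]
    ring
  have h2 : ∑ j : Fin (M + 1), (if j = Fin.last M then 0 else affineRaise f)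
      = (M : K) • affineRaise f := by
    rw [Fin.sum_univ_castSucc]
    simp [Fin.castSucc_ne_last, Nat.cast_smul_eq_nsmul]
  rw [h1, h2]
  simp only [Fin.val_last, map_smul, smul_add, Fin.val_zero, Nat.cast_zero, zero_smul]
  ring

end AffineIntertwiner

/-! ### Ranks of entries and the joint spectrum. -/

section Spectrum

variable {N : ℕ}

/-- `j` precedes `i` if the entry of index `j` is larger, or equal and to the left. -/
def Precedes (η : Fin N → ℕ) (j i : Fin N) : Prop := η i < η j ∨ η i = η j ∧ j < i

instance (η : Fin N → ℕ) : DecidableRel (Precedes η) := fun _ _ => instDecidableOr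

/-- The number of indices preceding `i`. -/
def rank (η : Fin N → ℕ) (i : Fin N) : ℕ := (Finset.univ.filter fun j => Precedes η j i).card

theorem Precedes.trans {η : Fin N → ℕ} {a b c : Fin N} (h : Precedes η a b)
    (h' : Precedes η b c) : Precedes η a c := by
  unfold Precedes at *
  omega

theorem precedes_irrefl (η : Fin N → ℕ) (a : Fin N) : ¬ Precedes η a a := by
  unfold Precedes
  omega

theorem precedes_or (η : Fin N → ℕ) {a b : Fin N} (h : a ≠ b) :
    Precedes η a b ∨ Precedes η b a := by
  unfold Precedes
  have : a.val ≠ b.val := fun e => h (Fin.ext e)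
  simp only [Fin.lt_def]
  omega

theorem Precedes.rank_lt {η : Fin N → ℕ} {a b : Fin N} (h : Precedes η a b) :
    rank η a < rank η b := by
  refine Finset.card_lt_card ⟨fun j hj => ?_, fun hsub => ?_⟩
  · simp only [Finset.mem_filter, Finset.mem_univ, true_and] at hj ⊢
    exact hj.trans h
  · have := hsub (Finset.mem_filter.2 ⟨Finset.mem_univ a, h⟩)
    exact precedes_irrefl η a (Finset.mem_filter.1 this).2

theorem rank_injective (η : Fin N → ℕ) : Function.Injective (rank η) := by
  intro a b h
  by_contra hne
  rcases precedes_or η hne with h' | h'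
  · exact h'.rank_lt.ne h
  · exact h'.rank_lt.ne' h

theorem rank_lt (η : Fin N → ℕ) (i : Fin N) : rank η i < N := by
  have : (Finset.univ.filter fun j => Precedes η j i).card < (Finset.univ : Finset (Fin N)).card :=
    Finset.card_lt_card ⟨Finset.subset_univ _, fun hsub =>
      precedes_irrefl η i (Finset.mem_filter.1 (hsub (Finset.mem_univ i))).2⟩
  simpa [rank] using this

theorem sum_rank {β : Type*} [AddCommMonoid β] (η : Fin N → ℕ) (g : ℕ → β) :
    ∑ i, g (rank η i) = ∑ i : Fin N, g i := by
  have hb : Function.Bijective fun i => (⟨rank η i, rank_lt η i⟩ : Fin N) :=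
    Finite.injective_iff_bijective.1 fun a b h => rank_injective η (Fin.ext_iff.1 h)
  exact Function.Bijective.sum_comp hb fun i : Fin N => g i

theorem prod_rank {β : Type*} [CommMonoid β] (η : Fin N → ℕ) (g : ℕ → β) :
    ∏ i, g (rank η i) = ∏ i : Fin N, g i := by
  have hb : Function.Bijective fun i => (⟨rank η i, rank_lt η i⟩ : Fin N) :=
    Finite.injective_iff_bijective.1 fun a b h => rank_injective η (Fin.ext_iff.1 h)
  exact Function.Bijective.prod_comp hb fun i : Fin N => g i

/-- The eigenvalue of the Cherednik operator of index `i` on the nonsymmetric Jack polynomial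
indexed by `η`. -/
def spec {K : Type*} [Field K] (α : K) (η : Fin N → ℕ) (i : Fin N) : K := α * η i - rank η i

variable {K : Type*} [Field K] [LinearOrder K] [IsStrictOrderedRing K] {α : K}

theorem Precedes.spec_lt (hα : 0 < α) {η : Fin N → ℕ} {a b : Fin N} (h : Precedes η a b) :
    spec α η b < spec α η a := by
  have h1 : (rank η a : K) < rank η b := by exact_mod_cast h.rank_lt
  have h2 : (η b : K) ≤ η a := by
    have : η b ≤ η a := by
      unfold Precedes at h
      omega
    exact_mod_cast this
  have := mul_le_mul_of_nonneg_left h2 hα.le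
  unfold spec
  linarith

theorem spec_lt_iff (hα : 0 < α) {η : Fin N → ℕ} {a b : Fin N} :
    spec α η b < spec α η a ↔ Precedes η a b := by
  refine ⟨fun h => ?_, fun h => h.spec_lt hα⟩
  rcases eq_or_ne a b with rfl | hne
  · exact (lt_irrefl _ h).elim
  · exact (precedes_or η hne).resolve_right fun h' => (h'.spec_lt hα).not_gt h

/-- For `α > 0` the order of the eigenvalues is the order `Precedes`, so the spectrum determines the
ranks, and then `α η_i = spec + rank` determines the entries. Thus the Cherednik operators separate
compositions. -/
theorem spec_injective (hα : 0 < α) : Function.Injective (spec α : (Fin N → ℕ) → Fin N → K) := by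
  intro η ν h
  have hr : ∀ i, rank η i = rank ν i := fun i => by
    unfold rank
    congr 1
    ext j
    simp only [Finset.mem_filter, Finset.mem_univ, true_and]
    rw [← spec_lt_iff hα, ← spec_lt_iff hα, h]
  funext i
  have := congrFun h i
  unfold spec at this
  rw [hr i] at this
  have h2 : α * (η i : K) = α * ν i := by linear_combination this
  exact_mod_cast mul_left_cancel₀ hα.ne' h2

end Spectrum

end JackConnection
namespace JackConnection

/-! ### The Laplace–Beltrami eigenvalue as a function of the parts. -/

section Energy

/-- `∑_{v, w ∈ s} min v w`. -/
def sumMin (s : Multiset ℕ) : ℕ := (s.map fun v => (s.map fun w => min v w).sum).sum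

/-- The sum of the squares of the elements. -/
def sumSq (s : Multiset ℕ) : ℕ := (s.map fun v => v ^ 2).sum

/-- The eigenvalue of the Laplace–Beltrami operator indexed by the multiset of parts `s`. -/
def energy {K : Type*} [Field K] (α : K) (s : Multiset ℕ) : K :=
  α * sumSq s - sumMin s + s.sum

theorem sumMin_cons (a : ℕ) (s : Multiset ℕ) :
    sumMin (a ::ₘ s) = a + 2 * (s.map fun w => min a w).sum + sumMin s := by
  simp only [sumMin, Multiset.map_cons, Multiset.sum_cons, min_self, Multiset.sum_map_add]
  have : (s.map fun v => min v a) = s.map fun w => min a w := by simp_rw [min_comm]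
  rw [this]
  ring

theorem sumSq_cons (a : ℕ) (s : Multiset ℕ) : sumSq (a ::ₘ s) = a ^ 2 + sumSq s := by
  simp [sumSq]

theorem energy_zero_cons {K : Type*} [Field K] (α : K) (s : Multiset ℕ) :
    energy α (0 ::ₘ s) = energy α s := by
  simp [energy, sumMin_cons, sumSq_cons]

theorem energy_filter_ne_zero {K : Type*} [Field K] (α : K) (s : Multiset ℕ) :
    energy α (s.filter (· ≠ 0)) = energy α s := by
  have h0 : ∀ (k : ℕ) (t : Multiset ℕ), energy α (Multiset.replicate k 0 + t) = energy α t := by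
    intro k t
    induction k with
    | zero => simp
    | succ k ih => rw [Multiset.replicate_succ, Multiset.cons_add, energy_zero_cons, ih]
  have h1 := Multiset.filter_add_not (fun v : ℕ => v = 0) s
  rw [Multiset.filter_eq' s 0] at h1
  conv_rhs => rw [← h1, h0]

variable {K : Type*} [Field K] [LinearOrder K] [IsStrictOrderedRing K] {α : K}

/-- Both new entries lie strictly between `b` and `a`. The sum of squares does not increase by
convexity, and the sums of minima against the other entries do not decrease by concavity of `min`.
Strictness comes from the minimum of the pair itself. -/
theorem energy_squeeze_lt (hα : 0 < α) {a b a' b' : ℕ} (t : Multiset ℕ) (hs : a' + b' = a + b)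
    (ha : b < a') (hb : b < b') : energy α (a' ::ₘ b' ::ₘ t) < energy α (a ::ₘ b ::ₘ t) := by
  have h1 : (t.map fun w => min a w).sum + (t.map fun w => min b w).sum
      ≤ (t.map fun w => min a' w).sum + (t.map fun w => min b' w).sum := by
    rw [← Multiset.sum_map_add, ← Multiset.sum_map_add]
    exact Multiset.sum_map_le_sum_map _ _ fun w _ => by omega
  have hb2 : a' ^ 2 + b' ^ 2 ≤ a ^ 2 + b ^ 2 := by
    obtain ⟨x, rfl⟩ := Nat.exists_eq_add_of_lt ha
    obtain ⟨y, rfl⟩ := Nat.exists_eq_add_of_lt hb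
    obtain rfl : a = b + x + 1 + y + 1 := by omega
    nlinarith [Nat.zero_le (x * y)]
  have h2 : sumSq (a' ::ₘ b' ::ₘ t) ≤ sumSq (a ::ₘ b ::ₘ t) := by
    rw [sumSq_cons, sumSq_cons, sumSq_cons, sumSq_cons]
    omega
  have h3 : sumMin (a ::ₘ b ::ₘ t) < sumMin (a' ::ₘ b' ::ₘ t) := by
    simp only [sumMin_cons, Multiset.map_cons, Multiset.sum_cons]
    omega
  have h4 : (a' ::ₘ b' ::ₘ t).sum = (a ::ₘ b ::ₘ t).sum := by
    simp only [Multiset.sum_cons]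
    omega
  unfold energy
  rw [h4]
  have h2' : (sumSq (a' ::ₘ b' ::ₘ t) : K) ≤ sumSq (a ::ₘ b ::ₘ t) := by exact_mod_cast h2
  have h3' : (sumMin (a ::ₘ b ::ₘ t) : K) < sumMin (a' ::ₘ b' ::ₘ t) := by exact_mod_cast h3
  have := mul_le_mul_of_nonneg_left h2' hα.le
  linarith

end Energy

/-! ### Triangularity of the Cherednik operators in monomials. -/

section Triangularity

open MvPolynomial

variable {N : ℕ}

/-- The exponents obtained from `κ` by replacing the entries of index `i` and `j`. -/
noncomputable def setPair (κ : Fin N →₀ ℕ) (i j : Fin N) (a b : ℕ) : Fin N →₀ ℕ :=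
  (κ.update i a).update j b

theorem setPair_apply (κ : Fin N →₀ ℕ) (i j : Fin N) (a b : ℕ) (l : Fin N) :
    setPair κ i j a b l = if l = j then b else if l = i then a else κ l := by
  simp [setPair, Finsupp.update_apply]

theorem setPair_self (κ : Fin N →₀ ℕ) (i j : Fin N) : setPair κ i j (κ i) (κ j) = κ := by
  ext l
  rw [setPair_apply]
  split_ifs with h1 h2
  · rw [h1]
  · rw [h2]
  · rfl

theorem monomial_setPair {K : Type*} [Field K] (κ : Fin N →₀ ℕ) {i j : Fin N} (h : i ≠ j)
    (a b : ℕ) : (monomial (setPair κ i j a b) 1 : MvPolynomial (Fin N) K)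
      = monomial (setPair κ i j 0 0) 1 * (X i ^ a * X j ^ b) := by
  rw [X_pow_eq_monomial, X_pow_eq_monomial, monomial_mul, monomial_mul, one_mul, one_mul]
  have : setPair κ i j a b
      = setPair κ i j 0 0 + (Finsupp.single i a + Finsupp.single j b) := by
    ext l
    simp only [Finsupp.add_apply, setPair_apply, Finsupp.single_apply]
    grind
  rw [this]

theorem map_eq_cons_cons (κ : Fin N → ℕ) {i j : Fin N} (h : i ≠ j) :
    Finset.univ.val.map κ
      = κ i ::ₘ κ j ::ₘ ((Finset.univ.erase i).erase j).val.map κ := by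
  have h1 : (Finset.univ : Finset (Fin N)) = insert i (insert j ((Finset.univ.erase i).erase j)) := by
    rw [Finset.insert_erase (Finset.mem_erase.2 ⟨h.symm, Finset.mem_univ j⟩),
      Finset.insert_erase (Finset.mem_univ i)]
  conv_lhs => rw [h1]
  rw [Finset.insert_val_of_notMem, Multiset.map_cons, Finset.insert_val_of_notMem,
    Multiset.map_cons]
  · simp
  · simp [h]

theorem divDiff_monomial {K : Type*} [Field K] {κ : Fin N →₀ ℕ} {i j : Fin N} (h : i ≠ j) (hκ : κ j ≤ κ i) :
    divDiff i j (monomial κ 1 : MvPolynomial (Fin N) K)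
      = monomial (setPair κ i j 0 0) 1 * (X i * X j) ^ κ j
        * ∑ t ∈ Finset.range (κ i - κ j), X i ^ t * X j ^ (κ i - κ j - 1 - t) := by
  have h0 : (monomial κ 1 : MvPolynomial (Fin N) K)
      = X i ^ (κ i - κ j) * (monomial (setPair κ i j 0 0) 1 * (X i * X j) ^ κ j) := by
    conv_lhs => rw [← setPair_self κ i j, monomial_setPair κ h]
    obtain ⟨d, hd⟩ := Nat.exists_eq_add_of_le hκ
    rw [hd, Nat.add_sub_cancel_left, pow_add, mul_pow]
    ring
  rw [h0, divDiff_mul_of_rename_eq, divDiff_X_pow h, mul_comm]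
  rw [map_mul, map_pow, map_mul, rename_X, rename_X, Equiv.swap_apply_left,
    Equiv.swap_apply_right, mul_comm (X j), rename_monomial]
  have : (setPair κ i j 0 0).mapDomain (Equiv.swap i j) = setPair κ i j 0 0 := by
    rw [← Finsupp.equivMapDomain_eq_mapDomain]
    ext l
    rw [Finsupp.equivMapDomain_apply, Equiv.symm_swap, setPair_apply, setPair_apply,
      Equiv.swap_apply_def]
    grind
  rw [this]

theorem divDiff_symm {K : Type*} [Field K] (i j : Fin N) (f : MvPolynomial (Fin N) K) :
    divDiff j i f = -divDiff i j f := by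
  rcases eq_or_ne i j with rfl | h
  · simp [divDiff]
  · apply divDiff_eq_of h.symm
    rw [Equiv.swap_comm, ← X_sub_X_mul_divDiff i j f]
    ring

theorem X_mul_divDiff_monomial_left {K : Type*} [Field K] {κ : Fin N →₀ ℕ} {i j : Fin N} (h : i ≠ j)
    (hκ : κ j ≤ κ i) : X i * divDiff i j (monomial κ 1 : MvPolynomial (Fin N) K)
      = ∑ t ∈ Finset.range (κ i - κ j), monomial (setPair κ i j (κ j + t + 1) (κ i - 1 - t)) 1 := by
  rw [divDiff_monomial h hκ, Finset.mul_sum, Finset.mul_sum]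
  refine Finset.sum_congr rfl fun t ht => ?_
  rw [Finset.mem_range] at ht
  rw [monomial_setPair κ h (κ j + t + 1)]
  have : κ i - 1 - t = κ j + (κ i - κ j - 1 - t) := by omega
  rw [this, pow_add, pow_add, pow_add, mul_pow]
  ring

theorem X_mul_divDiff_monomial_right {K : Type*} [Field K] {κ : Fin N →₀ ℕ} {i j : Fin N} (h : i ≠ j)
    (hκ : κ j ≤ κ i) : X j * divDiff i j (monomial κ 1 : MvPolynomial (Fin N) K)
      = ∑ t ∈ Finset.range (κ i - κ j), monomial (setPair κ i j (κ j + t) (κ i - t)) 1 := by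
  rw [divDiff_monomial h hκ, Finset.mul_sum, Finset.mul_sum]
  refine Finset.sum_congr rfl fun t ht => ?_
  rw [Finset.mem_range] at ht
  rw [monomial_setPair κ h (κ j + t)]
  have : κ i - t = κ j + (κ i - κ j - 1 - t) + 1 := by omega
  rw [this, pow_add, pow_add, pow_add, mul_pow]
  ring

theorem divDiff_monomial_of_eq {K : Type*} [Field K] {κ : Fin N →₀ ℕ} {i j : Fin N} (hκ : κ i = κ j) :
    divDiff i j (monomial κ (1 : K)) = 0 := by
  rcases eq_or_ne i j with rfl | h
  · simp [divDiff]
  · rw [divDiff_monomial h hκ.ge, hκ]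
    simp

/-- The eigenvalue of the Laplace–Beltrami operator at the composition `κ`. -/
def fnEnergy {K : Type*} [Field K] (α : K) (κ : Fin N → ℕ) : K :=
  energy α (Finset.univ.val.map κ)

theorem fnEnergy_comp_perm {K : Type*} [Field K] (α : K) (κ : Fin N → ℕ)
    (e : Equiv.Perm (Fin N)) : fnEnergy α (κ ∘ e) = fnEnergy α κ := by
  unfold fnEnergy
  rw [← Multiset.map_map, Multiset.map_univ_val_equiv]

/-- `∑_i i κ_i`. -/
def moment (κ : Fin N → ℕ) : ℕ := ∑ i : Fin N, i.val * κ i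

/-- The strict partial order for which the Cherednik operators are triangular. -/
def Below {K : Type*} [Field K] [LinearOrder K] (α : K) (ν κ : Fin N → ℕ) : Prop :=
  fnEnergy α ν < fnEnergy α κ ∨ (∃ e : Equiv.Perm (Fin N), ν = κ ∘ e) ∧ moment κ < moment ν

variable {K : Type*} [Field K] [LinearOrder K] {α : K}

theorem Below.energy_le {ν κ : Fin N → ℕ} (h : Below α ν κ) : fnEnergy α ν ≤ fnEnergy α κ := by
  rcases h with h | ⟨⟨e, rfl⟩, _⟩
  · exact h.le
  · rw [fnEnergy_comp_perm]

theorem Below.trans {μ ν κ : Fin N → ℕ} (h : Below α μ ν) (h' : Below α ν κ) :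
    Below α μ κ := by
  rcases h with h | ⟨⟨e, rfl⟩, h⟩
  · exact Or.inl (h.trans_le h'.energy_le)
  · rcases h' with h' | ⟨⟨e', rfl⟩, h'⟩
    · rw [Below, fnEnergy_comp_perm]
      exact Or.inl h'
    · exact Or.inr ⟨⟨e.trans e', by ext; simp⟩, h'.trans h⟩

theorem below_irrefl (κ : Fin N → ℕ) : ¬ Below α κ κ := by
  rintro (h | ⟨_, h⟩)
  · exact lt_irrefl _ h
  · exact lt_irrefl _ h

theorem below_setPair_of_squeeze [IsStrictOrderedRing K] (hα : 0 < α) {κ : Fin N →₀ ℕ}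
    {i j : Fin N} (h : i ≠ j) {a b : ℕ} (hs : a + b = κ i + κ j) (ha : κ j < a) (hb : κ j < b) :
    Below α (setPair κ i j a b) κ := by
  refine Or.inl ?_
  unfold fnEnergy
  rw [map_eq_cons_cons _ h, map_eq_cons_cons _ h]
  have : ((Finset.univ.erase i).erase j).val.map (setPair κ i j a b)
      = ((Finset.univ.erase i).erase j).val.map κ := by
    refine Multiset.map_congr rfl fun l hl => ?_
    have hl' := Finset.mem_erase.1 (Finset.mem_def.2 hl)
    rw [setPair_apply, if_neg hl'.1, if_neg (Finset.ne_of_mem_erase hl'.2)]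
  rw [this, setPair_apply, if_neg h, if_pos rfl, setPair_apply, if_pos rfl]
  exact energy_squeeze_lt hα _ hs ha hb

theorem moment_eq (κ : Fin N → ℕ) {i j : Fin N} (h : i ≠ j) :
    moment κ = i.val * κ i + (j.val * κ j + ∑ l ∈ (Finset.univ.erase i).erase j, l.val * κ l) := by
  rw [moment, Finset.add_sum_erase _ (fun l : Fin N => l.val * κ l)
    (Finset.mem_erase.2 ⟨h.symm, Finset.mem_univ j⟩),
    Finset.add_sum_erase _ (fun l : Fin N => l.val * κ l) (Finset.mem_univ i)]

theorem setPair_swap_eq (κ : Fin N →₀ ℕ) {i j : Fin N} (h : i ≠ j) :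
    ⇑(setPair κ i j (κ j) (κ i)) = κ ∘ Equiv.swap i j := by
  ext l
  rw [setPair_apply, Function.comp_apply, Equiv.swap_apply_def]
  grind

theorem below_comp_swap {κ : Fin N → ℕ} {i j : Fin N} (hij : i < j) (hκ : κ j < κ i) :
    Below α (κ ∘ Equiv.swap i j) κ := by
  refine Or.inr ⟨⟨_, rfl⟩, ?_⟩
  rw [moment_eq κ hij.ne, moment_eq _ hij.ne]
  have : ∑ l ∈ (Finset.univ.erase i).erase j, l.val * (κ ∘ Equiv.swap i j) l
      = ∑ l ∈ (Finset.univ.erase i).erase j, l.val * κ l := by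
    refine Finset.sum_congr rfl fun l hl => ?_
    have hl' := Finset.mem_erase.1 hl
    rw [Function.comp_apply,
      Equiv.swap_apply_of_ne_of_ne (Finset.ne_of_mem_erase hl'.2) hl'.1]
  rw [this]
  simp only [Function.comp_apply, Equiv.swap_apply_left, Equiv.swap_apply_right]
  have : i.val < j.val := hij
  nlinarith

/-- The span of the monomials below `κ`. -/
noncomputable def lower (α : K) (κ : Fin N → ℕ) : Submodule K (MvPolynomial (Fin N) K) :=
  Submodule.span K {f | ∃ ν : Fin N →₀ ℕ, Below α ν κ ∧ f = monomial ν 1}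

theorem monomial_mem_lower {κ : Fin N → ℕ} {ν : Fin N →₀ ℕ} (h : Below α ν κ) :
    (monomial ν 1 : MvPolynomial (Fin N) K) ∈ lower α κ :=
  Submodule.subset_span ⟨ν, h, rfl⟩

theorem below_of_mem_lower {κ : Fin N → ℕ} {f : MvPolynomial (Fin N) K} (hf : f ∈ lower α κ)
    {ν : Fin N →₀ ℕ} (hν : coeff ν f ≠ 0) : Below α ν κ := by
  by_contra hb
  refine hν ?_
  induction hf using Submodule.span_induction with
  | mem x hx =>
    obtain ⟨μ, hμ, rfl⟩ := hx
    rw [coeff_monomial, if_neg]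
    rintro rfl
    exact hb hμ
  | zero => simp
  | add x y _ _ hx hy =>
    rw [coeff_add]
    by_cases h1 : coeff ν x = 0
    · by_cases h2 : coeff ν y = 0
      · rw [h1, h2, add_zero]
      · exact absurd (hy h2) h2
    · exact absurd (hx h1) h1
  | smul c x _ hx =>
    rw [coeff_smul]
    by_cases h1 : coeff ν x = 0
    · rw [h1, smul_zero]
    · exact absurd (hx h1) h1

variable [IsStrictOrderedRing K]

/-- The last term of the geometric sum is the monomial itself; all others have the two exponents
squeezed strictly together and so smaller energy. -/
theorem X_mul_divDiff_sub_mem_lower (hα : 0 < α) {κ : Fin N →₀ ℕ} {i j : Fin N} (h : i ≠ j)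
    (hκ : κ j < κ i) :
    X i * divDiff i j (monomial κ 1) - monomial κ (1 : K) ∈ lower α κ := by
  rw [X_mul_divDiff_monomial_left h hκ.le]
  obtain ⟨d, hd⟩ := Nat.exists_eq_add_of_lt hκ
  have h1 : κ i - κ j = d + 1 := by omega
  rw [h1, Finset.sum_range_succ]
  have h2 : κ j + d + 1 = κ i := by omega
  have h3 : κ i - 1 - d = κ j := by omega
  rw [h2, h3, setPair_self, add_sub_cancel_right]
  refine Submodule.sum_mem _ fun t ht => monomial_mem_lower ?_
  rw [Finset.mem_range] at ht
  exact below_setPair_of_squeeze hα h (by omega) (by omega) (by omega)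

/-- The term `t = 0` is the monomial with the two exponents exchanged. Its energy is unchanged, and
it is lower only because `i < j` makes its moment larger; the second clause of `Below` exists for
this term. -/
theorem X_mul_divDiff_mem_lower (hα : 0 < α) {κ : Fin N →₀ ℕ} {i j : Fin N} (h : i < j)
    (hκ : κ j < κ i) : X j * divDiff i j (monomial κ (1 : K)) ∈ lower α κ := by
  rw [X_mul_divDiff_monomial_right h.ne hκ.le]
  refine Submodule.sum_mem _ fun t ht => monomial_mem_lower ?_
  rw [Finset.mem_range] at ht
  rcases Nat.eq_zero_or_pos t with rfl | ht0
  · rw [Nat.add_zero, Nat.sub_zero, setPair_swap_eq κ h.ne]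
    exact below_comp_swap h hκ
  · exact below_setPair_of_squeeze hα h.ne (by omega) (by omega) (by omega)

/-- Summed over `j`, the diagonal coefficient is `i - rank κ i`; the constant `-i` in the Cherednik
operator turns it into the `- rank κ i` of `spec`. -/
theorem dunklTerm_monomial_sub_mem_lower (hα : 0 < α) (κ : Fin N →₀ ℕ) (i j : Fin N) :
    dunklTerm i j (monomial κ 1)
      - ((if j < i then 1 else 0) - (if Precedes κ j i then 1 else 0) : K) • monomial κ (1 : K)
      ∈ lower α κ := by
  rcases lt_trichotomy i j with hij | rfl | hij
  · rw [dunklTerm_of_lt hij, if_neg hij.not_gt]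
    rcases lt_trichotomy (κ i) (κ j) with h | h | h
    · rw [if_pos (show Precedes κ j i from Or.inl h), divDiff_symm j i]
      have := Submodule.neg_mem _ (X_mul_divDiff_sub_mem_lower hα hij.ne' h)
      convert this using 1
      rw [zero_sub, neg_smul, one_smul]
      ring
    · rw [divDiff_monomial_of_eq h, if_neg]
      · simp
      · rintro (h' | h')
        · omega
        · exact h'.2.not_gt hij
    · rw [if_neg]
      · rw [sub_zero, zero_smul, sub_zero]
        exact X_mul_divDiff_mem_lower hα hij h
      · rintro (h' | h') <;> omega
  · simp [precedes_irrefl]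
  · rw [dunklTerm_of_gt hij, if_pos hij]
    rcases lt_trichotomy (κ i) (κ j) with h | h | h
    · rw [if_pos (show Precedes κ j i from Or.inl h), divDiff_symm j i, sub_self, zero_smul, sub_zero, mul_neg]
      exact Submodule.neg_mem _ (X_mul_divDiff_mem_lower hα hij h)
    · rw [divDiff_monomial_of_eq h, if_pos (show Precedes κ j i from Or.inr ⟨h, hij⟩)]
      simp
    · rw [if_neg]
      · rw [sub_zero, one_smul]
        exact X_mul_divDiff_sub_mem_lower hα hij.ne' h
      · rintro (h' | h') <;> omega

/-- The Cherednik operators are triangular in the monomials. -/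
theorem cherednik_monomial_sub_mem_lower (hα : 0 < α) (κ : Fin N →₀ ℕ) (i : Fin N) :
    cherednik α i (monomial κ 1) - spec α κ i • monomial κ (1 : K) ∈ lower α κ := by
  have hsum := Submodule.sum_mem (lower α κ) fun j (_ : j ∈ Finset.univ) =>
    dunklTerm_monomial_sub_mem_lower hα κ i j
  convert hsum using 1
  rw [Finset.sum_sub_distrib, ← Finset.sum_smul, Finset.sum_sub_distrib, Finset.sum_boole,
    Finset.sum_boole, cherednik_apply, X_mul_pderiv_monomial, spec, rank]
  have : (Finset.univ.filter fun j : Fin N => j < i).card = i.val := by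
    rw [Finset.filter_gt_eq_Iio, Fin.card_Iio]
  rw [this, sub_smul, sub_smul, mul_smul, Nat.cast_smul_eq_nsmul K (κ i)]
  abel

end Triangularity

end JackConnection
namespace JackConnection

theorem exists_forall_not_rel {β : Type*} {r : β → β → Prop} (hirr : ∀ a, ¬ r a a)
    (htr : ∀ a b c, r a b → r b c → r a c) {s : Finset β} (hs : s.Nonempty) :
    ∃ a ∈ s, ∀ b ∈ s, ¬ r a b := by
  classical
  induction hs using Finset.Nonempty.cons_induction with
  | singleton a => exact ⟨a, by simp, by simpa using hirr a⟩
  | cons x s hx hs ih =>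
    obtain ⟨a, ha, hmax⟩ := ih
    by_cases h : r a x
    · refine ⟨x, by simp, fun b hb hxb => ?_⟩
      rcases Finset.mem_cons.1 hb with rfl | hb
      · exact hirr _ hxb
      · exact hmax b hb (htr _ _ _ h hxb)
    · refine ⟨a, by simp [ha], fun b hb hab => ?_⟩
      rcases Finset.mem_cons.1 hb with rfl | hb
      · exact h hab
      · exact hmax b hb hab

/-! ### Joint eigenvectors and the swap intertwiner. -/

section Eigenvectors

open MvPolynomial

theorem cherednik_eq_sum {N : ℕ} {K : Type*} [Field K] (α : K) (i : Fin N) (f : MvPolynomial (Fin N) K) :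
    cherednik α i f
      = ∑ ν ∈ f.support, coeff ν f • cherednik α i (monomial ν 1) := by
  conv_lhs => rw [f.as_sum]
  rw [map_sum]
  refine Finset.sum_congr rfl fun ν _ => ?_
  rw [← map_smul, smul_monomial, smul_eq_mul, mul_one]

theorem divDiff_one {N : ℕ} {K : Type*} [Field K] (i j : Fin N) : divDiff i j (1 : MvPolynomial (Fin N) K) = 0 := by
  rcases eq_or_ne i j with rfl | h
  · simp [divDiff]
  · exact divDiff_eq_of h (by simp)

variable {N : ℕ} {K : Type*} [Field K] [LinearOrder K] [IsStrictOrderedRing K] {α : K}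

theorem below_of_coeff_cherednik_monomial_ne_zero (hα : 0 < α) {i : Fin N} {ν κ : Fin N →₀ ℕ}
    (h : coeff κ (cherednik α i (monomial ν 1)) ≠ 0) : κ = ν ∨ Below α κ ν := by
  by_contra! hc
  have h0 : coeff κ (cherednik α i (monomial ν 1) - spec α ν i • monomial ν (1 : K)) = 0 := by
    by_contra hne
    exact hc.2 (below_of_mem_lower (cherednik_monomial_sub_mem_lower hα ν i) hne)
  rw [coeff_sub, coeff_smul, coeff_monomial, if_neg fun e => hc.1 e.symm, smul_zero,
    sub_zero] at h0
  exact h h0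

theorem coeff_cherednik_monomial_self (hα : 0 < α) (i : Fin N) (κ : Fin N →₀ ℕ) :
    coeff κ (cherednik α i (monomial κ (1 : K))) = spec α κ i := by
  have h0 : coeff κ (cherednik α i (monomial κ 1) - spec α κ i • monomial κ (1 : K)) = 0 := by
    by_contra hne
    exact below_irrefl κ (below_of_mem_lower (cherednik_monomial_sub_mem_lower hα κ i) hne)
  rw [coeff_sub, coeff_smul, coeff_monomial, if_pos rfl, smul_eq_mul, mul_one, sub_eq_zero] at h0
  exact h0

/-- The coefficient of `Y_i f` at an exponent that is not below the support of `f`. -/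
theorem coeff_cherednik (hα : 0 < α) (i : Fin N) {f : MvPolynomial (Fin N) K} {κ : Fin N →₀ ℕ}
    (h : ∀ ν, coeff ν f ≠ 0 → ¬ Below α κ ν) :
    coeff κ (cherednik α i f) = spec α κ i * coeff κ f := by
  rw [cherednik_eq_sum, coeff_sum, Finset.sum_eq_single κ]
  · rw [coeff_smul, coeff_cherednik_monomial_self hα, smul_eq_mul, mul_comm]
  · intro ν hν hne
    rw [coeff_smul]
    by_contra hc
    rcases below_of_coeff_cherednik_monomial_ne_zero hα (right_ne_zero_of_mul hc) with h' | h'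
    · exact hne h'.symm
    · exact h ν (mem_support_iff.1 hν) h'
  · intro hκ
    rw [notMem_support_iff.1 hκ, zero_smul, coeff_zero]

theorem exists_of_coeff_cherednik_ne_zero (hα : 0 < α) {i : Fin N} {f : MvPolynomial (Fin N) K}
    {κ : Fin N →₀ ℕ} (h : coeff κ (cherednik α i f) ≠ 0) :
    ∃ ν, coeff ν f ≠ 0 ∧ (κ = ν ∨ Below α κ ν) := by
  rw [cherednik_eq_sum, coeff_sum] at h
  obtain ⟨ν, hν, hne⟩ := Finset.exists_ne_zero_of_sum_ne_zero h
  rw [coeff_smul] at hne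
  exact ⟨ν, mem_support_iff.1 hν,
    below_of_coeff_cherednik_monomial_ne_zero hα (right_ne_zero_of_mul hne)⟩

/-- The support of a joint eigenvector of the Cherednik operators. -/
theorem eq_or_below_of_eigen (hα : 0 < α) {f : MvPolynomial (Fin N) K} {η : Fin N →₀ ℕ}
    (hf : ∀ i, cherednik α i f = spec α η i • f) {κ : Fin N →₀ ℕ} (hκ : coeff κ f ≠ 0) :
    κ = η ∨ Below α κ η := by
  classical
  by_contra hbad
  -- At a maximal exponent `ν` outside the expected support, no exponent of `f` is above `ν`, so
  -- each `Y_i` multiplies that coefficient by `spec α ν i`. Then `ν` has the spectrum of `η`, hence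
  -- equals `η`.
  set S := f.support.filter fun ν => ¬ (ν = η ∨ Below α ν η) with hS
  have hne : S.Nonempty := ⟨κ, Finset.mem_filter.2 ⟨mem_support_iff.2 hκ, hbad⟩⟩
  obtain ⟨ν, hν, hmax⟩ := exists_forall_not_rel (r := fun a b : Fin N →₀ ℕ => Below α a b)
    (fun a => below_irrefl _) (fun a b c h h' => h.trans h') hne
  obtain ⟨hνf, hνbad⟩ := Finset.mem_filter.1 hν
  have hnot : ∀ μ, coeff μ f ≠ 0 → ¬ Below α ν μ := by
    intro μ hμ hb
    by_cases hm : μ = η ∨ Below α μ η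
    · rcases hm with rfl | hm
      · exact hνbad (Or.inr hb)
      · exact hνbad (Or.inr (hb.trans hm))
    · exact hmax μ (Finset.mem_filter.2 ⟨mem_support_iff.2 hμ, hm⟩) hb
  refine hνbad (Or.inl ?_)
  have : spec α ν = spec α η := by
    funext i
    have h1 := coeff_cherednik hα i hnot
    rw [hf i, coeff_smul, smul_eq_mul] at h1
    exact (mul_right_cancel₀ (mem_support_iff.1 hνf) h1).symm
  exact DFunLike.coe_injective (spec_injective hα this)

/-- `f` is a (monic) nonsymmetric Jack polynomial indexed by `η`. -/
def IsNonsymJack (α : K) (η : Fin N →₀ ℕ) (f : MvPolynomial (Fin N) K) : Prop :=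
  (∀ i, cherednik α i f = spec α η i • f) ∧ coeff η f = 1

theorem spec_zero (α : K) (i : Fin N) : spec α (0 : Fin N → ℕ) i = -(i.val : K) := by
  have : rank (0 : Fin N → ℕ) i = i.val := by
    rw [rank]
    simp only [Precedes, Pi.zero_apply, lt_irrefl, false_or, true_and]
    rw [Finset.filter_gt_eq_Iio, Fin.card_Iio]
  simp [spec, this]

theorem isNonsymJack_zero (α : K) : IsNonsymJack (N := N) α 0 1 := by
  refine ⟨fun i => ?_, by simp⟩
  have hd : ∀ j, dunklTerm i j (1 : MvPolynomial (Fin N) K) = 0 := fun j => by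
    rcases lt_trichotomy i j with h | rfl | h
    · rw [dunklTerm_of_lt h, divDiff_one, mul_zero]
    · simp
    · rw [dunklTerm_of_gt h, divDiff_one, mul_zero]
  rw [cherednik_apply, Finsupp.coe_zero, spec_zero]
  simp [hd]

/-- Positions matter only for ties. An adjacent swap changes the relative position of a single pair,
and the entries of that pair are different. -/
theorem rank_comp_swap {η : Fin N → ℕ} {i k : Fin N} (hk : k.val = i.val + 1) (hη : η i ≠ η k)
    (l : Fin N) : rank (η ∘ Equiv.swap i k) l = rank η (Equiv.swap i k l) := by
  unfold rank
  refine Finset.card_equiv (Equiv.swap i k) fun j => ?_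
  simp only [Finset.mem_filter, Finset.mem_univ, true_and]
  unfold Precedes
  simp only [Function.comp_apply]
  refine or_congr_right (and_congr_right fun h => ?_)
  have key : ∀ a b : Fin N, η a = η b → (Equiv.swap i k a < Equiv.swap i k b ↔ a < b) := by
    intro a b hab
    have h2 : ∀ c d : Fin N, c = d ↔ c.val = d.val := fun c d => Fin.ext_iff
    simp only [Equiv.swap_apply_def, Fin.lt_def]
    split_ifs <;> simp_all <;> omega
  have := key _ _ h.symm
  simpa using this

/-- By the Hecke relation, `s f` fails to be an eigenvector only by a multiple of `f`, and the
inverse of the spectral gap corrects this; the gap is positive because `η i < η k`. The result is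
monic because `η` lies below the swapped exponent, which therefore does not occur in `f`. -/
theorem isNonsymJack_swap (hα : 0 < α) {η : Fin N →₀ ℕ} {f : MvPolynomial (Fin N) K}
    (hf : IsNonsymJack α η f) {i k : Fin N} (hk : k.val = i.val + 1) (hη : η i < η k) :
    IsNonsymJack α (η.mapDomain (Equiv.swap i k))
      (rename (Equiv.swap i k) f + (spec α η k - spec α η i)⁻¹ • f) := by
  have hik : i < k := Fin.lt_def.2 (by omega)
  have hcoe : ⇑(η.mapDomain (Equiv.swap i k)) = η ∘ Equiv.swap i k := by
    ext l
    rw [← Finsupp.equivMapDomain_eq_mapDomain, Finsupp.equivMapDomain_apply, Equiv.symm_swap,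
      Function.comp_apply]
  have hspec : ∀ l, spec α (η.mapDomain (Equiv.swap i k)) l = spec α η (Equiv.swap i k l) := by
    intro l
    rw [hcoe]
    unfold spec
    rw [rank_comp_swap hk hη.ne, Function.comp_apply]
  have hlt : spec α η i < spec α η k := Precedes.spec_lt hα (Or.inl hη)
  have hne : spec α η k - spec α η i ≠ 0 := (sub_pos.2 hlt).ne'
  obtain ⟨hf1, hf2⟩ := hf
  refine ⟨fun l => ?_, ?_⟩
  · rw [hspec, map_add, map_smul, hf1]
    rcases eq_or_ne l i with rfl | hli
    · rw [Equiv.swap_apply_left]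
      have h1 := rename_swap_cherednik α hk (rename (Equiv.swap l k) f)
      have hinv : rename (Equiv.swap l k) (rename (Equiv.swap l k) f) = f := by
        rw [rename_rename]
        have : (Equiv.swap l k ∘ Equiv.swap l k : Fin N → Fin N) = id := by ext; simp
        rw [this, rename_id_apply]
      have h2 := congrArg (rename (Equiv.swap l k)) h1
      rw [hinv, map_add, hinv, hf1, map_smul, rename_rename] at h2
      have : (Equiv.swap l k ∘ Equiv.swap l k : Fin N → Fin N) = id := by ext; simp
      rw [this, rename_id_apply] at h2
      rw [h2, smul_add, smul_smul, smul_smul, add_assoc, ← one_smul K f, smul_smul, smul_smul,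
        ← add_smul]
      congr 2
      field_simp
      ring
    · rcases eq_or_ne l k with rfl | hlk
      · rw [Equiv.swap_apply_right]
        have h1 := rename_swap_cherednik α hk f
        rw [hf1, map_smul] at h1
        rw [← sub_eq_iff_eq_add] at h1
        rw [← h1, smul_add, smul_smul, smul_smul, sub_add_eq_add_sub, add_sub_assoc]
        congr 1
        rw [← one_smul K f, smul_smul, smul_smul, ← sub_smul]
        congr 1
        field_simp
        ring
      · rw [Equiv.swap_apply_of_ne_of_ne hli hlk,
          ← rename_swap_cherednik_of_ne α hk hli hlk, hf1, map_smul, smul_add, smul_comm]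
  · rw [coeff_add, coeff_rename_mapDomain _ (Equiv.injective _), hf2, coeff_smul]
    have : coeff (η.mapDomain (Equiv.swap i k)) f = 0 := by
      by_contra h0
      have hb := eq_or_below_of_eigen hα hf1 h0
      have hb' : Below α η (η ∘ Equiv.swap i k) := by
        have := below_comp_swap (α := α) (κ := η ∘ Equiv.swap i k) hik (by simpa using hη)
        rwa [Function.comp_assoc, show (Equiv.swap i k ∘ Equiv.swap i k : Fin N → Fin N) = id by
          ext; simp, Function.comp_id] at this
      rw [hcoe] at hb
      rcases hb with hb | hb
      · rw [← hcoe, hb] at hb'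
        exact below_irrefl _ hb'
      · exact below_irrefl _ (hb.trans hb')
    rw [this, smul_zero, add_zero]

end Eigenvectors

/-! ### The affine intertwiner on nonsymmetric Jack polynomials. -/

section Raise

open MvPolynomial

variable {M : ℕ} {K : Type*} [Field K] {α : K}

/-- The exponents `(η_1, …, η_M, η_0 + 1)`. -/
noncomputable def raise (η : Fin (M + 1) →₀ ℕ) : Fin (M + 1) →₀ ℕ :=
  Finsupp.single (Fin.last M) 1 + η.mapDomain (finRotate (M + 1)).symm

theorem raise_apply (η : Fin (M + 1) →₀ ℕ) (i : Fin (M + 1)) :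
    raise η i = η (finRotate (M + 1) i) + if i = Fin.last M then 1 else 0 := by
  rw [raise, Finsupp.add_apply, ← Finsupp.equivMapDomain_eq_mapDomain,
    Finsupp.equivMapDomain_apply, Equiv.symm_symm, Finsupp.single_apply, add_comm]
  simp only [eq_comm]

/-- The entry moved from first to last place loses all ties, but increasing it by one compensates
exactly: `η_0 ≥ η_j` if and only if `η_0 + 1 > η_j`. -/
theorem rank_raise (η : Fin (M + 1) →₀ ℕ) (i : Fin (M + 1)) :
    rank (raise η) i = rank η (finRotate (M + 1) i) := by
  unfold rank
  refine Finset.card_equiv (finRotate (M + 1)) fun j => ?_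
  simp only [Finset.mem_filter, Finset.mem_univ, true_and]
  unfold Precedes
  rw [raise_apply, raise_apply]
  have hpos : ∀ {l : Fin (M + 1)}, l ≠ Fin.last M → (0 : Fin (M + 1)) < finRotate (M + 1) l := by
    intro l hl
    rw [Fin.lt_def, coe_finRotate_of_ne_last hl]
    exact Nat.succ_pos _
  rcases eq_or_ne i (Fin.last M) with rfl | hi
  · rcases eq_or_ne j (Fin.last M) with rfl | hj
    · simp
    · have h1 : j < Fin.last M := Fin.lt_last_iff_ne_last.2 hj
      have h2 := hpos hj
      rw [if_pos rfl, if_neg hj, finRotate_last]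
      have h3 : ¬ finRotate (M + 1) j < 0 := h2.not_gt
      simp only [h1, h3, and_true, and_false, or_false]
      omega
  · rcases eq_or_ne j (Fin.last M) with rfl | hj
    · have h1 : ¬ Fin.last M < i := (Fin.le_last i).not_gt
      have h2 := hpos hi
      rw [if_pos rfl, if_neg hi, finRotate_last]
      simp only [h1, h2, and_true, and_false, or_false]
      omega
    · rw [if_neg hi, if_neg hj, finRotate_lt_iff hj hi]
      rfl

theorem isNonsymJack_raise {η : Fin (M + 1) →₀ ℕ} {f : MvPolynomial (Fin (M + 1)) K}
    [LinearOrder K] [IsStrictOrderedRing K]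
    (hf : IsNonsymJack α η f) : IsNonsymJack α (raise η) (affineRaise f) := by
  obtain ⟨hf1, hf2⟩ := hf
  refine ⟨fun i => ?_, ?_⟩
  · unfold spec
    rw [rank_raise, raise_apply]
    rcases eq_or_ne i (Fin.last M) with rfl | hi
    · rw [cherednik_last_affineRaise, hf1, ← add_smul, map_smul, if_pos rfl, finRotate_last]
      congr 1
      unfold spec
      push_cast
      ring
    · rw [cherednik_affineRaise_of_ne α hi, hf1, map_smul, if_neg hi, add_zero]
      rfl
  · rw [raise, affineRaise_apply, coeff_X_mul, coeff_rename_mapDomain _ (Equiv.injective _), hf2]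

end Raise

end JackConnection
namespace JackConnection

/-! ### Ranks in lists. -/

section Lists

theorem sum_range_ite_getD (L : List ℕ) (p : ℕ → Prop) [DecidablePred p] :
    ∑ i ∈ Finset.range L.length, (if p (L.getD i 0) then 1 else 0)
      = L.countP (fun x => p x) := by
  induction L with
  | nil => simp
  | cons x L ih =>
    rw [List.length_cons, Finset.sum_range_succ', List.countP_cons, ← ih]
    simp

theorem rank_getD {N : ℕ} (A B : List ℕ) (x : ℕ) (hN : (A ++ x :: B).length = N)
    (i : Fin N) (hi : i.val = A.length) :
    rank (fun j : Fin N => (A ++ x :: B).getD j 0) i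
      = A.countP (fun y => x ≤ y) + B.countP (fun y => x < y) := by
  have hx : (A ++ x :: B).getD i 0 = x := by simp [hi]
  have h1 : rank (fun j : Fin N => (A ++ x :: B).getD j 0) i
      = ∑ j ∈ Finset.range N, if x < (A ++ x :: B).getD j 0 ∨
        x = (A ++ x :: B).getD j 0 ∧ j < A.length then 1 else 0 := by
    rw [rank, Finset.card_filter, Finset.sum_range]
    refine Finset.sum_congr rfl fun j _ => ?_
    unfold Precedes
    simp only [hx, Fin.lt_def]
    rw [hi]
  have hN' : N = A.length + (1 + B.length) := by
    rw [← hN]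
    simp
    omega
  rw [h1, hN', Finset.sum_range_add, Finset.sum_range_add, ← sum_range_ite_getD,
    ← sum_range_ite_getD]
  congr 1
  · refine Finset.sum_congr rfl fun j hj => ?_
    have hj' := Finset.mem_range.1 hj
    rw [List.getD_append _ _ _ _ hj']
    simp only [hj', and_true, Nat.le_iff_lt_or_eq]
  · rw [Finset.sum_range_one]
    have h2 : (A ++ x :: B).getD (A.length + 0) 0 = x := by simp
    rw [h2, if_neg (by omega), zero_add]
    refine Finset.sum_congr rfl fun j _ => ?_
    have h3 : (A ++ x :: B).getD (A.length + (1 + j)) 0 = B.getD j 0 := by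
      rw [List.getD_append_right _ _ _ _ (by omega)]
      simp [add_comm 1 j]
    have h4 : ¬ A.length + (1 + j) < A.length := by omega
    rw [h3]
    simp only [h4, and_false, or_false]

end Lists

/-! ### Values of nonsymmetric Jack polynomials at `(1, …, 1)`. -/

section Values

open MvPolynomial

variable {M : ℕ} {K : Type*} [Field K] [LinearOrder K] [IsStrictOrderedRing K] {α : K}

/-- The exponents listed by `L`. -/
noncomputable def exps (N : ℕ) (L : List ℕ) : Fin N →₀ ℕ :=
  Finsupp.equivFunOnFinite.symm fun i => L.getD i 0

theorem coe_exps (N : ℕ) (L : List ℕ) : ⇑(exps N L) = fun i : Fin N => L.getD i 0 := rfl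

theorem exps_apply (N : ℕ) (L : List ℕ) (i : Fin N) : exps N L i = L.getD i 0 := rfl

/-- The nonsymmetric Jack polynomial indexed by the list `L` exists and takes the value `v` at
`(1, …, 1)`. -/
def JackValue (α : K) (N : ℕ) (L : List ℕ) (v : K) : Prop :=
  ∃ f : MvPolynomial (Fin N) K, IsNonsymJack α (exps N L) f ∧ eval (fun _ => 1) f = v

/-- Permuting variables does not change the value at `(1, …, 1)`, so the swap intertwiner multiplies
it by one plus the inverse spectral gap. The nonzero entry `v` has rank the number of larger entries
of `R`; the zero on its left has rank `p + R.length + 1`. -/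
theorem JackValue.swap (hα : 0 < α) {N p : ℕ} {v : ℕ} {R : List ℕ} {w : K}
    (q : ℕ) (hN : p + 1 + (q + R.length + 1) = N) (hv : 0 < v) (hR : ∀ x ∈ R, 0 < x)
    (h : JackValue α N (List.replicate (p + 1) 0 ++ v :: (List.replicate q 0 ++ R)) w) :
    JackValue α N (List.replicate p 0 ++ v :: (List.replicate (q + 1) 0 ++ R))
      (w * (1 + (α * v - R.countP (fun y => v < y) + R.length + 1 + p)⁻¹)) := by
  obtain ⟨f, hf, hw⟩ := h
  have e0 : List.replicate (p + 1) 0 ++ v :: (List.replicate q 0 ++ R)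
      = List.replicate p 0 ++ 0 :: (v :: (List.replicate q 0 ++ R)) := by
    rw [List.replicate_succ']
    simp
  set i : Fin N := ⟨p, by omega⟩ with hi
  set k : Fin N := ⟨p + 1, by omega⟩ with hk
  have hlen : (List.replicate (p + 1) 0 ++ v :: (List.replicate q 0 ++ R)).length = N := by
    simp
    omega
  have hηi : exps N (List.replicate (p + 1) 0 ++ v :: (List.replicate q 0 ++ R)) i = 0 := by
    rw [exps_apply, e0]
    simp [hi]
  have hηk : exps N (List.replicate (p + 1) 0 ++ v :: (List.replicate q 0 ++ R)) k = v := by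
    rw [exps_apply]
    simp [hk]
  have hrk : rank (exps N (List.replicate (p + 1) 0 ++ v :: (List.replicate q 0 ++ R))) k
      = R.countP (fun y => v < y) := by
    rw [coe_exps, rank_getD _ _ _ hlen k (by simp [hk])]
    rw [List.countP_append, List.countP_replicate, List.countP_replicate]
    simp [hv.ne']
  have hri : rank (exps N (List.replicate (p + 1) 0 ++ v :: (List.replicate q 0 ++ R))) i
      = p + (R.length + 1) := by
    have hlen' := hlen
    rw [e0] at hlen'
    rw [coe_exps, e0, rank_getD _ _ _ hlen' i (by simp [hi])]
    rw [List.countP_cons, List.countP_append, List.countP_replicate, List.countP_replicate]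
    have : R.countP (fun y => decide (0 < y)) = R.length := by
      rw [List.countP_eq_length]
      simpa using hR
    rw [this]
    simp [hv]
  have hlt : exps N (List.replicate (p + 1) 0 ++ v :: (List.replicate q 0 ++ R)) i
      < exps N (List.replicate (p + 1) 0 ++ v :: (List.replicate q 0 ++ R)) k := by
    rw [hηi, hηk]
    exact hv
  have hnew := isNonsymJack_swap hα hf (i := i) (k := k) rfl hlt
  have hkey : exps N (List.replicate p 0 ++ v :: (List.replicate (q + 1) 0 ++ R))
      = (exps N (List.replicate (p + 1) 0 ++ v :: (List.replicate q 0 ++ R))).mapDomain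
        (Equiv.swap i k) := by
    ext l
    rw [← Finsupp.equivMapDomain_eq_mapDomain, Finsupp.equivMapDomain_apply, Equiv.symm_swap,
      Equiv.swap_apply_def]
    split_ifs with h1 h2
    · rw [h1, hηk, exps_apply]
      simp [hi]
    · rw [h2, hηi, exps_apply]
      have : k.val = (List.replicate p 0).length + 1 := by simp [hk]
      rw [this, List.getD_append_right _ _ _ _ (by simp)]
      simp [List.replicate_succ]
    · rw [exps_apply, exps_apply, e0]
      have h1' : l.val ≠ p := fun e => h1 (Fin.ext e)
      have h2' : l.val ≠ p + 1 := fun e => h2 (Fin.ext e)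
      rcases lt_or_ge l.val p with h3 | h3
      · rw [List.getD_append _ _ _ _ (by simpa using h3),
          List.getD_append _ _ _ _ (by simpa using h3)]
      · obtain ⟨d, hd⟩ := Nat.exists_eq_add_of_le (show p + 2 ≤ l.val by omega)
        rw [List.getD_append_right _ _ _ _ (by simpa using h3),
          List.getD_append_right _ _ _ _ (by simpa using h3), hd, List.length_replicate]
        have : p + 2 + d - p = d + 1 + 1 := by omega
        rw [this, List.replicate_succ]
        simp
  rw [JackValue, hkey]
  refine ⟨_, hnew, ?_⟩
  rw [map_add, eval_rename, smul_eval]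
  have : (fun _ : Fin N => (1 : K)) ∘ (Equiv.swap i k) = fun _ => 1 := rfl
  rw [this, hw]
  unfold spec
  rw [hηi, hηk, hrk, hri]
  push_cast
  rw [mul_add, mul_one, mul_comm w]
  congr 3
  ring

/-- Moving a nonzero entry to the front through zeros. -/
theorem JackValue.move (hα : 0 < α) {N : ℕ} {v : ℕ} {R : List ℕ} (hv : 0 < v)
    (hR : ∀ x ∈ R, 0 < x) {p : ℕ} (q : ℕ) (hN : p + (q + R.length + 1) = N) {w : K}
    (h : JackValue α N (List.replicate p 0 ++ v :: (List.replicate q 0 ++ R)) w) :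
    JackValue α N (v :: (List.replicate (p + q) 0 ++ R))
      (w * ((α * v - R.countP (fun y => v < y) + R.length + 1 + p)
        / (α * v - R.countP (fun y => v < y) + R.length + 1))) := by
  have hc : ((R.countP fun y => v < y : ℕ) : K) ≤ R.length := by
    exact_mod_cast List.countP_le_length
  have hav : 0 < α * v := mul_pos hα (by exact_mod_cast hv)
  have hpos : ∀ p : ℕ, 0 < α * v - R.countP (fun y => v < y) + R.length + 1 + p := fun p => by
    have : (0 : K) ≤ p := Nat.cast_nonneg p
    linarith
  induction p generalizing q w with
  | zero =>
    have h0 := (hpos 0).ne'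
    rw [Nat.cast_zero, add_zero] at h0 ⊢
    rw [div_self h0, mul_one, zero_add]
    simpa using h
  | succ p ih =>
    -- The factors `(x + p + 1) / (x + p)` telescope.
    have h1 := ih (q + 1) (by omega) (h.swap hα q (by omega) hv hR)
    have e : p + (q + 1) = p + 1 + q := by omega
    rw [e] at h1
    convert h1 using 1
    have h2 := (hpos p).ne'
    rw [mul_assoc]
    congr 1
    push_cast
    field_simp
    ring

theorem JackValue.raise {x : ℕ} {L : List ℕ} (hL : L.length = M) {w : K}
    (h : JackValue α (M + 1) (x :: L) w) : JackValue α (M + 1) (L ++ [x + 1]) w := by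
  obtain ⟨f, hf, hw⟩ := h
  have hkey : exps (M + 1) (L ++ [x + 1]) = JackConnection.raise (exps (M + 1) (x :: L)) := by
    ext l
    rw [raise_apply, exps_apply, exps_apply]
    rcases eq_or_ne l (Fin.last M) with rfl | hl
    · rw [if_pos rfl, finRotate_last, Fin.val_last, List.getD_append_right _ _ _ _ hL.le, hL]
      simp
    · rw [if_neg hl, coe_finRotate_of_ne_last hl,
        List.getD_append _ _ _ _ (by rw [hL]; exact Fin.val_lt_last hl)]
      simp
  rw [JackValue, hkey]
  refine ⟨_, isNonsymJack_raise hf, ?_⟩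
  rw [affineRaise_apply, map_mul, eval_X, one_mul, eval_rename]
  exact hw

/-- The factor by which the value at `(1, …, 1)` changes when an entry `x` preceded by `r` entries
is moved in front of the zeros, where `ℓ` is the number of nonzero entries among `N`. -/
noncomputable def moveFactor (α : K) (N ℓ x r : ℕ) : K :=
  if x = 0 then 1 else (α * x - r + N) / (α * x - r + ℓ)

/-- The entry after the leading zeros is moved to the front and then sent by the affine intertwiner
to the end, increased by one. An entry `x = 0` is indistinguishable from those zeros and needs no
swap, which is why `moveFactor` is `1` there. -/
theorem JackValue.cycle (hα : 0 < α) {a x : ℕ} {R : List ℕ} (hN : a + (R.length + 1) = M + 1)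
    (hR : 0 < x → ∀ y ∈ R, 0 < y) {w : K}
    (h : JackValue α (M + 1) (List.replicate a 0 ++ x :: R) w) :
    JackValue α (M + 1) (List.replicate a 0 ++ (R ++ [x + 1]))
      (w * moveFactor α (M + 1) (R.length + 1) x (R.countP fun y => x < y)) := by
  rw [← List.append_assoc]
  apply JackValue.raise
  · simp
    omega
  · rcases Nat.eq_zero_or_pos x with rfl | hx
    · rw [moveFactor, if_pos rfl, mul_one]
      convert h using 1
      rw [← List.cons_append, ← List.replicate_succ, List.replicate_succ']
      simp
    · have h1 := JackValue.move (N := M + 1) (w := w) hα hx (hR hx) (p := a) 0 (by omega)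
        (by simpa using h)
      rw [add_zero] at h1
      rw [moveFactor, if_neg hx.ne', ← hN]
      convert h1 using 3 <;> · push_cast; ring

/-- Adding a column to the nonsymmetric Jack polynomial with increasing exponents. -/
theorem JackValue.column_aux (hα : 0 < α) {a : ℕ} {μ : List ℕ} (hN : a + μ.length = M + 1)
    (hμ : μ.Pairwise (· ≤ ·)) {w : K} (h : JackValue α (M + 1) (List.replicate a 0 ++ μ) w)
    {k : ℕ} (hk : k ≤ μ.length) :
    JackValue α (M + 1) (List.replicate a 0 ++ (μ.drop k ++ (μ.take k).map Nat.succ))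
      (w * ∏ i ∈ Finset.range k, moveFactor α (M + 1) μ.length (μ.getD i 0)
        ((μ.take i).countP (fun y => μ.getD i 0 ≤ y)
          + (μ.drop (i + 1)).countP (fun y => μ.getD i 0 < y))) := by
  induction k with
  | zero => simpa using h
  | succ k ih =>
    have hk' : k < μ.length := hk
    have h1 := ih hk'.le
    have hd : μ.drop k = μ.getD k 0 :: μ.drop (k + 1) := by
      rw [List.drop_eq_getElem_cons hk', List.getD_eq_getElem _ _ hk']
    have ht : μ.take (k + 1) = μ.take k ++ [μ.getD k 0] := by
      rw [List.take_succ_eq_append_getElem hk', List.getD_eq_getElem _ _ hk']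
    have hle : ∀ y ∈ μ.drop (k + 1), μ.getD k 0 ≤ y := by
      have := hμ.drop (i := k)
      rw [hd] at this
      exact (List.pairwise_cons.1 this).1
    have h1' := h1
    rw [hd, List.cons_append] at h1'
    have hlen : (μ.drop (k + 1) ++ (μ.take k).map Nat.succ).length + 1 = μ.length := by
      simp
      omega
    have h2 := JackValue.cycle hα (by rw [hlen]; exact hN) (fun hx y hy => by
      rcases List.mem_append.1 hy with hy | hy
      · exact hx.trans_le (hle y hy)
      · obtain ⟨z, _, rfl⟩ := List.mem_map.1 hy
        exact Nat.succ_pos z) h1'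
    -- Entries already processed have been increased by one, so the strict comparison with them
    -- becomes a weak one with the original entries. This is the tie rule in `rank`.
    have hc : ((fun y => decide (μ.getD k 0 < y)) ∘ Nat.succ)
        = fun y => decide (μ.getD k 0 ≤ y) := by
      funext y
      simp
    rw [hlen, List.countP_append, List.countP_map, hc,
      add_comm (List.countP _ (μ.drop (k + 1)))] at h2
    rw [Finset.prod_range_succ, ← mul_assoc, ht]
    convert h2 using 2
    simp

/-- Both `rank` and `ρ` list the entries in decreasing order and can differ only inside ties, where
the values agree. This turns a product over positions of the increasing list into a product over
rows. -/
theorem eq_apply_rank {ℓ : ℕ} {ρ : ℕ → ℕ} (hρ : Antitone ρ) (η : Fin ℓ → ℕ)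
    (hη : ∀ i : Fin ℓ, η i = ρ (ℓ - 1 - i)) (i : Fin ℓ) : ρ (rank η i) = η i := by
  classical
  have himg : ∀ m ≤ ℓ, (Finset.univ.filter fun j : Fin ℓ => ℓ - 1 - j.val < m).card = m := by
    intro m hm
    have : (Finset.univ.filter fun j : Fin ℓ => ℓ - 1 - j.val < m)
        = (Finset.univ.filter fun j : Fin ℓ => j.val < m).map Fin.revPerm.toEmbedding := by
      ext j
      simp only [Finset.mem_filter, Finset.mem_univ, true_and, Finset.mem_map_equiv,
        Fin.revPerm_symm, Fin.revPerm_apply, Fin.val_rev]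
      have := j.isLt
      omega
    rw [this, Finset.card_map, Fin.card_filter_val_lt]
    omega
  have hr := rank_lt η i
  apply le_antisymm
  · by_contra! hlt
    have hsub : (Finset.univ.filter fun j : Fin ℓ => ℓ - 1 - j.val < rank η i + 1)
        ⊆ Finset.univ.filter fun j => Precedes η j i := by
      intro j hj
      simp only [Finset.mem_filter, Finset.mem_univ, true_and] at hj ⊢
      refine Or.inl (hlt.trans_le ?_)
      rw [hη j]
      exact hρ (by omega)
    have := Finset.card_le_card hsub
    rw [himg _ hr] at this
    exact absurd this (by rw [rank]; omega)
  · by_contra! hlt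
    have hsub : insert i (Finset.univ.filter fun j => Precedes η j i)
        ⊆ Finset.univ.filter fun j : Fin ℓ => ℓ - 1 - j.val < rank η i := by
      intro j hj
      have hj' : η i ≤ η j := by
        rcases Finset.mem_insert.1 hj with rfl | hj
        · exact le_rfl
        · have := (Finset.mem_filter.1 hj).2
          unfold Precedes at this
          omega
      refine Finset.mem_filter.2 ⟨Finset.mem_univ _, ?_⟩
      by_contra! hge
      have := hρ hge
      rw [← hη j] at this
      omega
    have := Finset.card_le_card hsub
    rw [himg _ hr.le, Finset.card_insert_of_notMem] at this
    · exact absurd this (by rw [rank]; omega)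
    · exact fun h => precedes_irrefl η i (Finset.mem_filter.1 h).2

/-- The increasing list of the `N` first values of `ρ`, lowered by `j`. -/
def stage (N : ℕ) (ρ : ℕ → ℕ) (j : ℕ) : List ℕ :=
  (List.range N).map fun i => ρ (N - 1 - i) - j

/-- The `ℓ` rows longer than `j` are each cycled once and receive one box; truncated subtraction
makes the remaining entries zero at both levels. Rows of length exactly `j + 1` start from `0` and
contribute the factor `1`. -/
theorem JackValue.column (hα : 0 < α) {ρ : ℕ → ℕ} (hρ : Antitone ρ) {j ℓ : ℕ} (hℓ : ℓ ≤ M + 1)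
    (h1 : ∀ i < ℓ, j < ρ i) (h2 : ∀ i, ℓ ≤ i → ρ i ≤ j) {w : K}
    (h : JackValue α (M + 1) (stage (M + 1) ρ (j + 1)) w) :
    JackValue α (M + 1) (stage (M + 1) ρ j)
      (w * ∏ m ∈ Finset.range ℓ, moveFactor α (M + 1) ℓ (ρ m - (j + 1)) m) := by
  set μ : List ℕ := (List.range ℓ).map fun i => ρ (ℓ - 1 - i) - (j + 1) with hμ
  have hlen : μ.length = ℓ := by simp [hμ]
  have hget : ∀ i < ℓ, μ.getD i 0 = ρ (ℓ - 1 - i) - (j + 1) := fun i hi => by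
    rw [List.getD_eq_getElem _ _ (by omega)]
    simp [hμ]
  have hs1 : stage (M + 1) ρ (j + 1) = List.replicate (M + 1 - ℓ) 0 ++ μ := by
    apply List.ext_getElem
    · simp [stage, hlen]
      omega
    · intro i hi hi'
      simp only [stage, List.length_map, List.length_range] at hi
      rw [List.getElem_append]
      simp only [stage, List.getElem_map, List.getElem_range, List.length_replicate,
        List.getElem_replicate, hμ]
      split_ifs with h3
      · have := h2 (M + 1 - 1 - i) (by omega)
        omega
      · congr 2
        omega
  have hs2 : stage (M + 1) ρ j = List.replicate (M + 1 - ℓ) 0 ++ μ.map Nat.succ := by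
    apply List.ext_getElem
    · simp [stage, hlen]
      omega
    · intro i hi hi'
      simp only [stage, List.length_map, List.length_range] at hi
      rw [List.getElem_append]
      simp only [stage, List.getElem_map, List.getElem_range, List.length_replicate,
        List.getElem_replicate, hμ]
      split_ifs with h3
      · have := h2 (M + 1 - 1 - i) (by omega)
        omega
      · have h4 := h1 (ℓ - 1 - (i - (M + 1 - ℓ))) (by omega)
        have h5 : M + 1 - 1 - i = ℓ - 1 - (i - (M + 1 - ℓ)) := by omega
        rw [h5]
        omega
  have hpw : μ.Pairwise (· ≤ ·) := by
    rw [hμ, List.pairwise_map]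
    refine List.pairwise_lt_range.imp fun {a b} hab => ?_
    have := hρ (show ℓ - 1 - b ≤ ℓ - 1 - a by omega)
    omega
  rw [hs1] at h
  have hfin := JackValue.column_aux hα (by rw [hlen]; omega) hpw h le_rfl
  rw [List.drop_length, List.take_length, List.nil_append, ← hs2, hlen] at hfin
  convert hfin using 2
  set η : Fin ℓ → ℕ := fun i => μ.getD i 0 with hη
  have hr : ∀ i : Fin ℓ, rank η i = (μ.take i).countP (fun y => μ.getD i 0 ≤ y)
      + (μ.drop (i + 1)).countP (fun y => μ.getD i 0 < y) := by
    intro i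
    have hi : i.val < μ.length := by rw [hlen]; exact i.isLt
    have hsplit : μ = μ.take i ++ μ.getD i 0 :: μ.drop (i + 1) := by
      rw [List.getD_eq_getElem _ _ hi, ← List.drop_eq_getElem_cons hi, List.take_append_drop]
    rw [← rank_getD (N := ℓ) _ _ _ (by rw [← hsplit]; exact hlen) i (by simp; omega), ← hsplit]
  rw [Finset.prod_range fun i => moveFactor α (M + 1) ℓ (μ.getD i 0) _]
  have hanti : Antitone fun m => ρ m - (j + 1) := fun a b hab => Nat.sub_le_sub_right (hρ hab) _
  have hcomp := eq_apply_rank hanti η (fun i => hget i i.isLt)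
  calc ∏ m ∈ Finset.range ℓ, moveFactor α (M + 1) ℓ (ρ m - (j + 1)) m
      = ∏ m : Fin ℓ, moveFactor α (M + 1) ℓ (ρ m - (j + 1)) m := Finset.prod_range _
    _ = ∏ i : Fin ℓ, moveFactor α (M + 1) ℓ (ρ (rank η i) - (j + 1)) (rank η i) :=
        (prod_rank η fun m => moveFactor α (M + 1) ℓ (ρ m - (j + 1)) m).symm
    _ = _ := Finset.prod_congr rfl fun i _ => by
        have := hcomp i
        rw [this, hr i]

/-- The diagram is built column by column from right to left. At level `J` all entries are truncated
to zero and the polynomial is `1`. -/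
theorem JackValue.of_stages (hα : 0 < α) {ρ : ℕ → ℕ} (hρ : Antitone ρ) {ℓ : ℕ → ℕ}
    (hℓ : ∀ j, ℓ j ≤ M + 1) (h1 : ∀ j, ∀ i < ℓ j, j < ρ i) (h2 : ∀ j i, ℓ j ≤ i → ρ i ≤ j)
    {J : ℕ} (hJ : ∀ i, ρ i ≤ J) : JackValue α (M + 1) (stage (M + 1) ρ 0)
      (∏ j ∈ Finset.range J, ∏ m ∈ Finset.range (ℓ j),
        moveFactor α (M + 1) (ℓ j) (ρ m - (j + 1)) m) := by
  have key : ∀ k, k ≤ J → JackValue α (M + 1) (stage (M + 1) ρ (J - k))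
      (∏ j ∈ Finset.Ico (J - k) J, ∏ m ∈ Finset.range (ℓ j),
        moveFactor α (M + 1) (ℓ j) (ρ m - (j + 1)) m) := by
    intro k
    induction k with
    | zero =>
      intro _
      rw [Nat.sub_zero, Finset.Ico_self, Finset.prod_empty]
      refine ⟨1, ?_, by simp⟩
      convert isNonsymJack_zero α using 1
      ext i
      have : (stage (M + 1) ρ J)[i.val]? = some 0 := by
        simp [stage, hJ, Nat.lt_succ_iff.1 i.isLt]
      simp [exps_apply, List.getD, this]
    | succ k ih =>
      intro hk
      have h3 := ih (by omega)
      have e : J - k = J - (k + 1) + 1 := by omega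
      have h4 := JackValue.column hα hρ (hℓ (J - (k + 1))) (h1 _) (h2 _) (by rwa [e] at h3)
      rw [← e, mul_comm] at h4
      rwa [Finset.prod_eq_prod_Ico_succ_bot (by omega), ← e]
  have := key J le_rfl
  rwa [Nat.sub_self, Nat.Ico_zero_eq_range] at this

end Values

end JackConnection
namespace JackConnection

/-! ### Power sums and monomial symmetric functions. -/

section PowerSums

variable {K σ : Type*} [Field K]

/-- The multiset of the nonzero exponents. -/
def expParts (d : σ →₀ ℕ) : Multiset ℕ := d.support.val.map d

open Classical in
/-- The power sum in an arbitrary set of variables. -/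
noncomputable def powerSumIn (K σ : Type*) [Field K] (k : ℕ) : MvPowerSeries σ K :=
  fun d => if ∃ i : σ, d = Finsupp.single i k then 1 else 0

theorem coeff_powerSumIn_mul {k : ℕ} (hk : 0 < k) (G : MvPowerSeries σ K) (d : σ →₀ ℕ) :
    MvPowerSeries.coeff d (powerSumIn K σ k * G)
      = ∑ i ∈ d.support,
        if k ≤ d i then MvPowerSeries.coeff (d - Finsupp.single i k) G else 0 := by
  classical
  rw [MvPowerSeries.coeff_mul, ← Finset.sum_filter]
  have h1 : ∀ p ∈ Finset.HasAntidiagonal.antidiagonal d, MvPowerSeries.coeff p.1 (powerSumIn K σ k)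
      * MvPowerSeries.coeff p.2 G
      = if ∃ i : σ, p.1 = Finsupp.single i k then MvPowerSeries.coeff p.2 G else 0 := by
    intro p _
    rw [MvPowerSeries.coeff_apply, powerSumIn, ite_mul, one_mul, zero_mul]
  rw [Finset.sum_congr rfl h1, ← Finset.sum_filter]
  symm
  refine Finset.sum_bij (fun i _ => (Finsupp.single i k, d - Finsupp.single i k)) ?_ ?_ ?_ ?_
  · intro i hi
    have hki := (Finset.mem_filter.1 hi).2
    refine Finset.mem_filter.2 ⟨Finset.HasAntidiagonal.mem_antidiagonal.2 ?_, i, rfl⟩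
    exact add_tsub_cancel_of_le (Finsupp.single_le_iff.2 hki)
  · intro i _ j _ hij
    exact (Finsupp.single_left_inj hk.ne').1 (Prod.ext_iff.1 hij).1
  · rintro ⟨a, b⟩ hab
    obtain ⟨hab, i, rfl : a = _⟩ := Finset.mem_filter.1 hab
    rw [Finset.HasAntidiagonal.mem_antidiagonal] at hab
    have hle : k ≤ d i := by
      rw [← hab]
      simp
    refine ⟨i, Finset.mem_filter.2 ⟨Finsupp.mem_support_iff.2 (by omega), hle⟩, ?_⟩
    simp only [Prod.mk.injEq, true_and]
    rw [← hab]
    simp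
  · intro i _
    rfl

/-- The multiset obtained from `s` by lowering the element `v` by `k` and dropping a zero. -/
def lowerPart (s : Multiset ℕ) (v k : ℕ) : Multiset ℕ :=
  if v = k then s.erase v else (v - k) ::ₘ s.erase v

theorem expParts_sub_single [DecidableEq σ] {k : ℕ} (hk : 0 < k) {d : σ →₀ ℕ} {i : σ}
    (h : k ≤ d i) : expParts (d - Finsupp.single i k) = lowerPart (expParts d) (d i) k := by
  have hi : i ∈ d.support := Finsupp.mem_support_iff.2 (by omega)
  have hd : expParts d = d i ::ₘ (d.support.erase i).val.map d := by
    conv_lhs => rw [expParts, ← Finset.insert_erase hi]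
    rw [Finset.insert_val_of_notMem (Finset.notMem_erase _ _), Multiset.map_cons]
  have hval : ∀ l ≠ i, (d - Finsupp.single i k) l = d l := fun l hl => by
    simp [hl.symm]
  have hvali : (d - Finsupp.single i k) i = d i - k := by simp
  have hrest : (d.support.erase i).val.map (d - Finsupp.single i k)
      = (d.support.erase i).val.map d :=
    Multiset.map_congr rfl fun l hl => hval l (Finset.ne_of_mem_erase (Finset.mem_def.2 hl))
  rw [lowerPart, hd, Multiset.erase_cons_head, expParts]
  split_ifs with hik
  · have hs : (d - Finsupp.single i k).support = d.support.erase i := by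
      ext l
      rw [Finset.mem_erase, Finsupp.mem_support_iff, Finsupp.mem_support_iff]
      rcases eq_or_ne l i with rfl | hl
      · rw [hvali]
        simp
        omega
      · rw [hval l hl]
        simp [hl]
    rw [hs, hrest]
  · have hs : (d - Finsupp.single i k).support = insert i (d.support.erase i) := by
      ext l
      rw [Finset.insert_erase hi, Finsupp.mem_support_iff, Finsupp.mem_support_iff]
      rcases eq_or_ne l i with rfl | hl
      · rw [hvali]
        omega
      · rw [hval l hl]
    rw [hs, Finset.insert_val_of_notMem (Finset.notMem_erase _ _), Multiset.map_cons, hrest,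
      hvali]

/-- The coefficient of a monomial with exponents `s` in the product of the power sums listed by
`L`. -/
def powerSumEntry : List ℕ → Multiset ℕ → ℕ
  | [], s => if s = 0 then 1 else 0
  | k :: L, s => (s.map fun v => if k ≤ v then powerSumEntry L (lowerPart s v k) else 0).sum

/-- The count depends only on the multiset of exponents, not on the set of variables. This links the
series in infinitely many variables with the polynomials in `N` variables. -/
theorem coeff_prod_powerSumIn (L : List ℕ) (hL : ∀ k ∈ L, 0 < k) (d : σ →₀ ℕ) :
    MvPowerSeries.coeff d (L.map (powerSumIn K σ)).prod = powerSumEntry L (expParts d) := by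
  classical
  induction L generalizing d with
  | nil =>
    rw [List.map_nil, List.prod_nil, MvPowerSeries.coeff_one, powerSumEntry]
    simp [expParts]
  | cons k L ih =>
    have hk := hL k (by simp)
    rw [List.map_cons, List.prod_cons, coeff_powerSumIn_mul hk, powerSumEntry]
    have h1 : ((expParts d).map fun v =>
        if k ≤ v then powerSumEntry L (lowerPart (expParts d) v k) else 0).sum
        = ∑ i ∈ d.support,
          if k ≤ d i then powerSumEntry L (lowerPart (expParts d) (d i) k) else 0 := by
      conv_lhs => rw [expParts, Multiset.map_map]
      rfl
    rw [h1, Nat.cast_sum]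
    refine Finset.sum_congr rfl fun i _ => ?_
    split_ifs with h
    · rw [ih (fun l hl => hL l (by simp [hl])), expParts_sub_single hk h]
    · simp

theorem sum_lowerPart {s : Multiset ℕ} {v k : ℕ} (hv : v ∈ s) (hk : k ≤ v) :
    (lowerPart s v k).sum + k = s.sum := by
  have h := Multiset.sum_erase hv
  unfold lowerPart
  split_ifs with hvk
  · omega
  · rw [Multiset.sum_cons]
    omega

theorem exists_of_powerSumEntry_cons_ne_zero {k : ℕ} {L : List ℕ} {s : Multiset ℕ}
    (h : powerSumEntry (k :: L) s ≠ 0) :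
    ∃ v ∈ s, k ≤ v ∧ powerSumEntry L (lowerPart s v k) ≠ 0 := by
  by_contra! hc
  refine h ?_
  rw [powerSumEntry]
  refine Multiset.sum_eq_zero fun x hx => ?_
  obtain ⟨v, hv, rfl⟩ := Multiset.mem_map.1 hx
  split_ifs with hkv
  · exact hc v hv hkv
  · rfl

theorem sum_eq_of_powerSumEntry_ne_zero {L : List ℕ} {s : Multiset ℕ}
    (h : powerSumEntry L s ≠ 0) : s.sum = L.sum := by
  induction L generalizing s with
  | nil =>
    rw [powerSumEntry] at h
    split_ifs at h with hs
    · simp [hs]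
    · exact absurd rfl h
  | cons k L ih =>
    obtain ⟨v, hv, hk, h'⟩ := exists_of_powerSumEntry_cons_ne_zero h
    have := ih h'
    have := sum_lowerPart hv hk
    rw [List.sum_cons]
    omega

/-- Each element of `L` is subtracted from one element of `s` and removes at most one element;
equality of the cardinalities forces it to remove an equal one every time. So the change of basis is
triangular for the number of parts. -/
theorem card_lt_or_eq_of_powerSumEntry_ne_zero {L : List ℕ} {s : Multiset ℕ}
    (h : powerSumEntry L s ≠ 0) : s.card < L.length ∨ s = L := by
  induction L generalizing s with
  | nil =>
    rw [powerSumEntry] at h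
    split_ifs at h with hs
    · right
      simp [hs]
    · exact absurd rfl h
  | cons k L ih =>
    obtain ⟨v, hv, hk, h'⟩ := exists_of_powerSumEntry_cons_ne_zero h
    have hc := Multiset.card_erase_add_one hv
    have h2 := ih h'
    unfold lowerPart at h2
    rw [List.length_cons]
    split_ifs at h2 with hvk
    · rcases h2 with h2 | h2
      · left
        omega
      · right
        rw [← Multiset.cons_coe, ← h2, ← hvk, Multiset.cons_erase hv]
    · rw [Multiset.card_cons] at h2
      rcases h2 with h2 | h2
      · left
        omega
      · have := congrArg Multiset.card h2
        rw [Multiset.card_cons, Multiset.coe_card] at this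
        left
        omega

theorem powerSumEntry_self_ne_zero (L : List ℕ) : powerSumEntry L (L : Multiset ℕ) ≠ 0 := by
  induction L with
  | nil => simp [powerSumEntry]
  | cons k L ih =>
    rw [powerSumEntry]
    intro h
    have h2 := Multiset.le_sum_of_mem (Multiset.mem_map_of_mem
      (fun v => if k ≤ v then powerSumEntry L (lowerPart (↑(k :: L)) v k) else 0)
      (show k ∈ ((k :: L : List ℕ) : Multiset ℕ) by simp))
    rw [h, if_pos le_rfl, lowerPart, if_pos rfl, ← Multiset.cons_coe,
      Multiset.erase_cons_head] at h2
    omega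

theorem coe_rows {n : ℕ} (lam : n.Partition) : ((rows lam : List ℕ) : Multiset ℕ) = lam.parts :=
  Multiset.sort_eq _ _

theorem rows_pos {n : ℕ} (lam : n.Partition) : ∀ k ∈ rows lam, 0 < k := fun k hk =>
  lam.parts_pos (by rw [← coe_rows]; exact hk)

theorem sum_rows {n : ℕ} (lam : n.Partition) : (rows lam).sum = n := by
  rw [← Multiset.sum_coe, coe_rows, lam.parts_sum]

theorem length_rows {n : ℕ} (lam : n.Partition) : (rows lam).length = length lam := by
  rw [← Multiset.coe_card, coe_rows, length]

theorem coeff_powerSumPart {n : ℕ} (lam : n.Partition) (d : ℕ →₀ ℕ) :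
    MvPowerSeries.coeff d (powerSumPart K lam) = powerSumEntry (rows lam) (expParts d) := by
  rw [← coeff_prod_powerSumIn _ (rows_pos lam), powerSumPart, ← coe_rows, Multiset.map_coe,
    Multiset.prod_coe]
  rfl

theorem coeff_monomialSymm {n : ℕ} (mu : n.Partition) (d : ℕ →₀ ℕ) :
    MvPowerSeries.coeff d (monomialSymm K mu) = if expParts d = mu.parts then 1 else 0 := by
  rw [MvPowerSeries.coeff_apply, monomialSymm]
  congr

/-- The product of the power sums `p_{lam_i}` in finitely many variables. -/
noncomputable def powerSumPoly (K : Type*) [Field K] (N : ℕ) {n : ℕ} (lam : n.Partition) :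
    MvPolynomial (Fin N) K :=
  (lam.parts.map (MvPolynomial.psum (Fin N) K)).prod

theorem coe_psum {N k : ℕ} (hk : 0 < k) :
    (MvPolynomial.psum (Fin N) K k : MvPowerSeries (Fin N) K) = powerSumIn K (Fin N) k := by
  classical
  ext d
  rw [MvPolynomial.coeff_coe, MvPolynomial.psum, MvPolynomial.coeff_sum,
    MvPowerSeries.coeff_apply, powerSumIn]
  simp_rw [MvPolynomial.coeff_X_pow]
  split_ifs with h
  · obtain ⟨i, rfl⟩ := h
    rw [Finset.sum_eq_single i]
    · simp
    · intro j _ hj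
      rw [if_neg]
      intro h
      exact hj ((Finsupp.single_left_inj hk.ne').1 h)
    · simp
  · refine Finset.sum_eq_zero fun i _ => if_neg fun hi => h ⟨i, hi.symm⟩

theorem coeff_powerSumPoly {N n : ℕ} (lam : n.Partition) (d : Fin N →₀ ℕ) :
    MvPolynomial.coeff d (powerSumPoly K N lam) = powerSumEntry (rows lam) (expParts d) := by
  rw [← coeff_prod_powerSumIn _ (rows_pos lam), powerSumPoly, ← MvPolynomial.coeff_coe,
    ← coe_rows, Multiset.map_coe, Multiset.prod_coe, ← MvPolynomial.coeToMvPowerSeries.ringHom_apply,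
    map_list_prod, List.map_map]
  congr 2
  refine List.map_congr_left fun k hk => ?_
  exact coe_psum (rows_pos lam k hk)

theorem expParts_eq_filter {N : ℕ} (d : Fin N →₀ ℕ) :
    expParts d = (Finset.univ.val.map d).filter (· ≠ 0) := by
  have : d.support = Finset.univ.filter fun i => d i ≠ 0 := by
    ext i
    simp
  rw [expParts, this, Finset.filter_val, Multiset.filter_map]
  rfl

theorem map_exps {N : ℕ} {L : List ℕ} (hL : L.length = N) :
    Finset.univ.val.map (exps N L) = (L : Multiset ℕ) := by
  subst hL
  rw [Fin.univ_val_map]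
  congr 1
  apply List.ext_getElem
  · simp
  · intro i h1 h2
    simp [exps_apply, List.getElem?_eq_getElem h2]

theorem exists_expParts_eq_fin {N : ℕ} {s : Multiset ℕ} (hs : 0 ∉ s) (hN : s.card ≤ N) :
    ∃ d : Fin N →₀ ℕ, expParts d = s := by
  refine ⟨exps N (s.toList ++ List.replicate (N - s.card) 0), ?_⟩
  rw [expParts_eq_filter, map_exps (by simp; omega), ← Multiset.coe_add, Multiset.coe_toList,
    Multiset.filter_add, Multiset.filter_eq_self.2, Multiset.filter_eq_nil.2, add_zero]
  · intro a ha
    have := List.eq_of_mem_replicate (Multiset.mem_coe.1 ha)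
    simpa using this
  · intro a ha h
    exact hs (h ▸ ha)

theorem exists_expParts_eq {s : Multiset ℕ} (hs : 0 ∉ s) : ∃ d : ℕ →₀ ℕ, expParts d = s := by
  obtain ⟨d, hd⟩ := exists_expParts_eq_fin hs le_rfl
  refine ⟨d.embDomain Fin.valEmbedding, ?_⟩
  refine Eq.trans ?_ hd
  rw [expParts, expParts, Finsupp.support_embDomain, Finset.map_val, Multiset.map_map]
  exact Multiset.map_congr rfl fun i _ => Finsupp.embDomain_apply_self _ _ _

theorem zero_notMem_parts {n : ℕ} (mu : n.Partition) : 0 ∉ mu.parts := fun h =>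
  (mu.parts_pos h).ne' rfl

theorem expParts_ne_zero (d : σ →₀ ℕ) : 0 ∉ expParts d := by
  rw [expParts, Multiset.mem_map]
  rintro ⟨i, hi, h0⟩
  exact Finsupp.mem_support_iff.1 hi h0

/-- The partition whose parts are the nonzero exponents. -/
def partitionOf {n : ℕ} (s : Multiset ℕ) (hs : 0 ∉ s) (hn : s.sum = n) : n.Partition where
  parts := s
  parts_pos := fun hi => Nat.pos_of_ne_zero fun h => hs (h ▸ hi)
  parts_sum := hn

theorem coeff_sum_powerSumPart {n : ℕ} (c : n.Partition → K) (d : ℕ →₀ ℕ) :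
    MvPowerSeries.coeff d (∑ mu, c mu • powerSumPart K mu)
      = ∑ mu, c mu * powerSumEntry (rows mu) (expParts d) := by
  rw [map_sum]
  exact Finset.sum_congr rfl fun mu _ => by rw [map_smul, coeff_powerSumPart, smul_eq_mul]

variable [CharZero K]

/-- The change of basis from power sums to monomial symmetric functions. -/
noncomputable def powerSumToMonomial (K : Type*) [Field K] (n : ℕ) :
    (n.Partition → K) →ₗ[K] (n.Partition → K) where
  toFun c mu := ∑ lam, c lam * powerSumEntry (rows lam) mu.parts
  map_add' c c' := by
    funext mu
    simp [add_mul, Finset.sum_add_distrib]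
  map_smul' a c := by
    funext mu
    simp [Finset.mul_sum, mul_assoc]

/-- For a longest partition in the support of `c`, triangularity leaves only the diagonal entry in
the corresponding monomial coefficient. That entry is a nonzero natural number, hence nonzero in
characteristic zero. Injectivity makes the choice in `powerSumCoeff` unique. -/
theorem powerSumToMonomial_injective (n : ℕ) :
    Function.Injective (powerSumToMonomial K n) := by
  classical
  rw [← LinearMap.ker_eq_bot, LinearMap.ker_eq_bot']
  intro c hc
  by_contra hne
  have hne' : (Finset.univ.filter fun lam => c lam ≠ 0).Nonempty := by
    by_contra hemp
    rw [Finset.not_nonempty_iff_eq_empty, Finset.filter_eq_empty_iff] at hemp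
    exact hne (funext fun lam => not_not.1 (hemp (Finset.mem_univ lam)))
  obtain ⟨lam, hlam, hmax⟩ := Finset.exists_max_image _ (fun lam => length lam) hne'
  have h1 : ∑ nu, c nu * (powerSumEntry (rows nu) lam.parts : K) = 0 := congrFun hc lam
  rw [Finset.sum_eq_single lam] at h1
  · rcases mul_eq_zero.1 h1 with h | h
    · exact (Finset.mem_filter.1 hlam).2 h
    · rw [← coe_rows] at h
      exact powerSumEntry_self_ne_zero _ (by exact_mod_cast h)
  · intro nu _ hnu
    by_contra hprod
    have h2 := hmax nu (Finset.mem_filter.2 ⟨Finset.mem_univ _, left_ne_zero_of_mul hprod⟩)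
    have h3 : powerSumEntry (rows nu) lam.parts ≠ 0 := fun h =>
      right_ne_zero_of_mul hprod (by rw [h, Nat.cast_zero])
    rcases card_lt_or_eq_of_powerSumEntry_ne_zero h3 with h | h
    · rw [length_rows] at h
      exact absurd h2 (not_le.2 h)
    · rw [coe_rows] at h
      exact hnu (Nat.Partition.ext h.symm)
  · simp

theorem sum_powerSumPart_injective {n : ℕ} {c c' : n.Partition → K}
    (h : ∑ mu, c mu • powerSumPart K mu = ∑ mu, c' mu • powerSumPart K mu) : c = c' := by
  apply powerSumToMonomial_injective
  funext mu
  obtain ⟨d, hd⟩ := exists_expParts_eq (zero_notMem_parts mu)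
  have := congrArg (MvPowerSeries.coeff d) h
  rwa [coeff_sum_powerSumPart, coeff_sum_powerSumPart, hd] at this

theorem powerSumCoeff_sum {n : ℕ} (c : n.Partition → K) (lam : n.Partition) :
    powerSumCoeff (∑ mu, c mu • powerSumPart K mu) lam = c lam := by
  have h : ∃ c' : n.Partition → K,
      ∑ mu, c mu • powerSumPart K mu = ∑ mu, c' mu • powerSumPart K mu := ⟨c, rfl⟩
  rw [powerSumCoeff, dif_pos h]
  exact congrFun (sum_powerSumPart_injective h.choose_spec).symm lam

/-- The monomial symmetric functions are linear combinations of power sums. -/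
theorem exists_monomialSymm_eq {n : ℕ} (mu : n.Partition) :
    ∃ c : n.Partition → K, monomialSymm K mu = ∑ lam, c lam • powerSumPart K lam := by
  classical
  -- An injective endomorphism of a finite-dimensional space is surjective, so no explicit inverse
  -- matrix is needed.
  obtain ⟨c, hc⟩ := LinearMap.injective_iff_surjective.1 (powerSumToMonomial_injective n)
    (Pi.single mu 1 : n.Partition → K)
  refine ⟨c, ?_⟩
  ext d
  rw [coeff_sum_powerSumPart, coeff_monomialSymm]
  by_cases hd : (expParts d).sum = n
  · have h1 := congrFun hc (partitionOf (expParts d) (expParts_ne_zero d) hd)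
    change ∑ lam, c lam * (powerSumEntry (rows lam) (expParts d) : K) = _ at h1
    rw [h1, Pi.single_apply]
    congr 1
    rw [Nat.Partition.ext_iff]
    rfl
  · rw [if_neg, Finset.sum_eq_zero]
    · intro lam _
      by_contra h
      refine hd ?_
      rw [sum_eq_of_powerSumEntry_ne_zero fun h0 => right_ne_zero_of_mul h (by rw [h0, Nat.cast_zero]),
        sum_rows]
    · intro h
      exact hd (by rw [h, mu.parts_sum])

theorem exists_sum_monomialSymm_eq {n : ℕ} (u : n.Partition → K) :
    ∃ c : n.Partition → K,
      ∑ mu, u mu • monomialSymm K mu = ∑ lam, c lam • powerSumPart K lam := by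
  choose c hc using fun mu : n.Partition => exists_monomialSymm_eq (K := K) mu
  refine ⟨fun lam => ∑ mu, u mu * c mu lam, ?_⟩
  simp_rw [hc, Finset.smul_sum, Finset.sum_smul, smul_smul]
  exact Finset.sum_comm

end PowerSums

end JackConnection
namespace JackConnection

/-! ### The Laplace–Beltrami operator in the power sums. -/

section LaplaceBeltrami

open MvPolynomial

variable {K : Type*} [Field K]

/-- The norm of the monomial `∏_k p_k ^ d_k` in the power sums. -/
noncomputable def powerSumNorm (α : K) (d : ℕ →₀ ℕ) : K :=
  d.prod fun k m => (α * k) ^ m * (m.factorial : K)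

/-- The scalar product on the ring of polynomials in the power sums. -/
noncomputable def pairing (α : K) :
    MvPolynomial ℕ K →ₗ[K] MvPolynomial ℕ K →ₗ[K] K :=
  (basisMonomials ℕ K).constr K fun d => powerSumNorm α d • lcoeff K d

theorem pairing_monomial (α : K) (d : ℕ →₀ ℕ) (a : K) (G : MvPolynomial ℕ K) :
    pairing α (monomial d a) G = a * (powerSumNorm α d * coeff d G) := by
  have h : pairing α (monomial d 1) = powerSumNorm α d • lcoeff K d := by
    have := (basisMonomials ℕ K).constr_basis K (fun d => powerSumNorm α d • lcoeff K d) d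
    rwa [coe_basisMonomials] at this
  have h2 : (monomial d a : MvPolynomial ℕ K) = a • monomial d 1 := by
    rw [smul_monomial, smul_eq_mul, mul_one]
  rw [h2, map_smul, h]
  simp [lcoeff_apply]

theorem pairing_comm (α : K) (F G : MvPolynomial ℕ K) : pairing α F G = pairing α G F := by
  induction F using MvPolynomial.induction_on' with
  | add p q hp hq => rw [map_add, LinearMap.add_apply, hp, hq, map_add]
  | monomial d a =>
    induction G using MvPolynomial.induction_on' with
    | add p q hp hq => rw [map_add, hp, hq, map_add, LinearMap.add_apply]
    | monomial e b =>
      rw [pairing_monomial, pairing_monomial, coeff_monomial, coeff_monomial]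
      rcases eq_or_ne d e with rfl | h
      · simp only [if_true]
        ring
      · rw [if_neg h, if_neg h.symm]
        ring

theorem powerSumNorm_single_add (α : K) (k : ℕ) (d : ℕ →₀ ℕ) :
    powerSumNorm α (Finsupp.single k 1 + d) = α * k * (d k + 1) * powerSumNorm α d := by
  have h0 : ∀ j : ℕ, (α * (j : K)) ^ 0 * ((0 : ℕ).factorial : K) = 1 := fun j => by simp
  have hs : (Finsupp.single k 1 + d).support ⊆ insert k d.support := by
    intro j hj
    rw [Finsupp.mem_support_iff, Finsupp.add_apply, Finsupp.single_apply] at hj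
    rw [Finset.mem_insert, Finsupp.mem_support_iff]
    by_contra! h
    rw [if_neg h.1.symm, h.2] at hj
    exact hj rfl
  unfold powerSumNorm
  rw [Finsupp.prod_of_support_subset _ hs _ fun j _ => h0 j,
    Finsupp.prod_of_support_subset d (Finset.subset_insert k d.support) _ fun j _ => h0 j,
    ← Finset.mul_prod_erase _ _ (Finset.mem_insert_self k _),
    ← Finset.mul_prod_erase _ (fun j : ℕ => (α * (j : K)) ^ (d j) * ((d j).factorial : K))
      (Finset.mem_insert_self k _)]
  have : ∀ j ∈ (insert k d.support).erase k, (α * (j : K)) ^ ((Finsupp.single k 1 + d : ℕ →₀ ℕ) j)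
      * (((Finsupp.single k 1 + d : ℕ →₀ ℕ) j).factorial : K)
      = (α * (j : K)) ^ (d j) * ((d j).factorial : K) := fun j hj => by
    rw [Finsupp.add_apply, Finsupp.single_apply, if_neg (Finset.ne_of_mem_erase hj).symm, zero_add]
  rw [Finset.prod_congr rfl this, Finsupp.add_apply, Finsupp.single_eq_same, add_comm 1 (d k),
    Nat.factorial_succ, pow_succ]
  push_cast
  ring

/-- The norm of a monomial gains the factor `α k (d_k + 1)` when `p_k` is multiplied in, so
multiplication by `p_k` is adjoint to `α k ∂_k`. -/
theorem pairing_X_mul (α : K) (k : ℕ) (F G : MvPolynomial ℕ K) :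
    pairing α (X k * F) G = α * k * pairing α F (pderiv k G) := by
  induction F using MvPolynomial.induction_on' with
  | add p q hp hq => rw [mul_add, map_add, LinearMap.add_apply, hp, hq, map_add,
      LinearMap.add_apply, mul_add]
  | monomial d a =>
    rw [X, monomial_mul, one_mul, pairing_monomial, pairing_monomial, powerSumNorm_single_add,
      coeff_pderiv, add_comm d]
    ring

theorem pairing_mul_X (α : K) (k : ℕ) (F G : MvPolynomial ℕ K) :
    pairing α F (X k * G) = α * k * pairing α (pderiv k F) G := by
  rw [pairing_comm, pairing_X_mul, pairing_comm]

/-- The Laplace–Beltrami operator on polynomials in the power sums `p_1, …, p_M`. -/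
noncomputable def laplaceBeltrami (α : K) (M : ℕ) :
    MvPolynomial ℕ K →ₗ[K] MvPolynomial ℕ K :=
  ∑ k ∈ Finset.Icc 1 M, ∑ l ∈ Finset.Icc 1 M, (α * k * l) •
      (LinearMap.mulLeft K (X (k + l)) ∘ₗ (pderiv k).toLinearMap ∘ₗ (pderiv l).toLinearMap)
    + ∑ k ∈ Finset.Icc 1 M, ∑ l ∈ Finset.Icc 1 M, ((k + l : ℕ) : K) •
      (LinearMap.mulLeft K (X k * X l) ∘ₗ (pderiv (k + l)).toLinearMap)
    + ∑ k ∈ Finset.Icc 1 M, (α * k ^ 2 - k * (k - 1)) •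
      (LinearMap.mulLeft K (X k) ∘ₗ (pderiv k).toLinearMap)

theorem laplaceBeltrami_apply (α : K) (M : ℕ) (F : MvPolynomial ℕ K) :
    laplaceBeltrami α M F
      = ∑ k ∈ Finset.Icc 1 M, ∑ l ∈ Finset.Icc 1 M,
          (α * k * l) • (X (k + l) * pderiv k (pderiv l F))
        + ∑ k ∈ Finset.Icc 1 M, ∑ l ∈ Finset.Icc 1 M,
          ((k + l : ℕ) : K) • (X k * X l * pderiv (k + l) F)
        + ∑ k ∈ Finset.Icc 1 M, (α * k ^ 2 - k * (k - 1)) • (X k * pderiv k F) := by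
  simp [laplaceBeltrami, mul_assoc]

theorem pairing_merge (α : K) (k l : ℕ) (F G : MvPolynomial ℕ K) :
    pairing α ((α * k * l) • (X (k + l) * pderiv k (pderiv l F))) G
      = pairing α F (((k + l : ℕ) : K) • (X k * X l * pderiv (k + l) G)) := by
  rw [map_smul, LinearMap.smul_apply, pairing_X_mul, map_smul, mul_comm (X k) (X l),
    mul_assoc (X l), pairing_mul_X, pairing_mul_X, smul_eq_mul, smul_eq_mul]
  ring

/-- The terms that merge two power sums are adjoint to those that split one, and the diagonal terms
are self-adjoint. -/
theorem pairing_laplaceBeltrami (α : K) (M : ℕ) (F G : MvPolynomial ℕ K) :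
    pairing α (laplaceBeltrami α M F) G = pairing α F (laplaceBeltrami α M G) := by
  have h3 : ∀ k : ℕ, pairing α ((α * k ^ 2 - k * (k - 1)) • (X k * pderiv k F)) G
      = pairing α F ((α * k ^ 2 - k * (k - 1)) • (X k * pderiv k G)) := fun k => by
    rw [map_smul, LinearMap.smul_apply, pairing_X_mul, map_smul, pairing_mul_X]
  have h2 : ∀ k l : ℕ, pairing α (((k + l : ℕ) : K) • (X k * X l * pderiv (k + l) F)) G
      = pairing α F ((α * k * l) • (X (k + l) * pderiv k (pderiv l G))) := fun k l => by
    rw [pairing_comm, ← pairing_merge, pairing_comm]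
  rw [laplaceBeltrami_apply, laplaceBeltrami_apply]
  simp only [map_add, LinearMap.add_apply, map_sum, LinearMap.sum_apply, pairing_merge, h2, h3]
  ring

/-- The product of the power sums indexed by the elements of `s`. -/
noncomputable def powerProd (K : Type*) [Field K] (s : Multiset ℕ) : MvPolynomial ℕ K :=
  (s.map X).prod

theorem powerProd_cons (k : ℕ) (s : Multiset ℕ) :
    powerProd K (k ::ₘ s) = X k * powerProd K s := by
  simp [powerProd]

theorem powerProd_eq_monomial (s : Multiset ℕ) :
    powerProd K s = monomial (Multiset.toFinsupp s) 1 := by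
  induction s using Multiset.induction_on with
  | empty => simp [powerProd]
  | cons k s ih =>
    rw [powerProd_cons, ih, X, monomial_mul, one_mul, ← Multiset.singleton_add, map_add,
      Multiset.toFinsupp_singleton]

theorem pderiv_powerProd (k : ℕ) (s : Multiset ℕ) :
    pderiv k (powerProd K s) = (s.count k : K) • powerProd K (s.erase k) := by
  induction s using Multiset.induction_on with
  | empty => simp [powerProd]
  | cons a s ih =>
    rw [powerProd_cons, pderiv_mul, ih]
    rcases eq_or_ne a k with rfl | h
    · rw [pderiv_X_self, Multiset.erase_cons_head, Multiset.count_cons_self, one_mul]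
      by_cases ha : a ∈ s
      · have : powerProd K s = X a * powerProd K (s.erase a) := by
          rw [← powerProd_cons, Multiset.cons_erase ha]
        rw [mul_smul_comm, ← this, Nat.cast_succ, add_smul, one_smul, add_comm]
      · rw [Multiset.count_eq_zero_of_notMem ha]
        simp
    · rw [pderiv_X_of_ne h, zero_mul, zero_add, Multiset.erase_cons_tail _ h,
        Multiset.count_cons_of_ne h.symm, powerProd_cons, mul_smul_comm]

/-- The span of the products of power sums of degree `n` with at least `m` factors. -/
noncomputable def lengthSpan (K : Type*) [Field K] (n m : ℕ) : Submodule K (MvPolynomial ℕ K) :=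
  Submodule.span K {F | ∃ s : Multiset ℕ, 0 ∉ s ∧ s.sum = n ∧ m ≤ s.card ∧ F = powerProd K s}

theorem powerProd_mem_lengthSpan {n m : ℕ} {s : Multiset ℕ} (h0 : 0 ∉ s) (hn : s.sum = n)
    (hm : m ≤ s.card) : powerProd K s ∈ lengthSpan K n m :=
  Submodule.subset_span ⟨s, h0, hn, hm, rfl⟩

theorem natCast_count_smul_mem {S : Submodule K (MvPolynomial ℕ K)} {k : ℕ} {s : Multiset ℕ}
    {F : MvPolynomial ℕ K} (h : k ∈ s → F ∈ S) : (s.count k : K) • F ∈ S := by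
  by_cases hk : k ∈ s
  · exact S.smul_mem _ (h hk)
  · rw [Multiset.count_eq_zero_of_notMem hk, Nat.cast_zero, zero_smul]
    exact S.zero_mem

/-- Merging replaces two factors by one, splitting replaces one by two, and the last sum keeps the
product. The degree is preserved and at most one factor is lost: this is the source of the
vanishing. -/
theorem laplaceBeltrami_mem_lengthSpan (α : K) (M : ℕ) {n m : ℕ} {F : MvPolynomial ℕ K}
    (hF : F ∈ lengthSpan K n m) : laplaceBeltrami α M F ∈ lengthSpan K n (m - 1) := by
  induction hF using Submodule.span_induction with
  | zero => simp
  | add x y _ _ hx hy => rw [map_add]; exact Submodule.add_mem _ hx hy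
  | smul c x _ hx => rw [map_smul]; exact Submodule.smul_mem _ _ hx
  | mem x hx =>
    obtain ⟨s, h0, hn, hm, rfl⟩ := hx
    rw [laplaceBeltrami_apply]
    refine Submodule.add_mem _ (Submodule.add_mem _ ?_ ?_) ?_
    · refine Submodule.sum_mem _ fun k hk => Submodule.sum_mem _ fun l _ =>
        Submodule.smul_mem _ _ ?_
      rw [pderiv_powerProd, Derivation.map_smul, mul_smul_comm]
      refine natCast_count_smul_mem fun hl => ?_
      rw [pderiv_powerProd, mul_smul_comm]
      refine natCast_count_smul_mem fun hk' => ?_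
      rw [← powerProd_cons]
      have e1 := Multiset.sum_erase hl
      have e2 := Multiset.sum_erase hk'
      have e3 := Multiset.card_erase_add_one hl
      have e4 := Multiset.card_erase_add_one hk'
      refine powerProd_mem_lengthSpan ?_ ?_ ?_
      · rw [Multiset.mem_cons]
        rintro (h | h)
        · have := (Finset.mem_Icc.1 hk).1
          omega
        · exact h0 (Multiset.mem_of_mem_erase (Multiset.mem_of_mem_erase h))
      · rw [Multiset.sum_cons]
        omega
      · rw [Multiset.card_cons]
        omega
    · refine Submodule.sum_mem _ fun k hk => Submodule.sum_mem _ fun l hl =>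
        Submodule.smul_mem _ _ ?_
      rw [pderiv_powerProd, mul_smul_comm]
      refine natCast_count_smul_mem fun hkl => ?_
      rw [mul_assoc, ← powerProd_cons, ← powerProd_cons]
      have e1 := Multiset.sum_erase hkl
      have e3 := Multiset.card_erase_add_one hkl
      refine powerProd_mem_lengthSpan ?_ ?_ ?_
      · rw [Multiset.mem_cons, Multiset.mem_cons]
        rintro (h | h | h)
        · have := (Finset.mem_Icc.1 hk).1
          omega
        · have := (Finset.mem_Icc.1 hl).1
          omega
        · exact h0 (Multiset.mem_of_mem_erase h)
      · rw [Multiset.sum_cons, Multiset.sum_cons]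
        omega
      · rw [Multiset.card_cons, Multiset.card_cons]
        omega
    · refine Submodule.sum_mem _ fun k _ => Submodule.smul_mem _ _ ?_
      rw [pderiv_powerProd, mul_smul_comm]
      refine natCast_count_smul_mem fun hk => ?_
      rw [← powerProd_cons, Multiset.cons_erase hk]
      exact powerProd_mem_lengthSpan h0 hn (by omega)

/-- The polynomial in the power sums with coefficients `c`. -/
noncomputable def powerComb {n : ℕ} : (n.Partition → K) →ₗ[K] MvPolynomial ℕ K where
  toFun c := ∑ mu, c mu • powerProd K mu.parts
  map_add' c c' := by simp [add_smul, Finset.sum_add_distrib]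
  map_smul' a c := by simp [Finset.smul_sum, smul_smul]

theorem powerComb_apply {n : ℕ} (c : n.Partition → K) :
    powerComb c = ∑ mu, c mu • powerProd K mu.parts := rfl

theorem coeff_powerComb {n : ℕ} (c : n.Partition → K) (lam : n.Partition) :
    coeff (Multiset.toFinsupp lam.parts) (powerComb c) = c lam := by
  rw [powerComb_apply, coeff_sum, Finset.sum_eq_single lam]
  · rw [coeff_smul, powerProd_eq_monomial, coeff_monomial, if_pos rfl, smul_eq_mul, mul_one]
  · intro mu _ hmu
    rw [coeff_smul, powerProd_eq_monomial, coeff_monomial, if_neg, smul_zero]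
    intro h
    exact hmu (Nat.Partition.ext (Multiset.toFinsupp.injective h))
  · simp

theorem powerComb_mem_lengthSpan {n : ℕ} (c : n.Partition → K) :
    powerComb c ∈ lengthSpan K n 0 := by
  rw [powerComb_apply]
  exact Submodule.sum_mem _ fun mu _ => Submodule.smul_mem _ _
    (powerProd_mem_lengthSpan (zero_notMem_parts mu) mu.parts_sum (Nat.zero_le _))

theorem exists_powerComb_eq {n m : ℕ} {F : MvPolynomial ℕ K} (hF : F ∈ lengthSpan K n m) :
    ∃ c : n.Partition → K, F = powerComb c ∧ ∀ lam, length lam < m → c lam = 0 := by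
  classical
  induction hF using Submodule.span_induction with
  | zero => exact ⟨0, by simp, by simp⟩
  | add x y _ _ hx hy =>
    obtain ⟨c, rfl, hc⟩ := hx
    obtain ⟨c', rfl, hc'⟩ := hy
    exact ⟨c + c', by simp, fun lam h => by simp [hc lam h, hc' lam h]⟩
  | smul a x _ hx =>
    obtain ⟨c, rfl, hc⟩ := hx
    exact ⟨a • c, by simp, fun lam h => by simp [hc lam h]⟩
  | mem x hx =>
    obtain ⟨s, h0, hn, hm, rfl⟩ := hx
    refine ⟨Pi.single (partitionOf s h0 hn) 1, ?_, fun lam h => ?_⟩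
    · rw [powerComb_apply, Finset.sum_eq_single (partitionOf s h0 hn)]
      · simp [partitionOf]
      · intro mu _ hmu
        simp [hmu]
      · simp
    · rw [Pi.single_eq_of_ne]
      rintro rfl
      exact absurd hm (not_le.2 h)

theorem powerSumNorm_parts (α : K) {n : ℕ} (lam : n.Partition) :
    powerSumNorm α (Multiset.toFinsupp lam.parts) = α ^ length lam * zee lam := by
  rw [powerSumNorm, Finsupp.prod, Multiset.toFinsupp_support, zee, length]
  have : lam.parts.card = ∑ i ∈ lam.parts.toFinset, lam.parts.count i :=
    (Multiset.toFinset_sum_count_eq _).symm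
  rw [this, ← Finset.prod_pow_eq_pow_sum, Nat.cast_prod, ← Finset.prod_mul_distrib]
  refine Finset.prod_congr rfl fun i _ => ?_
  rw [Multiset.toFinsupp_apply]
  push_cast
  rw [mul_pow]
  ring

theorem pairing_powerComb (α : K) {n : ℕ} (c c' : n.Partition → K) :
    pairing α (powerComb c) (powerComb c')
      = ∑ lam, α ^ length lam * (zee lam : K) * c lam * c' lam := by
  conv_lhs => rw [powerComb_apply c]
  rw [map_sum, LinearMap.sum_apply]
  refine Finset.sum_congr rfl fun lam _ => ?_
  rw [map_smul, LinearMap.smul_apply, powerProd_eq_monomial, pairing_monomial, coeff_powerComb,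
    powerSumNorm_parts, smul_eq_mul]
  ring

theorem zee_pos {n : ℕ} (lam : n.Partition) : 0 < zee lam :=
  Finset.prod_pos fun _ hi => Nat.mul_pos
    (pow_pos (lam.parts_pos (Multiset.mem_toFinset.1 hi)) _) (Nat.factorial_pos _)

theorem pairing_self_pos [LinearOrder K] [IsStrictOrderedRing K] {α : K} (hα : 0 < α) {n : ℕ}
    {c : n.Partition → K} (hc : c ≠ 0) : 0 < pairing α (powerComb c) (powerComb c) := by
  rw [pairing_powerComb]
  obtain ⟨lam, hlam⟩ := Function.ne_iff.1 hc
  have hw : ∀ mu : n.Partition, 0 < α ^ length mu * (zee mu : K) := fun mu =>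
    mul_pos (pow_pos hα _) (by exact_mod_cast zee_pos mu)
  refine Finset.sum_pos' (fun mu _ => ?_) ⟨lam, Finset.mem_univ _, ?_⟩
  · rw [mul_assoc]
    exact mul_nonneg (hw mu).le (mul_self_nonneg _)
  · rw [mul_assoc]
    exact mul_pos (hw lam) (mul_self_pos.2 hlam)

end LaplaceBeltrami

end JackConnection
namespace JackConnection

/-! ### Cherednik operators on symmetric polynomials. -/

section Evaluation

open MvPolynomial

variable {K : Type*} [Field K] {N : ℕ}

/-- The substitution of the power sums of `x_0, …, x_{N-1}` for the variables `p_k`. -/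
noncomputable def powerSumEval (K : Type*) [Field K] (N : ℕ) :
    MvPolynomial ℕ K →ₐ[K] MvPolynomial (Fin N) K :=
  aeval fun k => psum (Fin N) K k

theorem powerSumEval_X (k : ℕ) : powerSumEval K N (X k) = psum (Fin N) K k := by
  simp [powerSumEval]

theorem rename_powerSumEval (e : Equiv.Perm (Fin N)) (F : MvPolynomial ℕ K) :
    rename e (powerSumEval K N F) = powerSumEval K N F := by
  have : (rename e).comp (powerSumEval K N) = powerSumEval K N := by
    refine algHom_ext fun k => ?_
    rw [AlgHom.comp_apply, powerSumEval_X]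
    exact psum_isSymmetric (Fin N) K k e
  exact DFunLike.congr_fun this F

theorem powerSumEval_powerProd {n : ℕ} (lam : n.Partition) :
    powerSumEval K N (powerProd K lam.parts) = powerSumPoly K N lam := by
  rw [powerProd, map_multiset_prod, Multiset.map_map, powerSumPoly]
  congr 1
  exact Multiset.map_congr rfl fun k _ => powerSumEval_X k

theorem X_mul_pderiv_psum (i : Fin N) (k : ℕ) :
    X i * pderiv i (psum (Fin N) K k) = (k : K) • X i ^ k := by
  rw [psum, map_sum, Finset.sum_eq_single i]
  · rw [pderiv_pow, pderiv_X_self, mul_one]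
    rcases k with _ | k
    · simp
    · rw [Nat.add_sub_cancel, mul_left_comm, ← pow_succ', smul_eq_C_mul, map_natCast]
  · intro j _ hj
    rw [pderiv_pow, pderiv_X_of_ne hj, mul_zero]
  · simp

theorem X_mul_pderiv_powerSumEval_powerProd {M : ℕ} (i : Fin N) {s : Multiset ℕ}
    (hs : ∀ k ∈ s, 1 ≤ k ∧ k ≤ M) :
    X i * pderiv i (powerSumEval K N (powerProd K s))
      = ∑ k ∈ Finset.Icc 1 M, (k : K) • (X i ^ k * powerSumEval K N (pderiv k (powerProd K s))) := by
  induction s using Multiset.induction_on with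
  | empty => simp [powerProd]
  | cons a s ih =>
    have ha := hs a (Multiset.mem_cons_self a s)
    have ih' := ih fun k hk => hs k (Multiset.mem_cons_of_mem hk)
    have h1 : ∀ k ∈ Finset.Icc 1 M, (k : K) • (X i ^ k * powerSumEval K N
        (pderiv k (powerProd K (a ::ₘ s))))
        = (if k = a then (a : K) • (X i ^ a * powerSumEval K N (powerProd K s)) else 0)
          + psum (Fin N) K a *
            ((k : K) • (X i ^ k * powerSumEval K N (pderiv k (powerProd K s)))) := by
      intro k _
      rw [powerProd_cons, pderiv_mul, map_add, map_mul, map_mul, powerSumEval_X]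
      split_ifs with h
      · subst h
        rw [pderiv_X_self, map_one, one_mul, mul_add, smul_add, mul_smul_comm]
        ring_nf
      · rw [pderiv_X_of_ne (Ne.symm h), map_zero, zero_mul, zero_add, zero_add, mul_smul_comm]
        ring_nf
    rw [Finset.sum_congr rfl h1, Finset.sum_add_distrib, Finset.sum_ite_eq',
      if_pos (Finset.mem_Icc.2 ha), ← Finset.mul_sum, ← ih', powerProd_cons, map_mul,
      powerSumEval_X, pderiv_mul, mul_add, ← mul_assoc, X_mul_pderiv_psum, smul_mul_assoc]
    ring

/-- This is the chain rule; the sum may stop at `M` because in degree `n ≤ M` no `p_k` with `k > M`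
occurs. -/
theorem X_mul_pderiv_powerSumEval {n m M : ℕ} (hM : n ≤ M) (i : Fin N) {F : MvPolynomial ℕ K}
    (hF : F ∈ lengthSpan K n m) :
    X i * pderiv i (powerSumEval K N F)
      = ∑ k ∈ Finset.Icc 1 M, (k : K) • (X i ^ k * powerSumEval K N (pderiv k F)) := by
  induction hF using Submodule.span_induction with
  | zero => simp
  | add x y _ _ hx hy => simp only [map_add, mul_add, smul_add, Finset.sum_add_distrib, hx, hy]
  | smul c x _ hx =>
    rw [map_smul, Derivation.map_smul, mul_smul_comm, hx, Finset.smul_sum]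
    refine Finset.sum_congr rfl fun k _ => ?_
    rw [Derivation.map_smul, map_smul, mul_smul_comm, smul_comm]
  | mem x hx =>
    obtain ⟨s, h0, hn, -, rfl⟩ := hx
    refine X_mul_pderiv_powerSumEval_powerProd i fun k hk =>
      ⟨Nat.one_le_iff_ne_zero.2 fun h => h0 (h ▸ hk), ?_⟩
    have := Multiset.le_sum_of_mem hk
    omega

theorem pderiv_mem_lengthSpan {n m k : ℕ} {F : MvPolynomial ℕ K} (hF : F ∈ lengthSpan K n m)  :
    pderiv k F ∈ lengthSpan K (n - k) 0 := by
  induction hF using Submodule.span_induction with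
  | zero => simp
  | add x y _ _ hx hy => rw [map_add]; exact Submodule.add_mem _ hx hy
  | smul c x _ hx => rw [Derivation.map_smul]; exact Submodule.smul_mem _ _ hx
  | mem x hx =>
    obtain ⟨s, h0, hn, -, rfl⟩ := hx
    rw [pderiv_powerProd]
    refine natCast_count_smul_mem fun hk => ?_
    have := Multiset.sum_erase hk
    exact powerProd_mem_lengthSpan (fun h => h0 (Multiset.mem_of_mem_erase h)) (by omega)
      (Nat.zero_le _)

theorem pderiv_eq_zero_of_lt {n m k : ℕ} {F : MvPolynomial ℕ K} (hF : F ∈ lengthSpan K n m)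
    (hk : n < k) : pderiv k F = 0 := by
  induction hF using Submodule.span_induction with
  | zero => simp
  | add x y _ _ hx hy => rw [map_add, hx, hy, add_zero]
  | smul c x _ hx => rw [Derivation.map_smul, hx, smul_zero]
  | mem x hx =>
    obtain ⟨s, -, hn, -, rfl⟩ := hx
    rw [pderiv_powerProd, Multiset.count_eq_zero_of_notMem, Nat.cast_zero, zero_smul]
    intro h
    have := Multiset.le_sum_of_mem h
    omega

theorem sum_Icc_one {A : Type*} [AddCommMonoid A] (k : ℕ) (f : ℕ → A) :
    ∑ t ∈ Finset.Icc 1 k, f t = ∑ t ∈ Finset.range k, f (t + 1) := by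
  induction k with
  | zero => simp
  | succ k ih => rw [Finset.sum_Icc_succ_top (by omega), Finset.sum_range_succ, ih]

theorem dunklTerm_X_pow {i j : Fin N} (h : i ≠ j) {k : ℕ} (hk : 1 ≤ k) :
    dunklTerm i j (X i ^ k : MvPolynomial (Fin N) K)
      = ∑ t ∈ Finset.Icc 1 (k - 1), X i ^ t * X j ^ (k - t) + X (max i j) ^ k := by
  obtain ⟨k, rfl⟩ := Nat.exists_eq_add_of_le' hk
  rw [Nat.add_sub_cancel, sum_Icc_one]
  have hk1 : k + 1 - 1 = k := rfl
  rcases lt_or_gt_of_ne h with h' | h'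
  · rw [dunklTerm_of_lt h', divDiff_X_pow h, max_eq_right h'.le, Finset.sum_range_succ', mul_add,
      Finset.mul_sum, hk1]
    congr 1
    · refine Finset.sum_congr rfl fun t ht => ?_
      have : k + 1 - (t + 1) = k - (t + 1) + 1 := by
        have := Finset.mem_range.1 ht
        omega
      rw [this]
      ring
    · rw [Nat.sub_zero]
      ring
  · rw [dunklTerm_of_gt h', divDiff_X_pow h, max_eq_left h'.le, Finset.sum_range_succ, mul_add,
      Finset.mul_sum, hk1]
    congr 1
    · refine Finset.sum_congr rfl fun t _ => ?_
      rw [Nat.add_sub_add_right]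
      ring
    · rw [Nat.sub_self]
      ring

theorem sum_apply_max {A : Type*} [AddCommMonoid A] (f : Fin N → A) :
    ∑ i, ∑ j, f (max i j) = ∑ i, (2 * i.val + 1) • f i := by
  have h : ∀ i j : Fin N, f (max i j) = (if j ≤ i then f i else 0) + (if i < j then f j else 0) := by
    intro i j
    rcases le_or_gt j i with hij | hij
    · rw [if_pos hij, if_neg hij.not_gt, max_eq_left hij, add_zero]
    · rw [if_neg hij.not_ge, if_pos hij, max_eq_right hij.le, zero_add]
  simp only [h, Finset.sum_add_distrib]
  rw [Finset.sum_comm (f := fun i j => if i < j then f j else 0), ← Finset.sum_add_distrib]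
  refine Finset.sum_congr rfl fun i _ => ?_
  rw [← Finset.sum_filter, ← Finset.sum_filter, Finset.sum_const, Finset.sum_const, ← add_smul]
  congr 1
  rw [Finset.filter_ge_eq_Iic, Finset.filter_gt_eq_Iio, Fin.card_Iic, Fin.card_Iio]
  omega

/-- The terms `x_{max i j}^k` count each index `i` with weight `2 i + 1`, and removing the diagonal
subtracts `k`. The non-symmetric remainder `∑ 2 i x_i^k` is cancelled by the constants `-i` when
`Y_i` is squared, which is why `∑ Y_i ^ 2` maps symmetric polynomials to symmetric ones. -/
theorem sum_dunklTerm_X_pow {k : ℕ} (hk : 1 ≤ k) :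
    ∑ i : Fin N, ∑ j, dunklTerm i j (X i ^ k : MvPolynomial (Fin N) K)
      = ∑ t ∈ Finset.Icc 1 (k - 1), psum (Fin N) K t * psum (Fin N) K (k - t)
        - ((k : K) - 1) • psum (Fin N) K k + ∑ i : Fin N, (2 * i.val : K) • X i ^ k := by
  have h : ∀ i j : Fin N, dunklTerm i j (X i ^ k : MvPolynomial (Fin N) K)
      = ∑ t ∈ Finset.Icc 1 (k - 1), X i ^ t * X j ^ (k - t) + X (max i j) ^ k
        - if i = j then (k : K) • X i ^ k else 0 := by
    intro i j
    split_ifs with hij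
    · subst hij
      have : ∀ t ∈ Finset.Icc 1 (k - 1), (X i ^ t * X i ^ (k - t) : MvPolynomial (Fin N) K)
          = X i ^ k := fun t ht => by
        have := Finset.mem_Icc.1 ht
        rw [← pow_add, Nat.add_sub_cancel' (by omega)]
      rw [dunklTerm_self, Finset.sum_congr rfl this, Finset.sum_const, Nat.card_Icc, max_self,
        ← succ_nsmul, Nat.cast_smul_eq_nsmul, Nat.sub_add_cancel (by omega),
        Nat.sub_add_cancel hk, sub_self]
    · rw [dunklTerm_X_pow hij hk, sub_zero]
  simp only [h, Finset.sum_sub_distrib, Finset.sum_add_distrib, Finset.sum_ite_eq,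
    Finset.mem_univ, if_true]
  rw [sum_apply_max fun i => (X i ^ k : MvPolynomial (Fin N) K)]
  have h2 : ∑ i : Fin N, ∑ j : Fin N, ∑ t ∈ Finset.Icc 1 (k - 1),
      (X i ^ t * X j ^ (k - t) : MvPolynomial (Fin N) K)
      = ∑ t ∈ Finset.Icc 1 (k - 1), psum (Fin N) K t * psum (Fin N) K (k - t) := by
    simp only [psum, Finset.sum_mul_sum]
    rw [Finset.sum_congr rfl fun i _ => Finset.sum_comm, Finset.sum_comm]
  rw [h2, add_sub_assoc, sub_eq_add_neg (∑ t ∈ _, _) (_ • _), add_assoc]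
  congr 1
  rw [psum, Finset.smul_sum, ← Finset.sum_neg_distrib, ← Finset.sum_add_distrib,
    ← Finset.sum_sub_distrib]
  refine Finset.sum_congr rfl fun i _ => ?_
  rw [← Nat.cast_smul_eq_nsmul K]
  push_cast
  module

theorem divDiff_powerSumEval (i j : Fin N) (F : MvPolynomial ℕ K) :
    divDiff i j (powerSumEval K N F) = 0 := by
  have := divDiff_mul_of_rename_eq i j (1 : MvPolynomial (Fin N) K)
    (rename_powerSumEval (Equiv.swap i j) F)
  rw [one_mul] at this
  rw [this]
  have h1 : divDiff i j (1 : MvPolynomial (Fin N) K) = 0 := by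
    rcases eq_or_ne i j with rfl | h
    · simp [divDiff]
    · exact divDiff_eq_of h (by simp)
  rw [h1, zero_mul]

theorem dunklTerm_mul_powerSumEval (i j : Fin N) (f : MvPolynomial (Fin N) K)
    (F : MvPolynomial ℕ K) :
    dunklTerm i j (f * powerSumEval K N F) = dunklTerm i j f * powerSumEval K N F := by
  have h := divDiff_mul_of_rename_eq i j f (rename_powerSumEval (Equiv.swap i j) F)
  rcases lt_trichotomy i j with hij | rfl | hij
  · rw [dunklTerm_of_lt hij, dunklTerm_of_lt hij, h, mul_assoc]
  · simp
  · rw [dunklTerm_of_gt hij, dunklTerm_of_gt hij, h, mul_assoc]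

theorem dunklTerm_powerSumEval (i j : Fin N) (F : MvPolynomial ℕ K) :
    dunklTerm i j (powerSumEval K N F) = 0 := by
  rcases lt_trichotomy i j with hij | rfl | hij
  · rw [dunklTerm_of_lt hij, divDiff_powerSumEval, mul_zero]
  · simp
  · rw [dunklTerm_of_gt hij, divDiff_powerSumEval, mul_zero]

theorem cherednik_powerSumEval (α : K) {n m M : ℕ} (hM : n ≤ M) (i : Fin N)
    {F : MvPolynomial ℕ K} (hF : F ∈ lengthSpan K n m) :
    cherednik α i (powerSumEval K N F)
      = ∑ k ∈ Finset.Icc 1 M, (α * k) • (X i ^ k * powerSumEval K N (pderiv k F))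
        - (i.val : K) • powerSumEval K N F := by
  rw [cherednik_apply, X_mul_pderiv_powerSumEval hM i hF,
    Finset.sum_eq_zero fun j _ => dunklTerm_powerSumEval i j F, add_zero, Finset.smul_sum]
  simp only [smul_smul]

theorem cherednik_X_pow_mul_powerSumEval (α : K) {n m M : ℕ} (hM : n ≤ M) (i : Fin N) (k : ℕ)
    {F : MvPolynomial ℕ K} (hF : F ∈ lengthSpan K n m) :
    cherednik α i (X i ^ k * powerSumEval K N F)
      = (α * k) • (X i ^ k * powerSumEval K N F)
        + ∑ l ∈ Finset.Icc 1 M, (α * l) • (X i ^ (k + l) * powerSumEval K N (pderiv l F))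
        + (∑ j, dunklTerm i j (X i ^ k)) * powerSumEval K N F
        - (i.val : K) • (X i ^ k * powerSumEval K N F) := by
  have h1 : X i * pderiv i (X i ^ k : MvPolynomial (Fin N) K) = (k : K) • X i ^ k := by
    rw [pderiv_pow, pderiv_X_self, mul_one]
    rcases k with _ | k
    · simp
    · rw [Nat.add_sub_cancel, mul_left_comm, ← pow_succ', smul_eq_C_mul, map_natCast]
  rw [cherednik_apply, pderiv_mul, mul_add, ← mul_assoc, h1, mul_left_comm,
    X_mul_pderiv_powerSumEval hM i hF, Finset.mul_sum, smul_add, Finset.smul_sum, Finset.sum_mul,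
    smul_mul_assoc, smul_smul]
  simp only [dunklTerm_mul_powerSumEval, mul_smul_comm, smul_smul, ← mul_assoc, pow_add]

/-- The splitting terms of the Laplace–Beltrami operator run over a square of pairs, those of the
Cherednik operators over a triangle given by the total; the difference vanishes for degree reasons.
-/
theorem sum_sum_Icc_eq {A : Type*} [AddCommMonoid A] {M : ℕ} {g : ℕ → ℕ → A}
    (hg : ∀ k l, M < k + l → g k l = 0) :
    ∑ k ∈ Finset.Icc 1 M, ∑ l ∈ Finset.Icc 1 M, g k l
      = ∑ m ∈ Finset.Icc 1 M, ∑ t ∈ Finset.Icc 1 (m - 1), g t (m - t) := by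
  rw [← Finset.sum_product', Finset.sum_sigma',
    ← Finset.sum_filter_of_ne (p := fun x : ℕ × ℕ => x.1 + x.2 ≤ M)
      fun x _ hx => not_lt.1 fun h => hx (hg _ _ h)]
  refine Finset.sum_nbij' (fun x => ⟨x.1 + x.2, x.1⟩) (fun y => (y.2, y.1 - y.2)) ?_ ?_ ?_ ?_ ?_
  · rintro ⟨k, l⟩ h
    simp only [Finset.mem_filter, Finset.mem_product, Finset.mem_sigma, Finset.mem_Icc] at h ⊢
    omega
  · rintro ⟨m, t⟩ h
    simp only [Finset.mem_filter, Finset.mem_product, Finset.mem_sigma, Finset.mem_Icc] at h ⊢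
    omega
  · rintro ⟨k, l⟩ h
    simp
  · rintro ⟨m, t⟩ h
    simp only [Finset.mem_sigma, Finset.mem_Icc] at h
    simp only [Sigma.mk.injEq, heq_eq_eq, and_true]
    omega
  · rintro ⟨k, l⟩ h
    simp

theorem cherednik_cherednik_powerSumEval (α : K) {n m M : ℕ} (hM : n ≤ M) (i : Fin N)
    {F : MvPolynomial ℕ K} (hF : F ∈ lengthSpan K n m) :
    cherednik α i (cherednik α i (powerSumEval K N F))
    = ∑ k ∈ Finset.Icc 1 M, ((α ^ 2 * k ^ 2) • (X i ^ k * powerSumEval K N (pderiv k F))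
        + ∑ l ∈ Finset.Icc 1 M,
          (α ^ 2 * k * l) • (X i ^ (k + l) * powerSumEval K N (pderiv l (pderiv k F)))
        + (α * k) • ((∑ j, dunklTerm i j (X i ^ k)) * powerSumEval K N (pderiv k F))
        - (α * k) • (((2 * i.val : K) • X i ^ k) * powerSumEval K N (pderiv k F)))
      + (i.val : K) ^ 2 • powerSumEval K N F := by
  have hk : ∀ k, pderiv k F ∈ lengthSpan K (n - k) 0 := fun k => pderiv_mem_lengthSpan hF
  rw [cherednik_powerSumEval α hM i hF, map_sub, map_sum, map_smul,
    cherednik_powerSumEval α hM i hF, smul_sub, Finset.smul_sum, ← sub_add, ← Finset.sum_sub_distrib,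
    smul_smul, ← sq (i.val : K)]
  congr 1
  refine Finset.sum_congr rfl fun k _ => ?_
  rw [map_smul, cherednik_X_pow_mul_powerSumEval α ((Nat.sub_le _ _).trans hM) i k (hk k),
    smul_sub, smul_add, smul_add, Finset.smul_sum]
  simp only [smul_smul, smul_mul_assoc]
  have : ∀ l : ℕ, α * k * (α * l) = α ^ 2 * k * l := fun l => by ring
  simp only [this]
  module
theorem sum_X_pow_terms (α : K) {k : ℕ} (hk : 1 ≤ k) (M : ℕ) (f : MvPolynomial (Fin N) K)
    (g : ℕ → MvPolynomial (Fin N) K) :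
    ∑ i : Fin N,
    ((α ^ 2 * k ^ 2) • (X i ^ k * f)
      + ∑ l ∈ Finset.Icc 1 M,
        (α ^ 2 * k * l) • (X i ^ (k + l) * g l)
      + (α * k) • ((∑ j, dunklTerm i j (X i ^ k)) * f)
      - (α * k) • (((2 * i.val : K) • X i ^ k) * f))
    = α • (∑ l ∈ Finset.Icc 1 M,
        (α * l * k) • (psum (Fin N) K (l + k) * g l)
      + ∑ t ∈ Finset.Icc 1 (k - 1), (k : K) •
        (psum (Fin N) K t * psum (Fin N) K (k - t) * f)
      + (α * k ^ 2 - k * (k - 1)) •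
        (psum (Fin N) K k * f)) := by
  have hd := sum_dunklTerm_X_pow (K := K) (N := N) hk
  have hp : ∀ m : ℕ, psum (Fin N) K m = ∑ i : Fin N, X i ^ m := fun m => rfl
  have h2 : ∑ i : Fin N, ∑ l ∈ Finset.Icc 1 M,
      (α ^ 2 * k * l) • (X i ^ (k + l) * g l)
      = α • ∑ l ∈ Finset.Icc 1 M,
        (α * l * k) • (psum (Fin N) K (l + k) * g l) := by
    rw [Finset.sum_comm, Finset.smul_sum]
    refine Finset.sum_congr rfl fun l _ => ?_
    rw [← Finset.smul_sum, ← Finset.sum_mul, ← hp, smul_smul, add_comm l k]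
    congr 1
    ring
  rw [Finset.sum_sub_distrib, Finset.sum_add_distrib, Finset.sum_add_distrib, h2,
    ← Finset.smul_sum, ← Finset.smul_sum, ← Finset.smul_sum, ← Finset.sum_mul, ← Finset.sum_mul,
    ← Finset.sum_mul, hd, ← hp, ← Finset.smul_sum, ← Finset.sum_mul]
  simp only [add_mul, sub_mul, smul_mul_assoc]
  module

/-- The sum of the squares of the Cherednik operators acts on symmetric functions as the
Laplace–Beltrami operator. -/
theorem sum_cherednik_cherednik_powerSumEval (α : K) {n m M : ℕ} (hM : n ≤ M)
    {F : MvPolynomial ℕ K} (hF : F ∈ lengthSpan K n m) :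
    ∑ i : Fin N, cherednik α i (cherednik α i (powerSumEval K N F))
      = α • powerSumEval K N (laplaceBeltrami α M F)
        + (∑ i : Fin N, (i.val : K) ^ 2) • powerSumEval K N F := by
  rw [Finset.sum_congr rfl fun i _ =>
    cherednik_cherednik_powerSumEval α hM i hF, Finset.sum_add_distrib, ← Finset.sum_smul,
    Finset.sum_comm, Finset.sum_congr rfl fun k hk =>
    sum_X_pow_terms α (Finset.mem_Icc.1 hk).1 M _ _, ← Finset.smul_sum, Finset.sum_add_distrib,
    Finset.sum_add_distrib, laplaceBeltrami_apply]
  simp only [map_add (powerSumEval K N), map_sum (powerSumEval K N), map_smul (powerSumEval K N),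
    map_mul (powerSumEval K N), powerSumEval_X]
  rw [Finset.sum_comm, sum_sum_Icc_eq (g := fun k l => ((k + l : ℕ) : K) •
    (psum (Fin N) K k * psum (Fin N) K l * powerSumEval K N (pderiv (k + l) F)))]
  · have : ∀ k ∈ Finset.Icc 1 M, ∑ t ∈ Finset.Icc 1 (k - 1), (k : K) •
        (psum (Fin N) K t * psum (Fin N) K (k - t) * powerSumEval K N (pderiv k F))
        = ∑ t ∈ Finset.Icc 1 (k - 1), ((t + (k - t) : ℕ) : K) •
        (psum (Fin N) K t * psum (Fin N) K (k - t) *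
          powerSumEval K N (pderiv (t + (k - t)) F)) :=
      fun k _ => Finset.sum_congr rfl fun t ht => by
        have := Finset.mem_Icc.1 ht
        rw [Nat.add_sub_cancel' (by omega)]
    rw [Finset.sum_congr rfl this]
  · intro k l hkl
    rw [pderiv_eq_zero_of_lt hF (hM.trans_lt hkl), map_zero, mul_zero, smul_zero]

end Evaluation

end JackConnection
namespace JackConnection

/-! ### The energy as a sum of squares of the spectrum. -/

section EnergyFormulas

variable {N : ℕ}

theorem min_eq_add_ite (κ : Fin N → ℕ) (i j : Fin N) :
    min (κ i) (κ j) = (if Precedes κ j i then κ i else 0) + (if Precedes κ i j then κ j else 0)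
      + if i = j then κ i else 0 := by
  unfold Precedes
  rcases lt_trichotomy i j with h | rfl | h
  · have := h.ne
    grind
  · simp
  · have := h.ne'
    grind

theorem sumMin_map_univ (κ : Fin N → ℕ) :
    sumMin (Finset.univ.val.map κ) = 2 * ∑ i, κ i * rank κ i + ∑ i, κ i := by
  have h1 : sumMin (Finset.univ.val.map κ) = ∑ i, ∑ j, min (κ i) (κ j) := by
    simp only [sumMin, Multiset.map_map, Function.comp_def]
    rfl
  have h2 : ∀ i, ∑ j, (if Precedes κ j i then κ i else 0) = κ i * rank κ i := fun i => by
    rw [← Finset.sum_filter, Finset.sum_const, rank, smul_eq_mul, mul_comm]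
  simp only [h1, min_eq_add_ite, Finset.sum_add_distrib, h2, Finset.sum_ite_eq, Finset.mem_univ,
    if_true]
  rw [Finset.sum_comm]
  simp only [h2]
  ring

/-- In the expanded squares the ranks permute `0, …, N - 1`, and the cross terms `κ_i * rank κ i`
are expressed by the sum of minima, since in each pair of distinct indices the smaller entry is the
preceded one. The constant is that of `sum_cherednik_cherednik_powerSumEval`. -/
theorem sum_spec_sq {K : Type*} [Field K] (α : K) (κ : Fin N → ℕ) :
    ∑ i, spec α κ i ^ 2 = α * fnEnergy α κ + ∑ i : Fin N, (i.val : K) ^ 2 := by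
  have h1 : (sumSq (Finset.univ.val.map κ) : K) = ∑ i, (κ i : K) ^ 2 := by
    rw [sumSq, Multiset.map_map]
    exact (Nat.cast_sum _ _).trans (Finset.sum_congr rfl fun i _ => by
      rw [Function.comp_apply, Nat.cast_pow])
  have h2 : ((Finset.univ.val.map κ).sum : K) = ∑ i, (κ i : K) := Nat.cast_sum _ _
  rw [← sum_rank κ fun m => (m : K) ^ 2, fnEnergy, energy, h1, h2, sumMin_map_univ]
  push_cast
  simp only [spec, sub_sq, mul_pow, Finset.sum_add_distrib, Finset.sum_sub_distrib,
    Finset.mul_sum, mul_add, mul_sub]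
  have : ∀ i, 2 * (α * (κ i : K)) * rank κ i = α * (2 * (κ i * rank κ i)) := fun i => by ring
  simp only [this]
  have h3 : ∀ i, α ^ 2 * (κ i : K) ^ 2 = α * (α * κ i ^ 2) := fun i => by ring
  simp only [h3]
  ring

end EnergyFormulas

/-! ### Dominance implies strict comparison of energies. -/

section Dominance

/-- In a decreasing list numbered from `0`, the entry of index `i` is the minimum in `2 i + 1` pairs
and lies in `i + 1` tails. Tail sums are what dominance controls. -/
theorem sumMin_add_sum {L : List ℕ} (hL : L.Pairwise (· ≥ ·)) {T : ℕ} (hT : L.length ≤ T) :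
    sumMin L + L.sum = 2 * ∑ k ∈ Finset.range T, (L.drop k).sum := by
  induction L generalizing T with
  | nil => simp [sumMin]
  | cons x L ih =>
    obtain ⟨hx, hL⟩ := List.pairwise_cons.1 hL
    obtain ⟨T, rfl⟩ : ∃ S, T = S + 1 := ⟨T - 1, by simp at hT; omega⟩
    have h1 : (Multiset.map (fun w => min x w) (L : Multiset ℕ)).sum = L.sum := by
      rw [Multiset.map_congr rfl fun w hw => min_eq_right (hx w (Multiset.mem_coe.1 hw))]
      simp
    have h2 := ih hL (T := T) (by simpa using hT)
    rw [← Multiset.cons_coe, sumMin_cons, h1, Finset.sum_range_succ']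
    simp only [List.drop_succ_cons, List.drop_zero, List.sum_cons]
    omega

theorem eq_of_sum_take_eq {A B : List ℕ} (hA : ∀ a ∈ A, 0 < a) (hB : ∀ b ∈ B, 0 < b)
    (h : ∀ i, (A.take i).sum = (B.take i).sum) : A = B := by
  induction A generalizing B with
  | nil =>
    rcases B with _ | ⟨b, B⟩
    · rfl
    · have h1 := h 1
      have h2 := hB b (by simp)
      simp at h1
      omega
  | cons a A ih =>
    rcases B with _ | ⟨b, B⟩
    · have h1 := h 1
      have h2 := hA a (by simp)
      simp at h1
      omega
    · obtain rfl : a = b := by simpa using h 1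
      rw [ih (fun x hx => hA x (List.mem_cons_of_mem _ hx))
        (fun x hx => hB x (List.mem_cons_of_mem _ hx)) fun i => by simpa using h (i + 1)]

theorem sum_take_eq_sum_getD (L : List ℕ) (i : ℕ) :
    (L.take i).sum = ∑ k ∈ Finset.range i, L.getD k 0 := by
  induction L generalizing i with
  | nil => simp
  | cons x L ih =>
    rcases i with _ | i
    · simp
    · rw [List.take_succ_cons, List.sum_cons, Finset.sum_range_succ', ih, add_comm]
      simp

theorem sumSq_eq_sum_getD (L : List ℕ) {T : ℕ} (hT : L.length ≤ T) :
    sumSq L = ∑ k ∈ Finset.range T, L.getD k 0 ^ 2 := by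
  induction L generalizing T with
  | nil => simp [sumSq]
  | cons x L ih =>
    obtain ⟨T, rfl⟩ : ∃ S, T = S + 1 := ⟨T - 1, by simp at hT; omega⟩
    rw [← Multiset.cons_coe, sumSq_cons, Finset.sum_range_succ', ih (T := T) (by simpa using hT),
      add_comm]
    simp

/-- Abel summation. -/
theorem mul_sum_le_sum_mul {f d : ℕ → ℤ} (hf : Antitone f) (hd : ∀ i, 0 ≤ ∑ k ∈ Finset.range i, d k)
    (T : ℕ) : f T * ∑ k ∈ Finset.range T, d k ≤ ∑ k ∈ Finset.range T, f k * d k := by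
  induction T with
  | zero => simp
  | succ T ih =>
    have h1 := mul_le_mul_of_nonneg_right (hf (Nat.le_succ T)) (hd (T + 1))
    refine h1.trans ?_
    rw [Finset.sum_range_succ, Finset.sum_range_succ, mul_add]
    linarith

theorem sum_sq_le_sum_sq {f g : ℕ → ℕ} (hf : Antitone f)
    (h : ∀ i, ∑ k ∈ Finset.range i, f k ≤ ∑ k ∈ Finset.range i, g k) (T : ℕ) :
    ∑ k ∈ Finset.range T, f k ^ 2 ≤ ∑ k ∈ Finset.range T, g k ^ 2 := by
  have hd : ∀ i, 0 ≤ ∑ k ∈ Finset.range i, ((g k : ℤ) - f k) := fun i => by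
    rw [Finset.sum_sub_distrib, sub_nonneg]
    exact_mod_cast h i
  have h1 := mul_sum_le_sum_mul (f := fun k => (f k : ℤ))
    (fun a b hab => Int.ofNat_le.2 (hf hab)) hd T
  have h2 : 0 ≤ (f T : ℤ) * ∑ k ∈ Finset.range T, ((g k : ℤ) - f k) :=
    mul_nonneg (Int.natCast_nonneg _) (hd T)
  have h3 : ∑ k ∈ Finset.range T, ((g k : ℤ) ^ 2 - (f k : ℤ) ^ 2)
      = ∑ k ∈ Finset.range T, ((g k : ℤ) - f k) ^ 2
        + 2 * ∑ k ∈ Finset.range T, (f k : ℤ) * (g k - f k) := by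
    rw [Finset.mul_sum, ← Finset.sum_add_distrib]
    exact Finset.sum_congr rfl fun k _ => by ring
  have h4 : 0 ≤ ∑ k ∈ Finset.range T, ((g k : ℤ) - f k) ^ 2 :=
    Finset.sum_nonneg fun k _ => sq_nonneg _
  rw [Finset.sum_sub_distrib] at h3
  zify
  linarith

theorem rowLen_diagram {n : ℕ} (lam : n.Partition) (i : ℕ) :
    (diagram lam).rowLen i = (rows lam).getD i 0 := by
  rcases lt_or_ge i (rows lam).length with h | h
  · rw [diagram, List.getD_eq_getElem _ _ h]
    exact YoungDiagram.rowLen_ofRowLens ⟨i, h⟩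
  · rw [List.getD_eq_default _ _ h]
    by_contra hne
    have : (i, 0) ∈ diagram lam := YoungDiagram.mem_iff_lt_rowLen.2 (Nat.pos_of_ne_zero hne)
    obtain ⟨h', -⟩ := YoungDiagram.mem_ofRowLens.1 this
    exact absurd h' (not_lt.2 h)

theorem antitone_getD_rows {n : ℕ} (lam : n.Partition) :
    Antitone fun i => (rows lam).getD i 0 := fun i j hij => by
  simp only [← rowLen_diagram]
  exact (diagram lam).rowLen_anti i j hij

theorem length_le {n : ℕ} (lam : n.Partition) : length lam ≤ n := by
  have h := Multiset.card_nsmul_le_sum (s := lam.parts) (a := 1) fun x hx => lam.parts_pos hx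
  rw [lam.parts_sum] at h
  simpa [length] using h

/-- The sum of squares is weakly monotone for dominance, and tail sums are antitone, strictly at
some place since partitions with equal partial sums coincide. Hence the triangularity of Jack
functions can be stated through the energy alone. -/
theorem DominatedBy.energy_lt {K : Type*} [Field K] [LinearOrder K] [IsStrictOrderedRing K] {α : K}
    (hα : 0 < α) {n : ℕ} {mu lam : n.Partition} (h : DominatedBy mu lam) :
    energy α mu.parts < energy α lam.parts := by
  obtain ⟨hne, hdom⟩ := h
  have hl : ∀ nu : n.Partition, (rows nu).length ≤ n := fun nu =>
    (length_rows nu).trans_le (length_le nu)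
  have hsq : sumSq mu.parts ≤ sumSq lam.parts := by
    rw [← coe_rows, ← coe_rows, sumSq_eq_sum_getD _ (hl mu), sumSq_eq_sum_getD _ (hl lam)]
    refine sum_sq_le_sum_sq (antitone_getD_rows mu) (fun i => ?_) n
    rw [← sum_take_eq_sum_getD, ← sum_take_eq_sum_getD]
    exact hdom i
  have hmin : sumMin lam.parts < sumMin mu.parts := by
    have h1 := sumMin_add_sum (mu.parts.pairwise_sort (· ≥ ·)) (hl mu)
    have h2 := sumMin_add_sum (lam.parts.pairwise_sort (· ≥ ·)) (hl lam)
    change sumMin (rows mu : List ℕ) + (rows mu).sum = 2 * ∑ k ∈ _, ((rows mu).drop k).sum at h1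
    change sumMin (rows lam : List ℕ) + (rows lam).sum = 2 * ∑ k ∈ _, ((rows lam).drop k).sum at h2
    rw [coe_rows, sum_rows] at h1 h2
    have hdrop : ∀ (nu : n.Partition) (k : ℕ),
        ((rows nu).take k).sum + ((rows nu).drop k).sum = n := fun nu k => by
      rw [List.sum_take_add_sum_drop, sum_rows]
    have hex : ∃ k, ((rows mu).take k).sum < ((rows lam).take k).sum := by
      by_contra! hc
      refine hne (Nat.Partition.ext ?_)
      rw [← coe_rows, ← coe_rows, eq_of_sum_take_eq (rows_pos mu) (rows_pos lam)
        fun i => le_antisymm (hdom i) (hc i)]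
    obtain ⟨k, hk⟩ := hex
    have hkn : k < n := by
      by_contra hkn
      rw [List.take_of_length_le ((hl mu).trans (not_lt.1 hkn)),
        List.take_of_length_le ((hl lam).trans (not_lt.1 hkn)), sum_rows, sum_rows] at hk
      exact lt_irrefl _ hk
    have h3 : ∑ k ∈ Finset.range n, ((rows lam).drop k).sum
        < ∑ k ∈ Finset.range n, ((rows mu).drop k).sum := by
      refine Finset.sum_lt_sum (fun i _ => ?_) ⟨k, Finset.mem_range.2 hkn, ?_⟩
      · have := hdrop mu i
        have := hdrop lam i
        have := hdom i
        omega
      · have := hdrop mu k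
        have := hdrop lam k
        omega
    omega
  unfold energy
  rw [mu.parts_sum, lam.parts_sum]
  have h2' : (sumSq mu.parts : K) ≤ sumSq lam.parts := by exact_mod_cast hsq
  have h3' : (sumMin lam.parts : K) < sumMin mu.parts := by exact_mod_cast hmin
  have := mul_le_mul_of_nonneg_left h2' hα.le
  linarith

end Dominance

end JackConnection
namespace JackConnection

open MvPolynomial

/-! ### Top coefficients of eigenvectors of the sum of squares. -/

section TopCoefficient

variable {K : Type*} [Field K] [LinearOrder K] [IsStrictOrderedRing K] {α : K} {N : ℕ}

theorem Below.trans_coeff_cherednik (hα : 0 < α) (i : Fin N) {f : MvPolynomial (Fin N) K}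
    {κ : Fin N →₀ ℕ} (h : ∀ ν : Fin N →₀ ℕ, coeff ν f ≠ 0 → ¬ Below α κ ν) (ν : Fin N →₀ ℕ)
    (hν : coeff ν (cherednik α i f) ≠ 0) : ¬ Below α κ ν := by
  intro hb
  obtain ⟨ν', hν', rfl | h'⟩ := exists_of_coeff_cherednik_ne_zero hα hν
  · exact h _ hν' hb
  · exact h _ hν' (hb.trans h')

theorem coeff_sum_cherednik_cherednik (hα : 0 < α) {f : MvPolynomial (Fin N) K}
    {κ : Fin N →₀ ℕ} (h : ∀ ν : Fin N →₀ ℕ, coeff ν f ≠ 0 → ¬ Below α κ ν) :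
    coeff κ (∑ i, cherednik α i (cherednik α i f))
      = (α * fnEnergy α κ + ∑ i : Fin N, (i.val : K) ^ 2) * coeff κ f := by
  rw [coeff_sum, ← sum_spec_sq, Finset.sum_mul]
  refine Finset.sum_congr rfl fun i _ => ?_
  rw [coeff_cherednik hα i (Below.trans_coeff_cherednik hα i h), coeff_cherednik hα i h]
  ring

/-- At a maximal exponent of `f` the operator acts by the scalar attached to that exponent. Read
contrapositively, an eigenvector is determined by its coefficients at exponents of its own energy.
-/
theorem exists_fnEnergy_eq (hα : 0 < α) {f : MvPolynomial (Fin N) K} (hf : f ≠ 0) {e : K}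
    (he : ∑ i, cherednik α i (cherednik α i f)
      = (α * e + ∑ i : Fin N, (i.val : K) ^ 2) • f) :
    ∃ κ : Fin N →₀ ℕ, coeff κ f ≠ 0 ∧ fnEnergy α κ = e := by
  obtain ⟨κ, hκ, hmax⟩ := exists_forall_not_rel (r := fun a b : Fin N →₀ ℕ => Below α a b)
    (fun a => below_irrefl (α := α) a) (fun _ _ _ h h' => Below.trans h h')
    (Finset.nonempty_iff_ne_empty.2 fun h => hf (support_eq_empty.1 h))
  refine ⟨κ, mem_support_iff.1 hκ, ?_⟩
  have h1 := coeff_sum_cherednik_cherednik hα fun ν hν => hmax ν (mem_support_iff.2 hν)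
  rw [he, coeff_smul, smul_eq_mul] at h1
  have h2 := mul_right_cancel₀ (mem_support_iff.1 hκ) h1
  exact (mul_left_cancel₀ hα.ne' (add_right_cancel h2)).symm

theorem exists_comp_perm_moment_min (κ : Fin N → ℕ) :
    ∃ e : Equiv.Perm (Fin N), ∀ e' : Equiv.Perm (Fin N), moment (κ ∘ e) ≤ moment (κ ∘ e') := by
  obtain ⟨e, -, he⟩ := Finset.exists_min_image Finset.univ
    (fun e : Equiv.Perm (Fin N) => moment (κ ∘ e)) Finset.univ_nonempty
  exact ⟨e, fun e' => he e' (Finset.mem_univ e')⟩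

end TopCoefficient

/-! ### Jack functions are eigenfunctions of the Laplace–Beltrami operator. -/

section Eigenfunctions

variable {K : Type*} [Field K]

theorem fnEnergy_eq_energy_expParts {N : ℕ} (α : K) (d : Fin N →₀ ℕ) :
    fnEnergy α d = energy α (expParts d) := by
  rw [expParts_eq_filter, energy_filter_ne_zero, fnEnergy]

theorem expParts_comp_perm {N : ℕ} {d d' : Fin N →₀ ℕ} {e : Equiv.Perm (Fin N)}
    (h : ⇑d' = d ∘ e) : expParts d' = expParts d := by
  rw [expParts_eq_filter, expParts_eq_filter, h, ← Multiset.map_map, Multiset.map_univ_val_equiv]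

theorem coeff_powerSumEval_powerComb {N n : ℕ} (c : n.Partition → K) (d : Fin N →₀ ℕ) :
    coeff d (powerSumEval K N (powerComb c))
      = ∑ mu, c mu * powerSumEntry (rows mu) (expParts d) := by
  rw [powerComb_apply, map_sum, coeff_sum]
  refine Finset.sum_congr rfl fun mu _ => ?_
  rw [map_smul, coeff_smul, powerSumEval_powerProd, coeff_powerSumPoly, smul_eq_mul]

theorem coeff_powerSumEval_of_expParts_eq {N n : ℕ} (c : n.Partition → K) {d : Fin N →₀ ℕ}
    {mu : n.Partition} (h : expParts d = mu.parts) :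
    coeff d (powerSumEval K N (powerComb c)) = powerSumToMonomial K n c mu := by
  rw [coeff_powerSumEval_powerComb, h]
  rfl

theorem exists_partition_of_coeff_ne_zero {N n : ℕ} {c : n.Partition → K} {d : Fin N →₀ ℕ}
    (h : coeff d (powerSumEval K N (powerComb c)) ≠ 0) :
    ∃ mu : n.Partition, expParts d = mu.parts := by
  rw [coeff_powerSumEval_powerComb] at h
  obtain ⟨mu, -, hmu⟩ := Finset.exists_ne_zero_of_sum_ne_zero h
  have := sum_eq_of_powerSumEntry_ne_zero fun h0 =>
    right_ne_zero_of_mul hmu (by rw [h0, Nat.cast_zero])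
  exact ⟨partitionOf (expParts d) (expParts_ne_zero d) (this.trans (sum_rows mu)), rfl⟩

/-- The weight `α ^ ℓ(lam) z_lam`. -/
def weight (α : K) {n : ℕ} (lam : n.Partition) : K := α ^ length lam * zee lam

/-- The rows of `c` are the power sum coefficients of symmetric functions that are orthogonal and
triangular with respect to the energy. -/
structure IsJackMatrix [LinearOrder K] (α : K) {n : ℕ} (c : n.Partition → n.Partition → K) :
    Prop where
  orth : ∀ lam mu, lam ≠ mu → pairing α (powerComb (c lam)) (powerComb (c mu)) = 0
  top : ∀ lam, powerSumToMonomial K n (c lam) lam = hook α lam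
  lower : ∀ lam mu, mu ≠ lam → powerSumToMonomial K n (c lam) mu ≠ 0 →
    energy α mu.parts < energy α lam.parts

variable [LinearOrder K] [IsStrictOrderedRing K] {α : K} {n : ℕ}

theorem hook_pos (hα : 0 < α) (lam : n.Partition) : 0 < hook α lam :=
  Finset.prod_pos fun s _ => by positivity

/-- Triangularity of `D` is inherited from `∑ Y_i ^ 2` in `n` variables, enough to see every
partition of `n`. If `μ` had energy at least that of `lam`, the arrangement of `μ` with least moment
would lie below no exponent in the support, so `D` would multiply that coefficient by the energy of
`μ`. It would then vanish after subtraction, because `μ = lam` or the coefficient was already zero.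
-/
theorem powerSumToMonomial_sub_ne_zero (hα : 0 < α) {c c' : n.Partition → K}
    (hc' : laplaceBeltrami α n (powerComb c) = powerComb c') {lam : n.Partition}
    (hlow : ∀ mu, mu ≠ lam → powerSumToMonomial K n c mu ≠ 0 →
      energy α mu.parts < energy α lam.parts) {mu : n.Partition}
    (hmu : powerSumToMonomial K n (c' - energy α lam.parts • c) mu ≠ 0) :
    energy α mu.parts < energy α lam.parts := by
  by_contra hge
  rw [not_lt] at hge
  obtain ⟨κ, hκ⟩ := exists_expParts_eq_fin (zero_notMem_parts mu) (length_le mu)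
  obtain ⟨e, he⟩ := exists_comp_perm_moment_min κ
  obtain ⟨d, hd⟩ : ∃ d : Fin n →₀ ℕ, ⇑d = κ ∘ e := ⟨Finsupp.equivFunOnFinite.symm (κ ∘ e), rfl⟩
  have hdmu : expParts d = mu.parts := (expParts_comp_perm hd).trans hκ
  have hen : ∀ {ν : Fin n →₀ ℕ} {nu : n.Partition}, expParts ν = nu.parts →
      fnEnergy α ν = energy α nu.parts := fun {ν nu} h => by rw [fnEnergy_eq_energy_expParts, h]
  have hsupp : ∀ ν : Fin n →₀ ℕ, coeff ν (powerSumEval K n (powerComb c)) ≠ 0 →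
      ¬ Below α d ν := by
    rintro ν hν (hb | ⟨⟨e', he'⟩, hb⟩)
    · obtain ⟨nu, hnu⟩ := exists_partition_of_coeff_ne_zero hν
      rw [coeff_powerSumEval_of_expParts_eq c hnu] at hν
      rw [hen hdmu, hen hnu] at hb
      rcases eq_or_ne nu lam with rfl | h
      · exact absurd hb (not_lt.2 hge)
      · exact absurd (hb.trans (hlow nu h hν)) (not_lt.2 hge)
    · have h1 : ⇑ν = κ ∘ ⇑(e'.symm.trans e) := by
        funext i
        have := congrFun he' (e'.symm i)
        rw [hd] at this
        simpa using this.symm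
      rw [h1, hd] at hb
      exact absurd (he (e'.symm.trans e)) (not_le.2 hb)
  have h1 := coeff_sum_cherednik_cherednik hα hsupp
  rw [sum_cherednik_cherednik_powerSumEval α le_rfl (powerComb_mem_lengthSpan c), coeff_add,
    coeff_smul, coeff_smul, hc', coeff_powerSumEval_of_expParts_eq _ hdmu,
    coeff_powerSumEval_of_expParts_eq _ hdmu, hen hdmu, smul_eq_mul, smul_eq_mul, add_mul] at h1
  have h2 := add_right_cancel h1
  rw [mul_assoc] at h2
  have h3 := mul_left_cancel₀ hα.ne' h2
  rw [map_sub, map_smul, Pi.sub_apply, Pi.smul_apply, h3, smul_eq_mul] at hmu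
  rcases eq_or_ne mu lam with rfl | h
  · exact hmu (sub_self _)
  · refine absurd (hlow mu h fun h0 => hmu ?_) (not_lt.2 hge)
    rw [h0, mul_zero, mul_zero, sub_zero]

namespace IsJackMatrix

variable {c : n.Partition → n.Partition → K}

theorem ne_zero (hα : 0 < α) (h : IsJackMatrix α c) (lam : n.Partition) : c lam ≠ 0 := by
  intro h0
  have := h.top lam
  rw [h0, map_zero, Pi.zero_apply] at this
  exact (hook_pos hα lam).ne this

theorem norm_pos (hα : 0 < α) (h : IsJackMatrix α c) (lam : n.Partition) :
    0 < pairing α (powerComb (c lam)) (powerComb (c lam)) :=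
  pairing_self_pos hα (h.ne_zero hα lam)

/-- Orthogonality of the columns. -/
theorem sum_div_norm (hα : 0 < α) (h : IsJackMatrix α c) [DecidableEq n.Partition]
    (lam mu : n.Partition) :
    ∑ β, weight α lam * c β lam * c β mu / pairing α (powerComb (c β)) (powerComb (c β))
      = if lam = mu then 1 else 0 := by
  set A : Matrix n.Partition n.Partition K := Matrix.of c
  set B : Matrix n.Partition n.Partition K := Matrix.of fun nu β =>
    weight α nu * c β nu / pairing α (powerComb (c β)) (powerComb (c β))
  -- Orthogonality of the rows gives a right inverse of a square matrix; read as a left inverse, it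
  -- gives orthogonality of the columns.
  have hAB : A * B = 1 := by
    ext β γ
    rw [Matrix.mul_apply, Matrix.one_apply]
    have h1 : ∀ nu, A β nu * B nu γ = α ^ length nu * (zee nu : K) * c β nu * c γ nu
        / pairing α (powerComb (c γ)) (powerComb (c γ)) := fun nu => by
      simp only [A, B, Matrix.of_apply, weight]
      ring
    rw [Finset.sum_congr rfl fun nu _ => h1 nu, ← Finset.sum_div, ← pairing_powerComb]
    split_ifs with hβ
    · subst hβ
      exact div_self (h.norm_pos hα β).ne'
    · rw [h.orth β γ hβ, zero_div]
  have hBA : (B * A) lam mu = (1 : Matrix n.Partition n.Partition K) lam mu := by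
    rw [mul_eq_one_comm.1 hAB]
  rw [Matrix.mul_apply, Matrix.one_apply] at hBA
  rw [← hBA]
  refine Finset.sum_congr rfl fun β _ => ?_
  simp only [A, B, Matrix.of_apply]
  ring

theorem eq_sum_pairing (hα : 0 < α) (h : IsJackMatrix α c) (g : n.Partition → K) :
    g = ∑ β, (pairing α (powerComb g) (powerComb (c β))
      / pairing α (powerComb (c β)) (powerComb (c β))) • c β := by
  classical
  funext mu
  rw [Finset.sum_apply]
  have h1 : ∀ β, ((pairing α (powerComb g) (powerComb (c β))
      / pairing α (powerComb (c β)) (powerComb (c β))) • c β) mu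
      = ∑ lam, g lam * (weight α lam * c β lam * c β mu
        / pairing α (powerComb (c β)) (powerComb (c β))) := fun β => by
    rw [Pi.smul_apply, smul_eq_mul, pairing_powerComb, Finset.sum_div, Finset.sum_mul]
    exact Finset.sum_congr rfl fun lam _ => by rw [weight]; ring
  rw [Finset.sum_congr rfl fun β _ => h1 β, Finset.sum_comm]
  simp_rw [← Finset.mul_sum, h.sum_div_norm hα]
  simp

/-- Take a counterexample of least energy and let `g` be its defect. Triangularity allows in `g`
only Jack functions of smaller energy, which are eigenvectors by minimality. By self-adjointness and
orthogonality `g` is orthogonal to each of them, so `g = 0`. -/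
theorem laplaceBeltrami_powerComb (hα : 0 < α) (h : IsJackMatrix α c) (lam : n.Partition) :
    laplaceBeltrami α n (powerComb (c lam)) = energy α lam.parts • powerComb (c lam) := by
  classical
  by_contra hbad
  obtain ⟨lam, hlam, hmin⟩ := Finset.exists_min_image
    (Finset.univ.filter fun lam => laplaceBeltrami α n (powerComb (c lam))
      ≠ energy α lam.parts • powerComb (c lam)) (fun lam => energy α lam.parts)
    ⟨lam, Finset.mem_filter.2 ⟨Finset.mem_univ _, hbad⟩⟩
  refine (Finset.mem_filter.1 hlam).2 ?_
  obtain ⟨c', hc', -⟩ := exists_powerComb_eq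
    (laplaceBeltrami_mem_lengthSpan α n (powerComb_mem_lengthSpan (c lam)))
  set g := c' - energy α lam.parts • c lam with hg
  have hpair : ∀ β, energy α β.parts < energy α lam.parts →
      pairing α (powerComb g) (powerComb (c β)) = 0 := by
    intro β hβ
    have hβe : laplaceBeltrami α n (powerComb (c β)) = energy α β.parts • powerComb (c β) := by
      by_contra hne
      exact absurd (hmin β (Finset.mem_filter.2 ⟨Finset.mem_univ _, hne⟩)) (not_le.2 hβ)
    have hne : lam ≠ β := fun h0 => hβ.ne (by rw [h0])
    rw [hg, map_sub, map_sub, LinearMap.sub_apply, ← hc', pairing_laplaceBeltrami, hβe, map_smul,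
      map_smul, map_smul, LinearMap.smul_apply, h.orth lam β hne, smul_zero, smul_zero, sub_zero]
  set x := fun β => pairing α (powerComb g) (powerComb (c β))
    / pairing α (powerComb (c β)) (powerComb (c β)) with hx
  have hgx : g = ∑ β, x β • c β := h.eq_sum_pairing hα g
  have hx0 : ∀ β, x β = 0 := by
    by_contra! hex
    obtain ⟨β₀, hβ₀⟩ := hex
    -- For `β` of greatest energy among those occurring in `g`, no other occurring Jack function
    -- contains `m_β`. So the coefficient of `m_β` in `g` is `x β` times a hook product, which is
    -- nonzero.
    obtain ⟨β, hβ, hmax⟩ := Finset.exists_max_image (Finset.univ.filter fun β => x β ≠ 0)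
      (fun β => energy α β.parts) ⟨β₀, Finset.mem_filter.2 ⟨Finset.mem_univ _, hβ₀⟩⟩
    have hβx := (Finset.mem_filter.1 hβ).2
    have hmon : powerSumToMonomial K n g β = x β * hook α β := by
      rw [hgx, map_sum, Finset.sum_apply, Finset.sum_eq_single β]
      · rw [map_smul, Pi.smul_apply, h.top, smul_eq_mul]
      · intro ν _ hν
        rw [map_smul, Pi.smul_apply, smul_eq_mul]
        by_contra hne
        have h1 := h.lower ν β hν.symm (right_ne_zero_of_mul hne)
        exact absurd (hmax ν (Finset.mem_filter.2
          ⟨Finset.mem_univ _, left_ne_zero_of_mul hne⟩)) (not_le.2 h1)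
      · simp
    have hlt : energy α β.parts < energy α lam.parts :=
      powerSumToMonomial_sub_ne_zero hα hc' (h.lower lam)
        (by rw [← hg, hmon]; exact mul_ne_zero hβx (hook_pos hα β).ne')
    exact hβx (by rw [hx]; simp only [hpair β hlt, zero_div])
  have hg0 : g = 0 := by
    rw [hgx]
    exact Finset.sum_eq_zero fun β _ => by rw [hx0 β, zero_smul]
  rw [hc', sub_eq_zero.1 hg0, map_smul]

end IsJackMatrix

/-- The power sum coefficients of the Jack symmetric functions form a Jack matrix. -/
theorem IsJackFamily.exists_isJackMatrix (hα : 0 < α) {J : n.Partition → MvPowerSeries ℕ K}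
    (hJ : IsJackFamily α J) : ∃ c : n.Partition → n.Partition → K,
      (∀ lam mu, powerSumCoeff (J lam) mu = c lam mu) ∧ IsJackMatrix α c := by
  classical
  obtain ⟨horth, u, hu, hJu⟩ := hJ
  have hex : ∀ lam, ∃ c : n.Partition → K, J lam = ∑ mu, c mu • powerSumPart K mu := fun lam => by
    obtain ⟨c, hc⟩ := exists_sum_monomialSymm_eq (u lam)
    obtain ⟨c', hc'⟩ := exists_monomialSymm_eq (K := K) lam
    refine ⟨hook α lam • c' + c, ?_⟩
    rw [hJu, hc, hc']
    simp only [Pi.add_apply, Pi.smul_apply, smul_eq_mul, add_smul, Finset.sum_add_distrib,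
      Finset.smul_sum, smul_smul]
  choose c hc using hex
  have hcoeff : ∀ lam mu, powerSumCoeff (J lam) mu = c lam mu := fun lam mu => by
    rw [hc, powerSumCoeff_sum]
  have hmon : ∀ lam mu, powerSumToMonomial K n (c lam) mu
      = (if mu = lam then hook α lam else 0) + u lam mu := fun lam mu => by
    obtain ⟨d, hd⟩ := exists_expParts_eq (zero_notMem_parts mu)
    have h1 := congrArg (MvPowerSeries.coeff d) ((hc lam).symm.trans (hJu lam))
    rw [coeff_sum_powerSumPart, hd] at h1
    refine Eq.trans h1 ?_
    rw [map_add, map_smul, map_sum, coeff_monomialSymm, hd, Finset.sum_eq_single mu]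
    · rw [map_smul, coeff_monomialSymm, if_pos hd, smul_eq_mul, smul_eq_mul, mul_one, mul_ite,
        mul_one, mul_zero]
      simp only [Nat.Partition.ext_iff]
    · intro nu _ hnu
      rw [map_smul, coeff_monomialSymm, if_neg, smul_zero]
      rw [hd]
      exact fun h => hnu (Nat.Partition.ext h.symm)
    · simp
  refine ⟨c, hcoeff, fun lam mu hne => ?_, fun lam => ?_, fun lam mu hne h => ?_⟩
  · rw [pairing_powerComb, ← horth lam mu hne, jackInner]
    simp only [hcoeff]
  · rw [hmon, if_pos rfl, hu lam lam fun h => h.1 rfl, add_zero]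
  · rw [hmon, if_neg hne, zero_add] at h
    by_contra hlt
    exact h (hu lam mu fun hd => hlt (hd.energy_lt hα))

end Eigenfunctions

end JackConnection
namespace JackConnection

open MvPolynomial

/-! ### Rearrangements of exponents. -/

section Permutations

variable {N : ℕ}

theorem map_univ_eq_of_expParts_eq {d d' : Fin N →₀ ℕ} (h : expParts d = expParts d') :
    Finset.univ.val.map d = Finset.univ.val.map d' := by
  have h0 : ∀ s : Multiset ℕ, s = s.filter (· ≠ 0)
      + Multiset.replicate (s.card - (s.filter (· ≠ 0)).card) 0 := fun s => by
    have h1 := Multiset.filter_add_not (fun v : ℕ => v ≠ 0) s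
    have h2 : s.filter (fun v => ¬ v ≠ 0) = Multiset.replicate (s.count 0) 0 := by
      rw [← Multiset.filter_eq' s 0]
      exact Multiset.filter_congr fun x _ => not_not
    have h3 := congrArg Multiset.card h1
    rw [Multiset.card_add, h2, Multiset.card_replicate] at h3
    rw [h2] at h1
    conv_lhs => rw [← h1]
    rw [← h3, Nat.add_sub_cancel_left]
  rw [expParts_eq_filter, expParts_eq_filter] at h
  rw [h0 (Finset.univ.val.map d), h0 (Finset.univ.val.map d'), h, Multiset.card_map,
    Multiset.card_map]

theorem exists_perm_of_expParts_eq {d d' : Fin N →₀ ℕ} (h : expParts d = expParts d') :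
    ∃ e : Equiv.Perm (Fin N), ⇑d' = d ∘ e := by
  have hcard : ∀ v, Fintype.card {i // d' i = v} = Fintype.card {i // d i = v} := fun v => by
    have := congrArg (Multiset.count v) (map_univ_eq_of_expParts_eq h)
    rw [Multiset.count_map, Multiset.count_map] at this
    rw [Fintype.card_subtype, Fintype.card_subtype]
    simp only [eq_comm (b := v)]
    exact this.symm
  refine ⟨Equiv.ofFiberEquiv fun v => Fintype.equivOfCardEq (hcard v), ?_⟩
  funext i
  exact (Equiv.ofFiberEquiv_map _ i).symm

/-- The permutations carrying `d` to `κ` form a coset of the stabilizer of `κ`. -/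
theorem card_perm_comp_eq {d κ : Fin N → ℕ} {e : Equiv.Perm (Fin N)} (h : κ = d ∘ e) :
    (Finset.univ.filter fun w : Equiv.Perm (Fin N) => d ∘ w = κ).card
      = Fintype.card {w : Equiv.Perm (Fin N) // κ ∘ w = κ} := by
  rw [Fintype.card_subtype]
  refine Finset.card_equiv (Equiv.mulLeft e⁻¹) fun w => ?_
  simp only [Finset.mem_filter, Finset.mem_univ, true_and, Equiv.coe_mulLeft]
  have : κ ∘ ⇑(e⁻¹ * w) = d ∘ w := by
    rw [h]
    funext i
    simp
  rw [this]

/-- By the rearrangement inequality no rearrangement is below the increasing one, so the polynomial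
indexed by increasing exponents contains no other rearrangement of its leading monomial. This is why
increasing exponents are used. -/
theorem moment_comp_perm_le {κ : Fin N → ℕ} (hκ : Monotone κ) (e : Equiv.Perm (Fin N)) :
    moment (κ ∘ e) ≤ moment κ :=
  Monovary.sum_mul_comp_perm_le_sum_mul
    (Monotone.monovary (fun _ _ h => Fin.le_def.1 h) hκ)

end Permutations

/-! ### Symmetrization. -/

section Symmetrization

variable {K : Type*} [Field K] {N : ℕ}

theorem coeff_rename_perm (w : Equiv.Perm (Fin N)) (f : MvPolynomial (Fin N) K) (d : Fin N →₀ ℕ) :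
    ∃ d' : Fin N →₀ ℕ, ⇑d' = d ∘ w ∧ coeff d (rename w f) = coeff d' f := by
  refine ⟨d.mapDomain w.symm, ?_, ?_⟩
  · funext i
    rw [← Finsupp.equivMapDomain_eq_mapDomain, Finsupp.equivMapDomain_apply, Equiv.symm_symm]
    rfl
  · rw [← coeff_rename_mapDomain w w.injective f (d.mapDomain w.symm), ← Finsupp.mapDomain_comp,
      Equiv.self_comp_symm, Finsupp.mapDomain_id]

/-- From `s Y_i = Y_k s + 1` and `s Y_k = Y_i s - 1`, moving `s` past the two squares produces the
corrections `Y_i + Y_k` and `-(Y_i + Y_k)`, which cancel. -/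
theorem rename_swap_sum_cherednik (α : K) {i k : Fin N} (hk : k.val = i.val + 1)
    (f : MvPolynomial (Fin N) K) :
    rename (Equiv.swap i k) (∑ j, cherednik α j (cherednik α j f))
      = ∑ j, cherednik α j (cherednik α j (rename (Equiv.swap i k) f)) := by
  have hik : i ≠ k := fun h => by rw [h] at hk; omega
  have hss : ∀ g : MvPolynomial (Fin N) K,
      rename (Equiv.swap i k) (rename (Equiv.swap i k) g) = g := fun g => by
    rw [rename_rename, ← Equiv.coe_trans, Equiv.swap_swap, Equiv.coe_refl, rename_id_apply]
  have h1 : ∀ g, rename (Equiv.swap i k) (cherednik α k g)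
      = cherednik α i (rename (Equiv.swap i k) g) - g := fun g => by
    have := congrArg (rename (Equiv.swap i k))
      (rename_swap_cherednik α hk (rename (Equiv.swap i k) g))
    rw [map_add, hss, hss] at this
    rw [this, add_sub_cancel_right]
  rw [map_sum, ← Finset.add_sum_erase _ _ (Finset.mem_univ i),
    ← Finset.add_sum_erase _ _ (Finset.mem_erase.2 ⟨hik.symm, Finset.mem_univ k⟩),
    ← Finset.add_sum_erase _ _ (Finset.mem_univ i),
    ← Finset.add_sum_erase _ _ (Finset.mem_erase.2 ⟨hik.symm, Finset.mem_univ k⟩),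
    rename_swap_cherednik α hk, rename_swap_cherednik α hk, h1, h1, map_add, map_sub]
  have h2 : ∀ j ∈ (Finset.univ.erase i).erase k,
      rename (Equiv.swap i k) (cherednik α j (cherednik α j f))
        = cherednik α j (cherednik α j (rename (Equiv.swap i k) f)) := fun j hj => by
    have hjk := Finset.ne_of_mem_erase hj
    have hji := Finset.ne_of_mem_erase (Finset.mem_of_mem_erase hj)
    rw [rename_swap_cherednik_of_ne α hk hji hjk, rename_swap_cherednik_of_ne α hk hji hjk]
  rw [Finset.sum_congr rfl h2]
  ring

theorem rename_perm_sum_cherednik {M : ℕ} (α : K) (w : Equiv.Perm (Fin (M + 1)))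
    (f : MvPolynomial (Fin (M + 1)) K) :
    rename w (∑ j, cherednik α j (cherednik α j f))
      = ∑ j, cherednik α j (cherednik α j (rename w f)) := by
  have hw : w ∈ Submonoid.closure
      (Set.range fun i : Fin M => Equiv.swap i.castSucc i.succ) := by
    rw [Equiv.Perm.mclosure_swap_castSucc_succ]
    exact Submonoid.mem_top w
  induction hw using Submonoid.closure_induction generalizing f with
  | mem x hx =>
    obtain ⟨i, rfl⟩ := hx
    exact rename_swap_sum_cherednik α (by simp) f
  | one => simp
  | mul x y _ _ hx hy =>
    rw [Equiv.Perm.coe_mul, ← rename_rename, hy, hx, rename_rename]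

/-- The sum of the images of `f` under all permutations of the variables. -/
noncomputable def symmetrize (f : MvPolynomial (Fin N) K) : MvPolynomial (Fin N) K :=
  ∑ w : Equiv.Perm (Fin N), rename w f

theorem sum_cherednik_symmetrize {M : ℕ} {α S : K} {f : MvPolynomial (Fin (M + 1)) K}
    (h : ∑ j, cherednik α j (cherednik α j f) = S • f) :
    ∑ j, cherednik α j (cherednik α j (symmetrize f)) = S • symmetrize f := by
  simp only [symmetrize, map_sum]
  rw [Finset.sum_comm, Finset.smul_sum]
  refine Finset.sum_congr rfl fun w _ => ?_
  rw [← rename_perm_sum_cherednik, h, map_smul]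

theorem eval_symmetrize (f : MvPolynomial (Fin N) K) :
    eval (fun _ => 1) (symmetrize f) = (N.factorial : K) * eval (fun _ => 1) f := by
  rw [symmetrize, map_sum]
  have : ∀ w : Equiv.Perm (Fin N), eval (fun _ => (1 : K)) (rename w f) = eval (fun _ => 1) f :=
    fun w => by rw [eval_rename]; rfl
  rw [Finset.sum_congr rfl fun w _ => this w, Finset.sum_const, Finset.card_univ,
    Fintype.card_perm, Fintype.card_fin, nsmul_eq_mul]

theorem eval_powerSumEval_powerComb {n : ℕ} (a : n.Partition → K) :
    eval (fun _ => 1) (powerSumEval K N (powerComb a)) = ∑ mu, a mu * (N : K) ^ length mu := by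
  rw [powerComb_apply, map_sum, map_sum]
  refine Finset.sum_congr rfl fun mu _ => ?_
  rw [map_smul, smul_eval, powerSumEval_powerProd, powerSumPoly, map_multiset_prod,
    Multiset.map_map]
  have : ∀ k ∈ mu.parts, (eval (fun _ => (1 : K)) ∘ psum (Fin N) K) k = N := fun k _ => by
    simp [psum]
  rw [Multiset.map_congr rfl this, Multiset.map_const', Multiset.prod_replicate, length]

end Symmetrization

/-! ### Jack functions as symmetrized nonsymmetric Jack polynomials. -/

section Comparison

variable {K : Type*} [Field K] [LinearOrder K] {α : K} {n M : ℕ}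
  {c : n.Partition → n.Partition → K}

theorem IsJackMatrix.coeff_powerSumEval (h : IsJackMatrix α c) {N : ℕ} (lam : n.Partition)
    {d : Fin N →₀ ℕ} (hd : fnEnergy α d = energy α lam.parts) :
    coeff d (powerSumEval K N (powerComb (c lam)))
      = if expParts d = lam.parts then hook α lam else 0 := by
  split_ifs with hp
  · rw [coeff_powerSumEval_of_expParts_eq _ hp, h.top]
  · by_contra hne
    obtain ⟨mu, hmu⟩ := exists_partition_of_coeff_ne_zero hne
    rw [coeff_powerSumEval_of_expParts_eq _ hmu] at hne
    have h1 := h.lower lam mu (fun h0 => hp (by rw [hmu, h0])) hne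
    rw [fnEnergy_eq_energy_expParts, hmu] at hd
    exact h1.ne hd

variable [IsStrictOrderedRing K]

/-- At exponents with the energy of `κ`, only the leading monomial of `E` contributes: the rest of
its support has smaller energy, rearrangements being excluded by maximality of the moment. -/
theorem coeff_symmetrize (hα : 0 < α) {N : ℕ} {E : MvPolynomial (Fin N) K} {κ d : Fin N →₀ ℕ}
    (hE : IsNonsymJack α κ E) (hκ : Monotone κ) (hd : fnEnergy α d = fnEnergy α κ) :
    coeff d (symmetrize E)
      = ((Finset.univ.filter fun w : Equiv.Perm (Fin N) => d ∘ w = κ).card : K) := by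
  rw [symmetrize, coeff_sum, ← Finset.sum_boole]
  refine Finset.sum_congr rfl fun w _ => ?_
  obtain ⟨d', hd', h⟩ := coeff_rename_perm w E d
  rw [h]
  split_ifs with hw
  · rw [DFunLike.coe_injective (hd'.trans hw), hE.2]
  · by_contra hne
    rcases eq_or_below_of_eigen hα hE.1 hne with h1 | h1 | ⟨⟨e, he⟩, h1⟩
    · exact hw (by rw [← hd', h1])
    · rw [hd', fnEnergy_comp_perm, hd] at h1
      exact lt_irrefl _ h1
    · rw [he] at h1
      exact absurd (moment_comp_perm_le hκ e) (not_le.2 h1)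

/-- The Jack polynomials are symmetrizations of nonsymmetric Jack polynomials. -/
theorem IsJackMatrix.hook_smul_symmetrize (hα : 0 < α) (h : IsJackMatrix α c)
    (lam : n.Partition) {E : MvPolynomial (Fin (M + 1)) K} {κ : Fin (M + 1) →₀ ℕ}
    (hE : IsNonsymJack α κ E) (hκ : Monotone κ) (hκl : expParts κ = lam.parts) :
    hook α lam • symmetrize E
      = (Fintype.card {w : Equiv.Perm (Fin (M + 1)) // ⇑κ ∘ w = κ} : K)
        • powerSumEval K (M + 1) (powerComb (c lam)) := by
  set s := (Fintype.card {w : Equiv.Perm (Fin (M + 1)) // ⇑κ ∘ w = κ} : K)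
  have hen : fnEnergy α κ = energy α lam.parts := by rw [fnEnergy_eq_energy_expParts, hκl]
  set S : K := α * energy α lam.parts + ∑ i : Fin (M + 1), (i.val : K) ^ 2 with hS
  have h1 : ∑ i, cherednik α i (cherednik α i E) = S • E := by
    rw [hS, ← hen, ← sum_spec_sq, Finset.sum_smul]
    refine Finset.sum_congr rfl fun i _ => ?_
    rw [hE.1, map_smul, hE.1, smul_smul, sq]
  have h2 : ∑ i, cherednik α i (cherednik α i (powerSumEval K (M + 1) (powerComb (c lam))))
      = S • powerSumEval K (M + 1) (powerComb (c lam)) := by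
    rw [sum_cherednik_cherednik_powerSumEval α le_rfl (powerComb_mem_lengthSpan _),
      h.laplaceBeltrami_powerComb hα, map_smul, smul_smul, ← add_smul]
  rw [← sub_eq_zero]
  by_contra hne
  -- Both sides are eigenvectors for the same eigenvalue, so it suffices to compare coefficients at
  -- exponents of that energy. Different partitions may share the energy; at those both coefficients
  -- vanish.
  obtain ⟨d, hd, hde⟩ := exists_fnEnergy_eq hα hne (e := energy α lam.parts) (by
    simp only [map_sub, map_smul, Finset.sum_sub_distrib, ← Finset.smul_sum, h2,
      sum_cherednik_symmetrize h1, smul_sub]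
    rw [smul_comm, smul_comm s])
  refine hd ?_
  rw [coeff_sub, coeff_smul, coeff_smul, coeff_symmetrize hα hE hκ (hde.trans hen.symm),
    h.coeff_powerSumEval lam hde, smul_eq_mul, smul_eq_mul]
  split_ifs with hp
  · obtain ⟨e, he⟩ := exists_perm_of_expParts_eq (hp.trans hκl.symm)
    rw [card_perm_comp_eq he]
    ring
  · rw [Finset.card_eq_zero.2, Nat.cast_zero, mul_zero, mul_zero, sub_zero]
    refine Finset.filter_eq_empty_iff.2 fun w _ hw => hp ?_
    rw [← hκl]
    exact (expParts_comp_perm hw.symm).symm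

end Comparison

end JackConnection
namespace JackConnection

open MvPolynomial

/-! ### Combinatorics of the diagram and the stabilizer. -/

section HookProduct

theorem exps_append_replicate (N : ℕ) (L : List ℕ) (k : ℕ) :
    exps N (L ++ List.replicate k 0) = exps N L := by
  ext i
  rw [exps_apply, exps_apply]
  rcases lt_or_ge i.val L.length with h | h
  · rw [List.getD_append _ _ _ _ h]
  · rw [List.getD_append_right _ _ _ _ h, List.getD_eq_default L _ h]
    rcases lt_or_ge (i.val - L.length) k with h' | h'
    · rw [List.getD_eq_getElem _ _ (by simpa using h'), List.getElem_replicate]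
    · rw [List.getD_eq_default _ _ (by simpa using h')]

theorem expParts_exps_rows {N n : ℕ} (lam : n.Partition) (hN : n ≤ N) :
    expParts (exps N (rows lam)) = lam.parts := by
  have hl : (rows lam).length ≤ N := (length_rows lam).trans_le ((length_le lam).trans hN)
  rw [← exps_append_replicate N (rows lam) (N - (rows lam).length), expParts_eq_filter,
    map_exps (by simp; omega), ← Multiset.coe_add, coe_rows, Multiset.filter_add,
    Multiset.filter_eq_self.2, Multiset.filter_eq_nil.2, add_zero]
  · intro a ha
    have := List.eq_of_mem_replicate (Multiset.mem_coe.1 ha)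
    simpa using this
  · intro a ha h
    exact zero_notMem_parts lam (h ▸ ha)

/-- The increasing arrangement of the parts of `lam`. -/
noncomputable def increasing {n : ℕ} (N : ℕ) (lam : n.Partition) : Fin N →₀ ℕ :=
  exps N (stage N (diagram lam).rowLen 0)

theorem increasing_apply {N n : ℕ} (lam : n.Partition) (i : Fin N) :
    increasing N lam i = (diagram lam).rowLen (N - 1 - i) := by
  rw [increasing, exps_apply, stage, List.getD_eq_getElem _ _ (by simp)]
  simp

theorem monotone_increasing {N n : ℕ} (lam : n.Partition) : Monotone (increasing N lam) := by
  intro i j hij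
  rw [increasing_apply, increasing_apply]
  exact (diagram lam).rowLen_anti _ _ (by have := Fin.le_def.1 hij; omega)

theorem increasing_eq_comp_rev {N n : ℕ} (lam : n.Partition) :
    ⇑(increasing N lam) = exps N (rows lam) ∘ Fin.revPerm := by
  funext i
  rw [increasing_apply, rowLen_diagram, Function.comp_apply, exps_apply, Fin.revPerm_apply,
    Fin.val_rev]
  congr 1
  omega

theorem expParts_increasing {N n : ℕ} (lam : n.Partition) (hN : n ≤ N) :
    expParts (increasing N lam) = lam.parts :=
  (expParts_comp_perm (increasing_eq_comp_rev lam)).trans (expParts_exps_rows lam hN)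

theorem prod_cells {A : Type*} [CommMonoid A] (Y : YoungDiagram) {J : ℕ}
    (hJ : ∀ i, Y.rowLen i ≤ J) (f : ℕ × ℕ → A) :
    ∏ s ∈ Y.cells, f s = ∏ j ∈ Finset.range J, ∏ i ∈ Finset.range (Y.colLen j), f (i, j) := by
  refine Finset.prod_finset_product_right _ _ _ fun p => ?_
  rw [YoungDiagram.mem_cells, Finset.mem_range, Finset.mem_range, ← YoungDiagram.mem_iff_lt_colLen]
  refine ⟨fun h => ⟨?_, h⟩, fun h => h.2⟩
  exact (YoungDiagram.mem_iff_lt_rowLen.1 h).trans_le (hJ _)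

theorem lt_colLen_iff (Y : YoungDiagram) (i j : ℕ) : i < Y.colLen j ↔ j < Y.rowLen i := by
  rw [← YoungDiagram.mem_iff_lt_colLen, YoungDiagram.mem_iff_lt_rowLen]

theorem rowLen_diagram_pos_iff {n : ℕ} (lam : n.Partition) (i : ℕ) :
    0 < (diagram lam).rowLen i ↔ i < length lam := by
  rw [rowLen_diagram, ← length_rows]
  rcases lt_or_ge i (rows lam).length with h | h
  · rw [List.getD_eq_getElem _ _ h]
    exact iff_of_true (rows_pos lam _ (List.getElem_mem h)) h
  · rw [List.getD_eq_default _ _ h]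
    exact iff_of_false (lt_irrefl 0) (not_lt.2 h)

theorem colLen_zero_diagram {n : ℕ} (lam : n.Partition) :
    (diagram lam).colLen 0 = length lam :=
  eq_of_forall_lt_iff fun i => by rw [lt_colLen_iff, rowLen_diagram_pos_iff]

theorem colLen_diagram_le {n : ℕ} (lam : n.Partition) (j : ℕ) :
    (diagram lam).colLen j ≤ length lam :=
  ((diagram lam).colLen_anti 0 j (Nat.zero_le j)).trans_eq (colLen_zero_diagram lam)

theorem sum_rowLen_diagram {n : ℕ} (lam : n.Partition) :
    ∑ i ∈ Finset.range n, (diagram lam).rowLen i = n := by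
  simp only [rowLen_diagram]
  rw [← sum_take_eq_sum_getD, List.take_of_length_le, sum_rows]
  exact (length_rows lam).trans_le (length_le lam)

theorem card_cells_diagram {n : ℕ} (lam : n.Partition) : (diagram lam).cells.card = n := by
  have h : ∑ s ∈ (diagram lam).cells, 1
      = ∑ i ∈ Finset.range n, ∑ j ∈ Finset.range ((diagram lam).rowLen i), 1 := by
    refine Finset.sum_finset_product _ _ _ fun p => ?_
    rw [YoungDiagram.mem_cells, Finset.mem_range, Finset.mem_range,
      ← YoungDiagram.mem_iff_lt_rowLen]
    refine ⟨fun h => ⟨?_, h⟩, fun h => h.2⟩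
    exact ((rowLen_diagram_pos_iff lam _).1
      ((Nat.zero_le _).trans_lt (YoungDiagram.mem_iff_lt_rowLen.1 h))).trans_le (length_le lam)
  simpa [sum_rowLen_diagram] using h

theorem rowLen_diagram_le {n : ℕ} (lam : n.Partition) (i : ℕ) : (diagram lam).rowLen i ≤ n := by
  rcases lt_or_ge i n with h | h
  · conv_rhs => rw [← sum_rowLen_diagram lam]
    exact Finset.single_le_sum (f := (diagram lam).rowLen) (fun _ _ => Nat.zero_le _)
      (Finset.mem_range.2 h)
  · rw [Nat.eq_zero_of_not_pos fun h' =>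
      absurd ((rowLen_diagram_pos_iff lam i).1 h') (not_lt.2 ((length_le lam).trans h))]
    exact Nat.zero_le n

theorem card_increasing_eq {N n : ℕ} (lam : n.Partition) (v : ℕ) :
    Fintype.card {a // increasing N lam a = v}
      = ((Finset.range N).filter fun i => (diagram lam).rowLen i = v).card := by
  rw [Fintype.card_subtype]
  refine Finset.card_bij (fun a _ => N - 1 - a.val) ?_ ?_ ?_
  · intro a ha
    rw [Finset.mem_filter, increasing_apply] at ha
    exact Finset.mem_filter.2 ⟨Finset.mem_range.2 (by omega), ha.2⟩
  · intro a _ b _ hab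
    exact Fin.ext (by omega)
  · intro i hi
    rw [Finset.mem_filter, Finset.mem_range] at hi
    have h : N - 1 - (N - 1 - i) = i := by omega
    refine ⟨⟨N - 1 - i, by omega⟩, Finset.mem_filter.2 ⟨Finset.mem_univ _, ?_⟩, h⟩
    rw [increasing_apply]
    simp only [h]
    exact hi.2

theorem filter_rowLen_eq_succ {N n : ℕ} (lam : n.Partition) (hN : n ≤ N) (j : ℕ) :
    ((Finset.range N).filter fun i => (diagram lam).rowLen i = j + 1)
      = Finset.Ico ((diagram lam).colLen (j + 1)) ((diagram lam).colLen j) := by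
  ext i
  have h1 := lt_colLen_iff (diagram lam) i j
  have h2 := lt_colLen_iff (diagram lam) i (j + 1)
  have h3 := colLen_diagram_le lam j
  have h4 := length_le lam
  rw [Finset.mem_filter, Finset.mem_range, Finset.mem_Ico]
  omega

theorem filter_rowLen_eq_zero {N n : ℕ} (lam : n.Partition) :
    ((Finset.range N).filter fun i => (diagram lam).rowLen i = 0)
      = Finset.Ico (length lam) N := by
  ext i
  have h1 := rowLen_diagram_pos_iff lam i
  rw [Finset.mem_filter, Finset.mem_range, Finset.mem_Ico]
  omega

/-- The part `j + 1` has multiplicity the difference of two consecutive column lengths, and the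
entry `0` has multiplicity `N - length lam`. -/
theorem card_stabilizer_increasing {N n : ℕ} (lam : n.Partition) (hN : n ≤ N) :
    Fintype.card {w : Equiv.Perm (Fin N) // ⇑(increasing N lam) ∘ w = increasing N lam}
      = (N - length lam).factorial * ∏ j ∈ Finset.range n,
        ((diagram lam).colLen j - (diagram lam).colLen (j + 1)).factorial := by
  have hsub : Finset.univ.image (increasing N lam) ⊆ Finset.range (n + 1) := by
    intro v hv
    obtain ⟨a, -, rfl⟩ := Finset.mem_image.1 hv
    rw [increasing_apply, Finset.mem_range]
    exact Nat.lt_succ_of_le (rowLen_diagram_le lam _)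
  rw [DomMulAct.stabilizer_card', Finset.prod_subset hsub, Finset.prod_range_succ',
    card_increasing_eq, filter_rowLen_eq_zero, Nat.card_Ico, mul_comm]
  · congr 1
    refine Finset.prod_congr rfl fun j _ => ?_
    rw [card_increasing_eq, filter_rowLen_eq_succ lam hN, Nat.card_Ico]
  · intro v _ hv
    have : IsEmpty {a // increasing N lam a = v} :=
      ⟨fun a => hv (Finset.mem_image.2 ⟨a.1, Finset.mem_univ _, a.2⟩)⟩
    rw [Fintype.card_eq_zero, Nat.factorial_zero]

end HookProduct

/-! ### The principal specialization. -/

section Evaluation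

variable {K : Type*} [Field K] {α : K} {n M : ℕ}

theorem prod_range_colLen_descending (N : ℕ) (lam : n.Partition) :
    ∏ j ∈ Finset.range n, ∏ i ∈ Finset.Ico ((diagram lam).colLen (j + 1)) ((diagram lam).colLen j),
      ((N : K) - i) = ∏ i ∈ Finset.range (length lam), ((N : K) - i) := by
  have h : ∀ m, (∏ j ∈ Finset.range m,
      ∏ i ∈ Finset.Ico ((diagram lam).colLen (j + 1)) ((diagram lam).colLen j), ((N : K) - i))
      * ∏ i ∈ Finset.range ((diagram lam).colLen m), ((N : K) - i)
      = ∏ i ∈ Finset.range (length lam), ((N : K) - i) := by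
    intro m
    induction m with
    | zero => rw [Finset.prod_range_zero, one_mul, colLen_zero_diagram]
    | succ m ih =>
      rw [← ih, Finset.prod_range_succ, mul_assoc, mul_comm (∏ i ∈ Finset.Ico _ _, _),
        Finset.prod_range_mul_prod_Ico _ ((diagram lam).colLen_anti m (m + 1) (Nat.le_succ m))]
  have h0 : (diagram lam).colLen n = 0 := by
    refine Nat.eq_zero_of_not_pos fun h' => ?_
    rw [lt_colLen_iff] at h'
    exact absurd (rowLen_diagram_le lam 0) (not_le.2 h')
  rw [← h n, h0, Finset.prod_range_zero, mul_one]

theorem prod_sub_eq_factorial_div {N ℓ : ℕ} (h : ℓ ≤ N) :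
    (∏ i ∈ Finset.range ℓ, ((N : K) - i)) * ((N - ℓ).factorial : K) = N.factorial := by
  rw [← Nat.factorial_mul_descFactorial h, Nat.descFactorial_eq_prod_range, mul_comm]
  push_cast
  congr 1
  refine Finset.prod_congr rfl fun i hi => ?_
  rw [Nat.cast_sub ((Finset.mem_range.1 hi).le.trans h)]

theorem hook_eq (α : K) (lam : n.Partition) :
    hook α lam = ∏ j ∈ Finset.range n, ∏ i ∈ Finset.range ((diagram lam).colLen j),
      (α * ((diagram lam).rowLen i - (j + 1) : ℕ) - i + (diagram lam).colLen j) := by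
  rw [hook, prod_cells _ (rowLen_diagram_le lam)]
  refine Finset.prod_congr rfl fun j _ => Finset.prod_congr rfl fun i hi => ?_
  have := Finset.mem_range.1 hi
  rw [arm, leg, Nat.cast_sub (show i + 1 ≤ (diagram lam).colLen j by omega)]
  push_cast
  ring

variable [LinearOrder K] [IsStrictOrderedRing K]

theorem prod_Ico_sub_eq_factorial {a b : ℕ} (h : a ≤ b) :
    ∏ i ∈ Finset.Ico a b, ((b : K) - i) = (b - a).factorial := by
  have h1 := prod_sub_eq_factorial_div (K := K) (le_refl b)
  have h2 := prod_sub_eq_factorial_div (K := K) h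
  rw [Nat.sub_self, Nat.factorial_zero, Nat.cast_one, mul_one,
    ← Finset.prod_range_mul_prod_Ico _ h] at h1
  have h3 : ∏ i ∈ Finset.range a, ((b : K) - i) ≠ 0 := by
    intro h0
    rw [h0, zero_mul] at h2
    exact Nat.cast_ne_zero.2 (Nat.factorial_ne_zero b) h2.symm
  exact mul_left_cancel₀ h3 (h1.trans h2.symm)

/-- In rows extending beyond column `j`, the denominator of `moveFactor` is the hook factor and
cancels it. In rows ending at column `j` the move factor is `1`, the hook factors multiply to the
factorial, and the factors `N - i` supply what is missing. -/
theorem hook_mul_column (hα : 0 < α) (lam : n.Partition) (N j : ℕ) :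
    (∏ i ∈ Finset.range ((diagram lam).colLen j),
      (α * ((diagram lam).rowLen i - (j + 1) : ℕ) - i + (diagram lam).colLen j))
      * (∏ i ∈ Finset.range ((diagram lam).colLen j),
        moveFactor α N ((diagram lam).colLen j) ((diagram lam).rowLen i - (j + 1)) i)
      * (∏ i ∈ Finset.Ico ((diagram lam).colLen (j + 1)) ((diagram lam).colLen j), ((N : K) - i))
      = (∏ i ∈ Finset.range ((diagram lam).colLen j),
        (α * ((diagram lam).rowLen i - (j + 1) : ℕ) - i + N))
        * ((diagram lam).colLen j - (diagram lam).colLen (j + 1)).factorial := by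
  have hle := (diagram lam).colLen_anti j (j + 1) (Nat.le_succ j)
  rw [← prod_Ico_sub_eq_factorial hle]
  simp only [← Finset.prod_range_mul_prod_Ico _ hle]
  have h1 : ∀ i ∈ Finset.Ico ((diagram lam).colLen (j + 1)) ((diagram lam).colLen j),
      (diagram lam).rowLen i - (j + 1) = 0 := fun i hi => by
    have h2 := (Finset.mem_Ico.1 hi).1
    rw [← not_lt, lt_colLen_iff] at h2
    omega
  have e1 : ∏ i ∈ Finset.range ((diagram lam).colLen (j + 1)),
      (α * ((diagram lam).rowLen i - (j + 1) : ℕ) - i + N)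
      = (∏ i ∈ Finset.range ((diagram lam).colLen (j + 1)),
      (α * ((diagram lam).rowLen i - (j + 1) : ℕ) - i + (diagram lam).colLen j))
      * ∏ i ∈ Finset.range ((diagram lam).colLen (j + 1)),
        moveFactor α N ((diagram lam).colLen j) ((diagram lam).rowLen i - (j + 1)) i := by
    rw [← Finset.prod_mul_distrib]
    refine Finset.prod_congr rfl fun i hi => ?_
    have hi1 := Finset.mem_range.1 hi
    have hi2 := hi1
    rw [lt_colLen_iff] at hi2
    rw [moveFactor, if_neg (by omega), mul_div_cancel₀]
    have h3 : (i : K) < (diagram lam).colLen j := by exact_mod_cast hi1.trans_le hle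
    have h4 : 0 ≤ α * ((diagram lam).rowLen i - (j + 1) : ℕ) := by positivity
    exact ne_of_gt (by linarith)
  have e2 : ∏ i ∈ Finset.Ico ((diagram lam).colLen (j + 1)) ((diagram lam).colLen j),
      moveFactor α N ((diagram lam).colLen j) ((diagram lam).rowLen i - (j + 1)) i = 1 :=
    Finset.prod_eq_one fun i hi => by rw [moveFactor, if_pos (h1 i hi)]
  have e3 : ∀ x : K, ∏ i ∈ Finset.Ico ((diagram lam).colLen (j + 1)) ((diagram lam).colLen j),
      (α * ((diagram lam).rowLen i - (j + 1) : ℕ) - i + x)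
      = ∏ i ∈ Finset.Ico ((diagram lam).colLen (j + 1)) ((diagram lam).colLen j), (x - i) :=
    fun x => Finset.prod_congr rfl fun i hi => by
      rw [h1 i hi, Nat.cast_zero]
      ring
  rw [e1, e2, e3, e3]
  ring

theorem jackValue_increasing (hα : 0 < α) (lam : n.Partition) (hM : n ≤ M + 1) :
    ∃ E : MvPolynomial (Fin (M + 1)) K, IsNonsymJack α (increasing (M + 1) lam) E ∧
      eval (fun _ => 1) E = ∏ j ∈ Finset.range n, ∏ i ∈ Finset.range ((diagram lam).colLen j),
        moveFactor α (M + 1) ((diagram lam).colLen j) ((diagram lam).rowLen i - (j + 1)) i :=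
  JackValue.of_stages hα (fun i j h => (diagram lam).rowLen_anti i j h)
    (fun j => (colLen_diagram_le lam j).trans ((length_le lam).trans hM))
    (fun j i h => (lt_colLen_iff _ i j).1 h)
    (fun j i h => not_lt.1 fun h' => absurd ((lt_colLen_iff _ i j).2 h') (not_lt.2 h))
    (rowLen_diagram_le lam)

/-- The principal specialization of the Jack symmetric functions. -/
theorem IsJackMatrix.sum_mul_pow (hα : 0 < α) {c : n.Partition → n.Partition → K}
    (h : IsJackMatrix α c) (lam : n.Partition) (hM : n ≤ M + 1) :
    ∑ mu, c lam mu * ((M + 1 : ℕ) : K) ^ length mu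
      = ∏ s ∈ (diagram lam).cells,
        (α * ((diagram lam).rowLen s.1 - (s.2 + 1) : ℕ) - s.1 + (M + 1 : ℕ)) := by
  obtain ⟨E, hE, hv⟩ := jackValue_increasing hα lam hM
  have h1 := congrArg (eval fun _ => 1) (h.hook_smul_symmetrize hα lam hE
    (monotone_increasing lam) (expParts_increasing lam hM))
  have hl : length lam ≤ M + 1 := (length_le lam).trans hM
  -- The factorial of `N = M + 1` is split into `(N - ℓ)!`, which cancels against the stabilizer,
  -- and factors `N - i`, distributed over the columns in which the rows end.
  rw [smul_eval, smul_eval, eval_symmetrize, hv, eval_powerSumEval_powerComb,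
    card_stabilizer_increasing lam hM, ← prod_sub_eq_factorial_div hl,
    ← prod_range_colLen_descending, hook_eq, Nat.cast_mul, Nat.cast_prod] at h1
  have h2 : (0 : K) < ((M + 1 - length lam).factorial : K)
      * ∏ j ∈ Finset.range n,
        (((diagram lam).colLen j - (diagram lam).colLen (j + 1)).factorial : K) :=
    mul_pos (by exact_mod_cast Nat.factorial_pos _)
      (Finset.prod_pos fun j _ => by exact_mod_cast Nat.factorial_pos _)
  refine mul_left_cancel₀ h2.ne' (h1.symm.trans ?_)
  have h3 := Finset.prod_congr rfl fun j (_ : j ∈ Finset.range n) => hook_mul_column hα lam (M + 1) j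
  rw [Finset.prod_mul_distrib, Finset.prod_mul_distrib, Finset.prod_mul_distrib] at h3
  rw [prod_cells _ (rowLen_diagram_le lam)]
  linear_combination ((M + 1 - length lam).factorial : K) * h3

end Evaluation

end JackConnection
namespace JackConnection

open MvPolynomial

/-! ### The action on `p_1 ^ n`. -/

section Ones

/-- The partition `[1^n]`. -/
def ones (n : ℕ) : n.Partition where
  parts := Multiset.replicate n 1
  parts_pos := fun hi => by rw [Multiset.eq_of_mem_replicate hi]; exact Nat.one_pos
  parts_sum := by simp

theorem length_ones (n : ℕ) : length (ones n) = n := Multiset.card_replicate n 1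

theorem eq_ones_of_length_eq {n : ℕ} {mu : n.Partition} (h : length mu = n) : mu = ones n := by
  refine Nat.Partition.ext (Multiset.eq_replicate.2 ⟨h, fun b hb => ?_⟩)
  have h1 := Multiset.card_nsmul_le_sum (s := mu.parts.erase b) (a := 1) fun x hx =>
    mu.parts_pos (Multiset.mem_of_mem_erase hx)
  have h2 := Multiset.sum_erase hb
  have h3 := Multiset.card_erase_add_one hb
  have h4 := mu.parts_pos hb
  rw [mu.parts_sum] at h2
  rw [smul_eq_mul, mul_one] at h1
  change mu.parts.card = n at h
  omega

theorem toFinsupp_ones (n : ℕ) : Multiset.toFinsupp (ones n).parts = Finsupp.single 1 n := by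
  ext i
  rw [Multiset.toFinsupp_apply, ones, Multiset.count_replicate, Finsupp.single_apply]

theorem toFinsupp_rho {n : ℕ} (hn : 2 ≤ n) : Multiset.toFinsupp (rho n).parts
    = Finsupp.single 2 1 + Finsupp.single 1 (n - 2) := by
  rw [rho, dif_pos hn]
  change Multiset.toFinsupp (2 ::ₘ (ones (n - 2)).parts) = _
  rw [← Multiset.singleton_add, map_add, Multiset.toFinsupp_singleton, toFinsupp_ones]

variable {K : Type*} [Field K]

theorem powerSumNorm_single_one (α : K) (n : ℕ) :
    powerSumNorm α (Finsupp.single 1 n) = α ^ n * n.factorial := by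
  rw [powerSumNorm, Finsupp.prod_single_index (by simp), Nat.cast_one, mul_one]

theorem pairing_X_one_pow (α : K) {n : ℕ} (c : n.Partition → K) :
    pairing α (X 1 ^ n) (powerComb c) = α ^ n * n.factorial * c (ones n) := by
  rw [X_pow_eq_monomial, pairing_monomial, powerSumNorm_single_one, ← toFinsupp_ones,
    coeff_powerComb, one_mul]

theorem pairing_X_two_mul (α : K) {n : ℕ} (hn : 2 ≤ n) (c : n.Partition → K) :
    pairing α (X 2 * X 1 ^ (n - 2)) (powerComb c)
      = 2 * α ^ (n - 1) * (n - 2).factorial * c (rho n) := by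
  rw [X_pow_eq_monomial, X, monomial_mul, pairing_monomial, powerSumNorm_single_add,
    powerSumNorm_single_one, ← toFinsupp_rho hn, coeff_powerComb, Finsupp.single_eq_of_ne (by simp)]
  obtain ⟨m, rfl⟩ := Nat.exists_eq_add_of_le' hn
  simp only [Nat.add_sub_cancel, show m + 2 - 1 = m + 1 from rfl]
  push_cast
  ring

/-- Only the merging of two factors `p_1` and the diagonal term with `k = 1` survive; splitting
would need a power sum of index at least `2`. -/
theorem laplaceBeltrami_X_one_pow (α : K) {n : ℕ} (hn : 2 ≤ n) :
    laplaceBeltrami α n (X 1 ^ n) = (α * n * (n - 1)) • (X 2 * X 1 ^ (n - 2))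
      + (α * n) • X 1 ^ n := by
  have h0 : ∀ l ≠ 1, ∀ m : ℕ, pderiv l (X 1 ^ m : MvPolynomial ℕ K) = 0 := fun l hl m => by
    rw [pderiv_pow, pderiv_X_of_ne hl.symm, mul_zero]
  have h1 : ∀ m : ℕ, pderiv 1 (X 1 ^ m : MvPolynomial ℕ K) = (m : K) • X 1 ^ (m - 1) := fun m => by
    rw [pderiv_pow, pderiv_X_self, mul_one, smul_eq_C_mul, map_natCast]
  have hmem : 1 ∈ Finset.Icc 1 n := Finset.mem_Icc.2 ⟨le_rfl, by omega⟩
  rw [laplaceBeltrami_apply, Finset.sum_eq_single_of_mem 1 hmem, Finset.sum_eq_single_of_mem 1 hmem,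
    Finset.sum_eq_zero (s := Finset.Icc 1 n) (f := fun k => ∑ l ∈ Finset.Icc 1 n, _),
    Finset.sum_eq_single_of_mem 1 hmem, h1, Derivation.map_smul, h1]
  · obtain ⟨m, rfl⟩ := Nat.exists_eq_add_of_le' hn
    simp only [Nat.add_sub_cancel, show m + 2 - 1 = m + 1 from rfl, mul_smul_comm, smul_smul,
      add_zero, ← pow_succ']
    push_cast
    congr 2 <;> ring
  · intro k _ hk
    rw [h0 k hk, mul_zero, smul_zero]
  · intro k hk
    refine Finset.sum_eq_zero fun l hl => ?_
    have h3 := (Finset.mem_Icc.1 hk).1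
    have h4 := (Finset.mem_Icc.1 hl).1
    rw [h0 (k + l) (by omega), mul_zero, smul_zero]
  · intro l _ hl
    rw [h0 l hl, map_zero, mul_zero, smul_zero]
  · intro k _ hk
    refine Finset.sum_eq_zero fun l _ => ?_
    rcases eq_or_ne l 1 with rfl | hl
    · rw [h1, Derivation.map_smul, h0 k hk, smul_zero, mul_zero, smul_zero]
    · rw [h0 l hl, map_zero, mul_zero, smul_zero]

theorem X_one_pow_eq_powerComb (n : ℕ) [DecidableEq n.Partition] :
    (X 1 ^ n : MvPolynomial ℕ K) = powerComb (Pi.single (ones n) 1) := by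
  rw [powerComb_apply, Finset.sum_eq_single (ones n)]
  · rw [Pi.single_eq_same, one_smul, powerProd_eq_monomial, toFinsupp_ones, X_pow_eq_monomial]
  · intro mu _ hmu
    rw [Pi.single_eq_of_ne hmu, zero_smul]
  · simp

/-- A translate of the Laplace–Beltrami operator. -/
noncomputable def shiftedOperator (α : K) (n : ℕ) : Module.End K (MvPolynomial ℕ K) :=
  laplaceBeltrami α n - (α * n) • LinearMap.id

theorem shiftedOperator_apply (α : K) (n : ℕ) (F : MvPolynomial ℕ K) :
    shiftedOperator α n F = laplaceBeltrami α n F - (α * n) • F := rfl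

theorem lengthSpan_mono {n m m' : ℕ} (h : m' ≤ m) : lengthSpan K n m ≤ lengthSpan K n m' :=
  Submodule.span_mono fun _ ⟨s, h0, hn, hm, hF⟩ => ⟨s, h0, hn, h.trans hm, hF⟩

/-- The power `p_1^n` has `n` factors and each application loses at most one. -/
theorem shiftedOperator_pow_X_one_pow_mem (α : K) (n r : ℕ) :
    (shiftedOperator α n ^ r) (X 1 ^ n) ∈ lengthSpan K n (n - r) := by
  induction r with
  | zero =>
    rw [pow_zero, Module.End.one_apply, X_pow_eq_monomial, ← toFinsupp_ones,
      ← powerProd_eq_monomial]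
    exact powerProd_mem_lengthSpan (zero_notMem_parts _) (ones n).parts_sum (length_ones n).ge
  | succ r ih =>
    rw [pow_succ', Module.End.mul_apply, shiftedOperator_apply, ← Nat.sub_sub]
    exact Submodule.sub_mem _ (laplaceBeltrami_mem_lengthSpan α n ih)
      (Submodule.smul_mem _ _ (lengthSpan_mono (Nat.sub_le _ _) ih))

end Ones

/-! ### Eigenvalues, coefficients and the vanishing. -/

section Main

variable {K : Type*} [Field K] [LinearOrder K] [IsStrictOrderedRing K] {α : K} {n : ℕ}
  {c : n.Partition → n.Partition → K}

namespace IsJackMatrix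

/-- The principal specialization holds for infinitely many `N`, so it is an identity of polynomials
in `N`. In degree `n` the left side has only the coefficient of `p_1^n`, since `[1^n]` is the only
partition with `n` parts, while the right side is monic with one factor per box. -/
theorem apply_ones (hα : 0 < α) (h : IsJackMatrix α c) (lam : n.Partition) :
    c lam (ones n) = 1 := by
  set P : Polynomial K := ∑ mu, Polynomial.C (c lam mu) * Polynomial.X ^ length mu with hP
  set Q : Polynomial K := ∏ s ∈ (diagram lam).cells, (Polynomial.X + Polynomial.C
    (α * ((diagram lam).rowLen s.1 - (s.2 + 1) : ℕ) - s.1)) with hQ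
  have hPQ : P = Q := by
    refine Polynomial.eq_of_infinite_eval_eq P Q (Set.infinite_of_injective_forall_mem
      (f := fun k : ℕ => ((n + k + 1 : ℕ) : K)) ?_ fun k => ?_)
    · intro a b hab
      have : n + a + 1 = n + b + 1 := Nat.cast_injective hab
      omega
    · have h1 := h.sum_mul_pow hα lam (M := n + k) (by omega)
      rw [Set.mem_ofPred_eq, hP, hQ, Polynomial.eval_finsetSum, Polynomial.eval_prod]
      simp only [Polynomial.eval_mul, Polynomial.eval_C, Polynomial.eval_pow, Polynomial.eval_X,
        Polynomial.eval_add]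
      rw [h1]
      exact Finset.prod_congr rfl fun s _ => add_comm _ _
  have hQn : Q.coeff n = 1 := by
    have hmon : ∀ s ∈ (diagram lam).cells, (Polynomial.X + Polynomial.C
        (α * ((diagram lam).rowLen s.1 - (s.2 + 1) : ℕ) - s.1)).Monic :=
      fun s _ => Polynomial.monic_X_add_C _
    have hdeg : Q.natDegree = n := by
      rw [hQ, Polynomial.natDegree_prod_of_monic _ _ hmon]
      rw [Finset.sum_congr rfl fun s _ => Polynomial.natDegree_X_add_C _, Finset.sum_const,
        card_cells_diagram, smul_eq_mul, mul_one]
    have := Polynomial.monic_prod_of_monic _ _ hmon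
    rw [Polynomial.Monic, Polynomial.leadingCoeff, ← hQ, hdeg] at this
    exact this
  have hPn : P.coeff n = c lam (ones n) := by
    rw [hP, Polynomial.finsetSum_coeff, Finset.sum_eq_single (ones n)]
    · rw [Polynomial.coeff_C_mul_X_pow, if_pos (length_ones n).symm]
    · intro mu _ hmu
      rw [Polynomial.coeff_C_mul_X_pow, if_neg]
      exact fun h0 => hmu (eq_ones_of_length_eq h0.symm)
    · simp
  rw [← hPn, hPQ, hQn]

/-- Compute `⟨D p_1^n, J⟩ = ⟨p_1^n, D J⟩` on both sides. The left side reads off the coefficients of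
`p_ρ` and `p_1^n` in `J`, the right side is the eigenvalue times the latter, which is `1`. -/
theorem energy_eq (hα : 0 < α) (h : IsJackMatrix α c) (hn : 2 ≤ n) (lam : n.Partition) :
    energy α lam.parts = 2 * c lam (rho n) + α * n := by
  have h1 := pairing_laplaceBeltrami α n (X 1 ^ n) (powerComb (c lam))
  rw [laplaceBeltrami_X_one_pow α hn, h.laplaceBeltrami_powerComb hα, map_add,
    LinearMap.add_apply, map_smul, map_smul, map_smul, LinearMap.smul_apply, LinearMap.smul_apply,
    pairing_X_one_pow, pairing_X_two_mul α hn, h.apply_ones hα, smul_eq_mul, smul_eq_mul,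
    smul_eq_mul] at h1
  obtain ⟨m, rfl⟩ := Nat.exists_eq_add_of_le' hn
  have h2 : (α ^ (m + 2) * ((m + 2).factorial : K)) ≠ 0 :=
    mul_ne_zero (pow_pos hα _).ne' (Nat.cast_ne_zero.2 (Nat.factorial_ne_zero _))
  refine mul_left_cancel₀ h2 ?_
  simp only [Nat.add_sub_cancel, show m + 2 - 1 = m + 1 from rfl, Nat.factorial_succ] at h1 ⊢
  push_cast at h1 ⊢
  linear_combination -h1

theorem shiftedOperator_pow (hα : 0 < α) (h : IsJackMatrix α c) (hn : 2 ≤ n) (r : ℕ)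
    (lam : n.Partition) : (shiftedOperator α n ^ r) (powerComb (c lam))
      = (2 * c lam (rho n)) ^ r • powerComb (c lam) := by
  induction r with
  | zero => simp
  | succ r ih =>
    rw [pow_succ', Module.End.mul_apply, ih, map_smul, shiftedOperator_apply,
      h.laplaceBeltrami_powerComb hα, h.energy_eq hα hn, ← sub_smul, add_sub_cancel_right,
      smul_smul, pow_succ]

/-- Expand `p_1^n` in Jack functions and apply the shifted operator `r` times. The coefficient of
`p_lam` is `α^n n! 2^r` times the sum, and it vanishes since `lam` has fewer than `n - r` parts. -/
theorem sum_pow_eq_zero (hα : 0 < α) (h : IsJackMatrix α c) (hn : 2 ≤ n) {lam : n.Partition}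
    {r : ℕ} (hr : r < n - length lam) :
    ∑ β, c β lam * c β (rho n) ^ r / pairing α (powerComb (c β)) (powerComb (c β)) = 0 := by
  classical
  set w : K := α ^ n * n.factorial
  have h1 := shiftedOperator_pow_X_one_pow_mem α n r
  have h2 : (X 1 ^ n : MvPolynomial ℕ K)
      = ∑ β, (w / pairing α (powerComb (c β)) (powerComb (c β))) • powerComb (c β) := by
    have h3 := congrArg powerComb (h.eq_sum_pairing hα (Pi.single (ones n) 1))
    rw [map_sum, ← X_one_pow_eq_powerComb] at h3
    rw [h3]
    refine Finset.sum_congr rfl fun β _ => ?_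
    rw [map_smul, pairing_X_one_pow, h.apply_ones hα, mul_one]
  obtain ⟨c', hc', hlow⟩ := exists_powerComb_eq h1
  have h4 := congrArg (coeff (Multiset.toFinsupp lam.parts)) hc'
  rw [coeff_powerComb, hlow lam (by omega), h2, map_sum, coeff_sum] at h4
  have h5 : w * 2 ^ r ≠ 0 := mul_ne_zero
    (mul_ne_zero (pow_pos hα n).ne' (Nat.cast_ne_zero.2 n.factorial_ne_zero))
    (pow_ne_zero r two_ne_zero)
  refine (mul_eq_zero.1 (Eq.trans ?_ h4)).resolve_left h5
  rw [Finset.mul_sum]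
  refine Finset.sum_congr rfl fun β _ => ?_
  rw [map_smul, h.shiftedOperator_pow hα hn, coeff_smul, coeff_smul, coeff_powerComb, smul_eq_mul,
    smul_eq_mul]
  ring

end IsJackMatrix

end Main

end JackConnection

theorem mainTheorem5 {K : Type*} [Field K] [LinearOrder K] [IsStrictOrderedRing K]
    (α : K) (hα : 0 < α) (n : ℕ)
    (J : n.Partition → MvPowerSeries ℕ K) (hJ : JackConnection.IsJackFamily α J)
    (lam : n.Partition) (r : ℕ) (hr : r < n - JackConnection.length lam) :
    JackConnection.connectionCoeffRho α J r lam = 0 := by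
  obtain ⟨c, hc, hJc⟩ := hJ.exists_isJackMatrix hα
  -- For `n < 2` the partition `rho n` is a dummy. The bound on `r` excludes this case: it forces `n
  -- > 0`, then `lam` has at least one part, and `n` exceeds the number of parts.
  have hn : 2 ≤ n := by
    have h1 : JackConnection.length lam ≠ 0 := fun h0 => by
      have h2 := lam.parts_sum
      rw [Multiset.card_eq_zero.1 h0, Multiset.sum_zero] at h2
      omega
    omega
  rw [JackConnection.connectionCoeffRho, JackConnection.connectionCoeff,
    ← hJc.sum_pow_eq_zero hα hn hr]
  refine Finset.sum_congr rfl fun β _ => ?_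
  rw [Fin.prod_univ_succ, Fin.cons_zero]
  simp only [Fin.cons_succ, Finset.prod_const, Finset.card_univ, Fintype.card_fin, hc]
  rw [JackConnection.pairing_powerComb, JackConnection.jackInner]
  simp only [hc]
  rw [one_div, inv_mul_eq_div]
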